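/- Let $0<x_0<L<\infty$. Let $H^1_L=H^1_0((-L,L))$ and let $H^{-1}_L=(H^1_L)'$ be its dual (both complexified), with $u\in H^1_L$ regarded as the element $v\mapsto\int_{-L}^L uv\,dx$ of $H^{-1}_L$. For $\beta\in\mathbb R$ let $A_{L,\beta}$ be the unbounded operator on $H^{-1}_L$ with domain $H^1_L$ given by $$\langle A_{L,\beta}u,v\rangle=\int_{-L}^L u_xv_x\,dx+\beta\,u(x_0)\,v(0),\qquad u,v\in H^1_L,$$ and let $A'_{L,\beta}$ be its adjoint, $\langle A_{L,\beta}u,v\rangle=\langle u,A'_{L,\beta}v\rangle$ for $u,v\in H^1_L$. Order $H^1_L$ pointwise, and call $f\in H^{-1}_L$ positive ($f\ge 0$) if $\langle f,v\rangle\ge 0$ for all $0\le v\in H^1_L$. Then: 1. For every $\beta\in\mathbb R$, $-A_{L,\beta}$ generates an analytic $c_0$-semigroup $(e^{-tA_{L,\beta}})_{t\ge0}$ on $H^{-1}_L$. 2. This semigroup is positive (i.e. $f\ge0$ implies $e^{-tA_{L,\beta}}f\ge0$ for all $t\ge0$) if and only if $\beta\le0$. 3. There is $\beta_+>0$ (depending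 on $L,x_0$) such that for every $\beta<\beta_+$ the operators $A_{L,\beta}$ and $A'_{L,\beta}$ have a common first eigenvalue $\mu\in\mathbb R$ (for each of the two operators, $\mu$ is an eigenvalue whose eigenspace is one-dimensional, and every other eigenvalue $\nu\in\mathbb C$ satisfies $\operatorname{Re}\nu>\mu$), with eigenfunctions $\varphi$ and $\psi$, respectively, that are strictly positive on $(-L,L)$; and such that for every $\beta\in(0,\beta_+)$ the semigroup is individually eventually positive: for every $0\le f\in H^{-1}_L$ there is $t_0\ge0$ with $e^{-tA_{L,\beta}}f\ge0$ for all $t\ge t_0$. -/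

import Mathlib

open MeasureTheory Set Filter Topology
open scoped ContDiff ComplexOrder NNReal ENNReal

noncomputable section

namespace PointHeat

/-! ### The Sobolev space `H¹₀(-L, L)` (complex valued) and its dual -/

/-- The space `L²(-L, L)` of complex valued functions. -/
abbrev LTwo (L : ℝ) : Type := Lp ℂ 2 (volume.restrict (Ioo (-L) L))

/-- The pairs `(φ, φ')`, `φ` a test function on `(-L, L)`, inside `L² × L²` with the norm
`(‖a‖² + ‖b‖²)^{1/2}`; thus the test functions with the `H¹` norm. -/
def testPairs (L : ℝ) : Submodule ℂ (WithLp 2 (LTwo L × LTwo L)) where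
  carrier := {w | ∃ φ : ℝ → ℂ, ContDiff ℝ ∞ φ ∧ HasCompactSupport φ ∧ tsupport φ ⊆ Ioo (-L) L ∧
    w.fst =ᵐ[volume.restrict (Ioo (-L) L)] φ ∧
    w.snd =ᵐ[volume.restrict (Ioo (-L) L)] deriv φ}
  zero_mem' := by
    refine ⟨0, contDiff_const, HasCompactSupport.zero, by simp, Lp.coeFn_zero _ _ _, ?_⟩
    have h : deriv (0 : ℝ → ℂ) = 0 := by ext x; exact deriv_const x (0 : ℂ)
    rw [h]
    exact Lp.coeFn_zero _ _ _
  add_mem' := by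
    rintro v w ⟨φ, h1, h2, h3, h4, h5⟩ ⟨ψ, k1, k2, k3, k4, k5⟩
    refine ⟨φ + ψ, h1.add k1, h2.add k2,
      (tsupport_add φ ψ).trans (union_subset h3 k3), ?_, ?_⟩
    · exact (Lp.coeFn_add v.fst w.fst).trans (h4.add k4)
    · have h : deriv (φ + ψ) = deriv φ + deriv ψ := by
        ext x
        exact deriv_add (h1.differentiable (by simp) x) (k1.differentiable (by simp) x)
      rw [h]
      exact (Lp.coeFn_add v.snd w.snd).trans (h5.add k5)
  smul_mem' := by
    rintro c w ⟨φ, h1, h2, h3, h4, h5⟩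
    refine ⟨c • φ, contDiff_const.smul h1, h2.smul_left,
      (tsupport_smul_subset_right (fun _ => c) φ).trans h3, ?_, ?_⟩
    · exact (Lp.coeFn_smul c w.fst).trans (h4.const_smul c)
    · have h : deriv (c • φ) = c • deriv φ := by
        ext x
        exact deriv_const_smul c (h1.differentiable (by simp) x)
      rw [h]
      exact (Lp.coeFn_smul c w.snd).trans (h5.const_smul c)

/-- `H¹₀(-L, L)`: the closure of the test functions in the `H¹` norm. An element is a pair
consisting of the class of `u` and of its weak derivative `u'`. -/
abbrev H10 (L : ℝ) : Type := (testPairs L).topologicalClosure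

/-- `H⁻¹(-L, L)`: the dual space of `H¹₀(-L, L)`, with the dual norm. -/
abbrev Hm1 (L : ℝ) : Type := H10 L →L[ℂ] ℂ

/-- The function `u` in `L²` underlying an element of `H¹₀`. -/
def fn (L : ℝ) : H10 L →L[ℂ] LTwo L :=
  (WithLp.fstL 2 ℂ (LTwo L) (LTwo L)).comp (testPairs L).topologicalClosure.subtypeL

/-- The weak derivative `u'` in `L²` of an element `u` of `H¹₀`. -/
def wderiv (L : ℝ) : H10 L →L[ℂ] LTwo L :=
  (WithLp.sndL 2 ℂ (LTwo L) (LTwo L)).comp (testPairs L).topologicalClosure.subtypeL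

/-- The Dirac functional `δ_x ∈ H⁻¹`, i.e. the evaluation at `x` of the continuous
representative of `u ∈ H¹₀`, which is `u(x) = ∫_{-L}^x u'(y) dy`; see `fn_ae_eq_dirac`. -/
def dirac (L x : ℝ) : Hm1 L :=
  (innerSL ℂ (indicatorConstLp 2 (μ := volume.restrict (Ioo (-L) L)) (s := Iic x)
    measurableSet_Iic (measure_ne_top _ _) (1 : ℂ))).comp (wderiv L)

theorem dirac_apply (L x : ℝ) (u : H10 L) :
    dirac L x u = ∫ y in Ioo (-L) L ∩ Iic x, wderiv L u y := by
  rw [inter_comm, ← Measure.restrict_restrict measurableSet_Iic]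
  simp [dirac, L2.inner_indicatorConstLp_one]

/-- The pairing `(f, g) ↦ ∫ f g` on `L²` (bilinear, without conjugation). -/
def pairing (L : ℝ) : LTwo L →L[ℂ] LTwo L →L[ℂ] ℂ :=
  (ContinuousLinearMap.mul ℂ ℂ).lpPairing (volume.restrict (Ioo (-L) L)) 2 2

theorem pairing_apply (L : ℝ) (f g : LTwo L) :
    pairing L f g = ∫ x in Ioo (-L) L, f x * g x := by
  simp [pairing, ContinuousLinearMap.lpPairing_eq_integral]

/-- The embedding `H¹₀ → H⁻¹`, `⟨ι u, v⟩ = ∫ u v`. -/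
def emb (L : ℝ) : H10 L →L[ℂ] Hm1 L := (pairing L).bilinearComp (fn L) (fn L)

theorem emb_apply (L : ℝ) (u v : H10 L) :
    emb L u v = ∫ x in Ioo (-L) L, fn L u x * fn L v x := pairing_apply ..

/-! ### The operators -/

/-- `A_L`, induced by the Dirichlet form: `⟨A_L u, v⟩ = ∫ u' v'`. -/
def opA (L : ℝ) : H10 L →L[ℂ] Hm1 L := (pairing L).bilinearComp (wderiv L) (wderiv L)

theorem opA_apply (L : ℝ) (u v : H10 L) :
    opA L u v = ∫ x in Ioo (-L) L, wderiv L u x * wderiv L v x := pairing_apply ..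

/-- `A_{L,β} u = A_L u + β u(x₀) δ₀`, as a bounded operator `H¹₀ → H⁻¹`. -/
def opAβ (L x₀ β : ℝ) : H10 L →L[ℂ] Hm1 L :=
  opA L + (β : ℂ) • (dirac L x₀).smulRight (dirac L 0)

theorem opAβ_apply (L x₀ β : ℝ) (u v : H10 L) :
    opAβ L x₀ β u v = opA L u v + β * (dirac L x₀ u * dirac L 0 v) := by
  simp [opAβ]

/-- The adjoint `A'_{L,β}` with respect to the duality of `H⁻¹` and `H¹₀`:
`⟨A_{L,β} u, v⟩ = ⟨u, A'_{L,β} v⟩`. -/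
def opAβ' (L x₀ β : ℝ) : H10 L →L[ℂ] Hm1 L := (opAβ L x₀ β).flip


/-- A test function on `(-L, L)` as an element of `H¹₀(-L, L)`. -/
theorem exists_test (L : ℝ) {φ : ℝ → ℂ} (h1 : ContDiff ℝ ∞ φ) (h2 : HasCompactSupport φ)
    (h3 : tsupport φ ⊆ Ioo (-L) L) : ∃ u : H10 L,
      fn L u =ᵐ[volume.restrict (Ioo (-L) L)] φ ∧
      wderiv L u =ᵐ[volume.restrict (Ioo (-L) L)] deriv φ := by
  have m1 : MemLp φ 2 (volume.restrict (Ioo (-L) L)) :=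
    (h1.continuous.memLp_of_hasCompactSupport h2).restrict _
  have m2 : MemLp (deriv φ) 2 (volume.restrict (Ioo (-L) L)) :=
    ((h1.continuous_deriv (by simp)).memLp_of_hasCompactSupport h2.deriv).restrict _
  exact ⟨⟨WithLp.toLp 2 (m1.toLp, m2.toLp), (testPairs L).le_topologicalClosure
    ⟨φ, h1, h2, h3, m1.coeFn_toLp, m2.coeFn_toLp⟩⟩, m1.coeFn_toLp, m2.coeFn_toLp⟩

theorem closure_induction {L : ℝ} {P : H10 L → Prop} (hP : IsClosed {u | P u})
    (h : ∀ (u : H10 L) (φ : ℝ → ℂ), ContDiff ℝ ∞ φ → HasCompactSupport φ →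
      tsupport φ ⊆ Ioo (-L) L → fn L u =ᵐ[volume.restrict (Ioo (-L) L)] φ →
      wderiv L u =ᵐ[volume.restrict (Ioo (-L) L)] deriv φ → P u) (u : H10 L) : P u := by
  have hd : Dense {u : H10 L | (u : WithLp 2 (LTwo L × LTwo L)) ∈ testPairs L} := by
    intro v
    rw [closure_subtype]
    have : ((fun x : H10 L => (x : WithLp 2 (LTwo L × LTwo L))) ''
      {u : H10 L | (u : WithLp 2 (LTwo L × LTwo L)) ∈ testPairs L}) = testPairs L := by
      ext w
      constructor
      · rintro ⟨z, hz, rfl⟩; exact hz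
      · intro hw; exact ⟨⟨w, (testPairs L).le_topologicalClosure hw⟩, hw, rfl⟩
    rw [this]
    exact v.2
  have : closure {u : H10 L | (u : WithLp 2 (LTwo L × LTwo L)) ∈ testPairs L} ⊆ {u | P u} := by
    refine closure_minimal ?_ hP
    rintro v ⟨φ, h1, h2, h3, h4, h5⟩
    exact h v φ h1 h2 h3 h4 h5
  exact this (hd u)

/-- On a test function `φ`, the functional `δ_x` is evaluation at `x`. -/
theorem dirac_test {L x : ℝ} (hx : x ∈ Ioo (-L) L) {u : H10 L} {φ : ℝ → ℂ} (h1 : ContDiff ℝ ∞ φ)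
    (h3 : tsupport φ ⊆ Ioo (-L) L)
    (h5 : wderiv L u =ᵐ[volume.restrict (Ioo (-L) L)] deriv φ) : dirac L x u = φ x := by
  rw [dirac_apply]
  have e : Ioo (-L) L ∩ Iic x = Ioc (-L) x := by
    ext y; simp only [mem_inter_iff, mem_Ioo, mem_Iic, mem_Ioc]
    exact ⟨fun h => ⟨h.1.1, h.2⟩, fun h => ⟨⟨h.1, h.2.trans_lt hx.2⟩, h.2⟩⟩
  have h6 := ae_restrict_of_ae_restrict_of_subset (inter_subset_left (t := Iic x)) h5
  rw [integral_congr_ae h6, e, ← intervalIntegral.integral_of_le hx.1.le,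
    intervalIntegral.integral_deriv_eq_sub (fun y _ => h1.differentiable (by simp) y)
      ((h1.continuous_deriv (by simp)).intervalIntegrable _ _)]
  have : φ (-L) = 0 := image_eq_zero_of_notMem_tsupport fun h => lt_irrefl _ (h3 h).1
  rw [this, sub_zero]

/-- Every `u ∈ H¹₀` agrees almost everywhere with `x ↦ δ_x(u)`. -/
theorem fn_ae_eq_dirac (L : ℝ) (u : H10 L) :
    fn L u =ᵐ[volume.restrict (Ioo (-L) L)] fun x => dirac L x u := by
  have hd : u ∈ closure {v : H10 L | fn L v =ᵐ[volume.restrict (Ioo (-L) L)]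
      fun x => dirac L x v} := by
    refine closure_induction (P := fun u => u ∈ closure {v : H10 L |
      fn L v =ᵐ[volume.restrict (Ioo (-L) L)] fun x => dirac L x v}) isClosed_closure ?_ u
    intro v φ h1 h2 h3 h4 h5
    refine subset_closure ?_
    filter_upwards [h4, ae_restrict_mem measurableSet_Ioo] with x hx hm
    rw [hx, dirac_test hm h1 h3 h5]
  obtain ⟨v, hv, hvu⟩ := mem_closure_iff_seq_limit.1 hd
  have ht := tendstoInMeasure_of_tendsto_Lp (((fn L).continuous.tendsto u).comp hvu)
  obtain ⟨ns, hns, hae⟩ := ht.exists_seq_tendsto_ae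
  have hall := ae_all_iff.2 fun n => hv (ns n)
  filter_upwards [hae, hall] with x hx ha
  refine tendsto_nhds_unique hx ?_
  have := (((dirac L x).continuous.tendsto u).comp hvu).comp hns.tendsto_atTop
  refine this.congr fun n => ?_
  exact (ha n).symm

/-- `wderiv u` is the weak derivative of `fn u`. -/
theorem wderiv_weak (L : ℝ) (u : H10 L) {φ : ℝ → ℂ} (h1 : ContDiff ℝ ∞ φ)
    (h2 : HasCompactSupport φ) (h3 : tsupport φ ⊆ Ioo (-L) L) :
    ∫ x in Ioo (-L) L, wderiv L u x * φ x = -∫ x in Ioo (-L) L, fn L u x * deriv φ x := by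
  obtain ⟨w, hw1, hw2⟩ := exists_test L h1 h2 h3
  have e1 : ∀ v : H10 L, ∫ x in Ioo (-L) L, wderiv L v x * φ x =
      pairing L (wderiv L v) (fn L w) := fun v => by
    rw [pairing_apply]
    exact integral_congr_ae (hw1.mono fun x hx => by simp only [hx])
  have e2 : ∀ v : H10 L, ∫ x in Ioo (-L) L, fn L v x * deriv φ x =
      pairing L (fn L v) (wderiv L w) := fun v => by
    rw [pairing_apply]
    exact integral_congr_ae (hw2.mono fun x hx => by simp only [hx])
  rw [e1, e2]
  refine closure_induction (P := fun v => pairing L (wderiv L v) (fn L w) =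
    -pairing L (fn L v) (wderiv L w)) (isClosed_eq (by fun_prop) (by fun_prop)) ?_ u
  intro v ψ k1 k2 k3 k4 k5
  rw [← e1, ← e2]
  have f1 : ∫ x in Ioo (-L) L, wderiv L v x * φ x = ∫ x, deriv ψ x * φ x := by
    rw [← setIntegral_eq_integral_of_forall_compl_eq_zero (s := Ioo (-L) L)
      (f := fun x => deriv ψ x * φ x)]
    · exact integral_congr_ae (k5.mono fun x hx => by simp only [hx])
    · intro x hx
      rw [image_eq_zero_of_notMem_tsupport fun h => hx (h3 h), mul_zero]
  have f2 : ∫ x in Ioo (-L) L, fn L v x * deriv φ x = ∫ x, ψ x * deriv φ x := by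
    rw [← setIntegral_eq_integral_of_forall_compl_eq_zero (s := Ioo (-L) L)
      (f := fun x => ψ x * deriv φ x)]
    · exact integral_congr_ae (k4.mono fun x hx => by simp only [hx])
    · intro x hx
      rw [image_eq_zero_of_notMem_tsupport fun h => hx (k3 h), zero_mul]
  rw [f1, f2]
  have c1 := h1.continuous
  have c2 := k1.continuous
  have c3 := h1.continuous_deriv (by simp)
  have c4 := k1.continuous_deriv (by simp)
  have := integral_mul_deriv_eq_deriv_mul_of_integrable (u := ψ) (v := φ) (u' := deriv ψ)
    (v' := deriv φ) (fun x _ => (k1.differentiable (by simp) x).hasDerivAt)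
    (fun x _ => (h1.differentiable (by simp) x).hasDerivAt)
    ((c2.mul c3).integrable_of_hasCompactSupport k2.mul_right)
    ((c4.mul c1).integrable_of_hasCompactSupport h2.mul_left)
    ((c2.mul c1).integrable_of_hasCompactSupport h2.mul_left)
  rw [this, neg_neg]

theorem ae_eq_zero_of_test {L : ℝ} (f : LTwo L) (h : ∀ φ : ℝ → ℂ, ContDiff ℝ ∞ φ →
    HasCompactSupport φ → tsupport φ ⊆ Ioo (-L) L → ∫ x in Ioo (-L) L, f x * φ x = 0) :
    f = 0 := by
  have hint : IntegrableOn f (Ioo (-L) L) := (Lp.memLp f).integrable (by norm_num)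
  have := isOpen_Ioo.ae_eq_zero_of_integral_contDiff_smul_eq_zero hint.locallyIntegrableOn
    (fun g g1 g2 g3 => by
      have := h (fun x => (g x : ℂ)) (Complex.ofRealCLM.contDiff.comp g1)
        (g2.comp_left (g := fun x : ℝ => (x : ℂ)) (by simp))
        ((tsupport_comp_subset (g := fun x : ℝ => (x : ℂ)) (by simp) g).trans g3)
      rw [← setIntegral_eq_integral_of_forall_compl_eq_zero (s := Ioo (-L) L), ← this]
      · simp [mul_comm]
      · intro x hx
        rw [image_eq_zero_of_notMem_tsupport fun h => hx (g3 h), zero_smul])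
  rw [Lp.eq_zero_iff_ae_eq_zero]
  exact (ae_restrict_iff' measurableSet_Ioo).2 this

theorem emb_injective (L : ℝ) : Function.Injective (emb L) := by
  rw [injective_iff_map_eq_zero]
  intro u hu
  have hf : fn L u = 0 := ae_eq_zero_of_test _ fun φ h1 h2 h3 => by
    obtain ⟨w, hw1, -⟩ := exists_test L h1 h2 h3
    have := emb_apply L u w
    rw [hu] at this
    refine Eq.trans ?_ this.symm
    exact integral_congr_ae (hw1.mono fun x hx => by simp only [hx])
  have hw : wderiv L u = 0 := ae_eq_zero_of_test _ fun φ h1 h2 h3 => by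
    rw [wderiv_weak L u h1 h2 h3, neg_eq_zero, hf]
    refine integral_eq_zero_of_ae ?_
    filter_upwards [Lp.coeFn_zero ℂ 2 (volume.restrict (Ioo (-L) L))] with x hx
    rw [hx]
    simp
  apply Subtype.ext
  apply WithLp.ofLp_injective
  exact Prod.ext hf hw


/-- `x ↦ δ_x(u)` is continuous on `(-L, L)`. -/
theorem continuousOn_dirac (L : ℝ) (u : H10 L) :
    ContinuousOn (fun x => dirac L x u) (Ioo (-L) L) := by
  have hint : IntegrableOn (wderiv L u) (Ioo (-L) L) := (Lp.memLp _).integrable (by norm_num)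
  have hi : Integrable ((Ioo (-L) L).indicator (wderiv L u)) :=
    (integrable_indicator_iff measurableSet_Ioo).2 hint
  refine (intervalIntegral.continuous_primitive (fun a b => hi.intervalIntegrable)
    (-L)).continuousOn.congr fun x hx => ?_
  simp only
  rw [dirac_apply, intervalIntegral.integral_of_le hx.1.le, setIntegral_indicator measurableSet_Ioo]
  congr 2
  ext y
  simp only [mem_inter_iff, mem_Ioo, mem_Iic, mem_Ioc]
  tauto

/-- `A_{L,β}` as an unbounded operator on `H⁻¹` with domain (the image of) `H¹₀`. -/
def unbddA (L x₀ β : ℝ) : Hm1 L →ₗ.[ℂ] Hm1 L where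
  domain := LinearMap.range (emb L).toLinearMap
  toFun := (opAβ L x₀ β).toLinearMap ∘ₗ
    (LinearEquiv.ofInjective (emb L).toLinearMap (emb_injective L)).symm.toLinearMap

theorem mem_graph_unbddA (L x₀ β : ℝ) (f g : Hm1 L) :
    (f, g) ∈ (unbddA L x₀ β).graph ↔ ∃ u : H10 L, f = emb L u ∧ g = opAβ L x₀ β u := by
  rw [LinearPMap.mem_graph_iff]
  constructor
  · rintro ⟨⟨y, u, rfl⟩, h1, h2⟩
    refine ⟨u, h1.symm, h2.symm.trans (congrArg (opAβ L x₀ β) ?_)⟩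
    exact (LinearEquiv.symm_apply_eq _).2 rfl
  · rintro ⟨u, rfl, rfl⟩
    refine ⟨⟨emb L u, u, rfl⟩, rfl, congrArg (opAβ L x₀ β) ?_⟩
    exact (LinearEquiv.symm_apply_eq _).2 rfl

/-! ### Semigroups -/

section Semigroup

variable {X : Type*} [NormedAddCommGroup X] [NormedSpace ℂ X]

/-- `(T(t))_{t ≥ 0}` is a strongly continuous (`c₀`-) semigroup of bounded operators. -/
structure IsC0Semigroup (T : ℝ≥0 → X →L[ℂ] X) : Prop where
  map_zero : T 0 = 1
  map_add : ∀ s t, T (s + t) = T s * T t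
  continuous : ∀ x, Continuous fun t => T t x

/-- The open sector of half-angle `δ` around the positive real axis. -/
def sector (δ : ℝ) : Set ℂ := {z | z ≠ 0 ∧ |z.arg| < δ}

/-- A `c₀`-semigroup is analytic if it extends to a holomorphic operator valued function `S` on a
sector, satisfying the semigroup law, and strongly continuous at `0` in smaller sectors. -/
structure IsAnalyticSemigroup (T : ℝ≥0 → X →L[ℂ] X) : Prop extends IsC0Semigroup T where
  analytic : ∃ δ : ℝ, 0 < δ ∧ δ ≤ Real.pi / 2 ∧ ∃ S : ℂ → X →L[ℂ] X,
    (∀ t : ℝ≥0, S ((t : ℝ) : ℂ) = T t) ∧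
    (∀ z ∈ sector δ, ∀ w ∈ sector δ, S (z + w) = S z * S w) ∧
    DifferentiableOn ℂ S (sector δ) ∧
    ∀ δ', 0 < δ' → δ' < δ → ∀ x, Tendsto (fun z => S z x) (𝓝[sector δ'] 0) (𝓝 x)

/-- `B` is the infinitesimal generator of `T`: one has `x ∈ dom B` and `B x = y` if and only if
`(T(h) x - x) / h → y` as `h → 0+`. -/
def IsGenerator (B : X →ₗ.[ℂ] X) (T : ℝ≥0 → X →L[ℂ] X) : Prop :=
  ∀ x y, (x, y) ∈ B.graph ↔
    Tendsto (fun h : ℝ≥0 => (((h : ℝ) : ℂ)⁻¹) • (T h x - x)) (𝓝[>] 0) (𝓝 y)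

end Semigroup

/-! ### Order and positivity -/

/-- `u ≥ 0` in `H¹₀`: real and nonnegative pointwise. -/
def NonnegH10 {L : ℝ} (u : H10 L) : Prop := ∀ x ∈ Ioo (-L) L, 0 ≤ dirac L x u

/-- `u > 0` pointwise on `(-L, L)`. -/
def PosH10 {L : ℝ} (u : H10 L) : Prop := ∀ x ∈ Ioo (-L) L, 0 < dirac L x u

/-- `f ≥ 0` in `H⁻¹`: `⟨f, v⟩ ≥ 0` for all `0 ≤ v ∈ H¹₀`. -/
def NonnegHm1 {L : ℝ} (f : Hm1 L) : Prop := ∀ v : H10 L, NonnegH10 v → 0 ≤ f v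

/-- Positivity of a semigroup on `H⁻¹`. -/
def IsPositive {L : ℝ} (T : ℝ≥0 → Hm1 L →L[ℂ] Hm1 L) : Prop :=
  ∀ t f, NonnegHm1 f → NonnegHm1 (T t f)

/-- Individual eventual positivity: the orbit of every `f ≥ 0` is `≥ 0` from some time on, which
may depend on `f`. -/
def IsIndividuallyEventuallyPositive {L : ℝ} (T : ℝ≥0 → Hm1 L →L[ℂ] Hm1 L) : Prop :=
  ∀ f, NonnegHm1 f → ∃ t₀, ∀ t ≥ t₀, NonnegHm1 (T t f)

/-! ### Eigenfunctions -/

/-- `u ∈ H¹₀` is an eigenfunction of `B : H¹₀ → H⁻¹` for the eigenvalue `μ`. -/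
def IsEigenpair {L : ℝ} (B : H10 L →L[ℂ] Hm1 L) (μ : ℂ) (u : H10 L) : Prop :=
  u ≠ 0 ∧ B u = μ • emb L u

/-- `u` is the first eigenfunction of `B`, with first eigenvalue `μ`: all other eigenvalues have a
larger real part, and the eigenspace of `μ` is spanned by `u`. -/
def IsFirstEigenpair {L : ℝ} (B : H10 L →L[ℂ] Hm1 L) (μ : ℂ) (u : H10 L) : Prop :=
  IsEigenpair B μ u ∧ (∀ w, IsEigenpair B μ w → ∃ c : ℂ, w = c • u) ∧
    ∀ ν w, IsEigenpair B ν w → ν ≠ μ → μ.re < ν.re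

end PointHeat

end

open PointHeat

open MeasureTheory Set Filter Topology
open scoped ContDiff ComplexOrder NNReal ENNReal

/-! Generation. The bound |u(x)|² ≤ 2‖u‖‖u'‖ (L² norms) makes β u(x₀) v(0) a small perturbation of
the Dirichlet form. Pairing (A_{L,β} + κ²)u with the conjugate of u and multiplying by the conjugate
of κ gives real part at least (Re κ − |β|)‖u‖² in the H¹ norm, once |κ| ≥ 1 and Re κ ≥ |β|
(`shifted_coercive`). Hence A_{L,β} + κ² is invertible for Re κ > b = |β| + 1, with inverse of norm
at most |κ|/(Re κ − b): the spectrum lies inside a parabola. The substitution λ = κ² turns the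
Dunford integral into a Gaussian integral over a vertical line, convergent for Re z > 0. Moving that
line yields the semigroup bounds near zero (`ParabolicResolvent.isAnalyticSemigroup`,
`ParabolicResolvent.isGenerator`).

Positivity. In terms of explicit Dirichlet Green functions the resolvent is visibly positive if β ≤
0, and implicit Euler steps carry this over to the semigroup (`fn_orbit_mem_closure`,
`heat_mem_realCone`). If β > 0, take bumps u at x₀ and v at 0 with disjoint supports: the pairing of
e^{-tA}u with v vanishes at t = 0 and has slope −β there.

First eigenvalue. Let s'' = −μs, s(0) = 0, s'(0) = 1, c = s', and G_y(x) = s(L + min(x,y)) s(L −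
max(x,y)). If 2s(L)c(L) + βG_0(x₀) = 0, then φ = G_0 and ψ = G_{x₀} are eigenfunctions of A_{L,β}
and of its adjoint. The intermediate value theorem finds such a μ for which s stays positive on (0,
L + x₀], hence φ, ψ > 0. The operator is not symmetric, but the weight ψ/φ gives a ground state
identity: for u = hφ, Re⟨(A_{L,β} − μ)u, (ψ/φ)ū⟩ = ∫|h'|²φψ − (β/2)φ(x₀)²|h(0) − h(x₀)|²
(`Principal.ground_state`). For β below a positive threshold the jump term is at most half of the
integral (`Principal.small_jump`), and a weighted Poincaré inequality then gives a gap γ > 0 on the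
annihilator of ψ (`Principal.exists_gap`). Every eigenfunction for another eigenvalue annihilates ψ,
so the gap alone yields both simplicity and dominance of μ, without compactness or further spectral
theory.

Eventual positivity. Subtract from the orbit of f ≥ 0, f ≠ 0, its component d e^{-μt}φ with d > 0.
The remainder and its time derivative annihilate ψ, so both are O(e^{-(μ+γ)t}) in L²
(`Principal.exists_decay`). The Green representation upgrades this to a pointwise bound by a
multiple of the distance to the boundary (`exists_pointwise_bound`), and φ dominates such a bound.
-/

namespace PointHeat

section
/-! ### Gaussian integrals along vertical lines -/

section GaussLine

variable {E F : Type*} [NormedAddCommGroup E] [NormedSpace ℂ E]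
  [NormedAddCommGroup F] [NormedSpace ℂ F]

/-- `(1/π) ∫ exp (z κ²) f κ ds` over the vertical line `κ = c + i s`. -/
noncomputable def lineInt (f : ℂ → E) (c : ℝ) (z : ℂ) : E :=
  ((Real.pi : ℂ)⁻¹) • ∫ s : ℝ, Complex.exp (z * ((c : ℂ) + s * Complex.I) ^ 2) •
    f ((c : ℂ) + s * Complex.I)

/-- Holomorphic functions of at most exponential growth on a half plane. -/
structure ExpGrowth (b : ℝ) (f : ℂ → E) : Prop where
  diff : DifferentiableOn ℂ f {κ | b < κ.re}
  bound : ∃ K : ℝ, 0 ≤ K ∧ ∃ m : ℝ, 0 ≤ m ∧ ∀ κ : ℂ, b < κ.re →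
    ‖f κ‖ ≤ K * Real.exp (m * ‖κ‖) / (κ.re - b)

theorem re_mul_line_sq (z : ℂ) (c s : ℝ) : (z * ((c : ℂ) + s * Complex.I) ^ 2).re =
    z.re * (c ^ 2 - s ^ 2) - 2 * c * s * z.im := by
  simp [pow_two]; ring

/-- The modulus is the exponential of Re z (c² − s²) − 2cs Im z; Young's inequality spends half of
the Gaussian decay on the cross term. -/
theorem norm_exp_line_le {z : ℂ} {c s x X y : ℝ} (hx : 0 < x) (h1 : x ≤ z.re) (h2 : z.re ≤ X)
    (h3 : |z.im| ≤ y) : ‖Complex.exp (z * ((c : ℂ) + s * Complex.I) ^ 2)‖ ≤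
      Real.exp (X * c ^ 2 + 2 * c ^ 2 * y ^ 2 / x) * Real.exp (-(x / 2) * s ^ 2) := by
  rw [Complex.norm_exp, re_mul_line_sq, ← Real.exp_add, Real.exp_le_exp]
  have e1 : z.re * (c ^ 2 - s ^ 2) ≤ X * c ^ 2 - x * s ^ 2 := by
    nlinarith [sq_nonneg c, sq_nonneg s]
  have e2 : -(2 * c * s * z.im) ≤ 2 * c ^ 2 * y ^ 2 / x + x / 2 * s ^ 2 := by
    have h4 : -(2 * c * s * z.im) ≤ 2 * c ^ 2 * z.im ^ 2 / x + x / 2 * s ^ 2 := by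
      rw [div_add' _ _ _ hx.ne', le_div_iff₀ hx]
      nlinarith [sq_nonneg (x * s + 2 * c * z.im)]
    have h5 : z.im ^ 2 ≤ y ^ 2 := sq_le_sq' (by linarith [neg_abs_le z.im]) ((le_abs_self _).trans h3)
    have h6 : 2 * c ^ 2 * z.im ^ 2 / x ≤ 2 * c ^ 2 * y ^ 2 / x := by gcongr
    linarith
  linarith

theorem norm_line_le (c s : ℝ) : ‖(c : ℂ) + s * Complex.I‖ ≤ |c| + |s| := by
  refine (norm_add_le _ _).trans ?_
  simp

/-- Half of the remaining Gaussian absorbs exp(m|κ|). The constant is uniform over a strip of lines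
and a box of z, as needed both for moving the line and for differentiating under the integral. -/
theorem ExpGrowth.line_bound {b : ℝ} {f : ℂ → E} (hf : ExpGrowth b f) {c₁ c₂ x : ℝ} (X y : ℝ)
    (hc : b < c₁) (hx : 0 < x) : ∃ K : ℝ, ∀ (c s : ℝ) (z : ℂ), c₁ ≤ c → c ≤ c₂ → x ≤ z.re →
      z.re ≤ X → |z.im| ≤ y → ‖Complex.exp (z * ((c : ℂ) + s * Complex.I) ^ 2) •
        f ((c : ℂ) + s * Complex.I)‖ ≤ K * Real.exp (-(x / 4) * s ^ 2) := by
  obtain ⟨K, hK, m, hm, h⟩ := hf.bound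
  set d := max |c₁| |c₂| with hd
  refine ⟨Real.exp (|X| * d ^ 2 + 2 * d ^ 2 * y ^ 2 / x) *
    (K * (Real.exp (m * d) * Real.exp (m ^ 2 / x)) / (c₁ - b)), fun c s z h1 h2 h3 h4 h5 => ?_⟩
  have hcd : |c| ≤ d := abs_le_max_abs_abs h1 h2
  have hc2 : c ^ 2 ≤ d ^ 2 := sq_le_sq' (by linarith [neg_abs_le c]) ((le_abs_self _).trans hcd)
  have hre : ((c : ℂ) + s * Complex.I).re = c := by simp
  have e1 := norm_exp_line_le (c := c) (s := s) hx h3 (h4.trans (le_abs_self X)) h5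
  have e2 := h ((c : ℂ) + s * Complex.I) (by rw [hre]; linarith)
  rw [hre] at e2
  have e3 : Real.exp (m * ‖(c : ℂ) + s * Complex.I‖) ≤
      Real.exp (m * d) * Real.exp (m ^ 2 / x) * Real.exp (x / 4 * s ^ 2) := by
    rw [← Real.exp_add, ← Real.exp_add, Real.exp_le_exp]
    have h6 : m * ‖(c : ℂ) + s * Complex.I‖ ≤ m * (d + |s|) := by
      gcongr; exact (norm_line_le c s).trans (by linarith)
    have h7 : m * |s| ≤ m ^ 2 / x + x / 4 * s ^ 2 := by
      rw [div_add' _ _ _ hx.ne', le_div_iff₀ hx, ← sq_abs s]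
      nlinarith [sq_nonneg (x * |s| / 2 - m)]
    linarith
  have hcb : 0 < c₁ - b := by linarith
  have hcb' : 0 < c - b := by linarith
  rw [norm_smul]
  calc _ ≤ (Real.exp (|X| * c ^ 2 + 2 * c ^ 2 * y ^ 2 / x) * Real.exp (-(x / 2) * s ^ 2)) *
        (K * Real.exp (m * ‖(c : ℂ) + s * Complex.I‖) / (c - b)) := by gcongr
    _ ≤ (Real.exp (|X| * d ^ 2 + 2 * d ^ 2 * y ^ 2 / x) * Real.exp (-(x / 2) * s ^ 2)) *
        (K * (Real.exp (m * d) * Real.exp (m ^ 2 / x) * Real.exp (x / 4 * s ^ 2)) / (c₁ - b)) := by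
        gcongr
    _ = _ := by
        have : Real.exp (-(x / 4) * s ^ 2) = Real.exp (-(x / 2) * s ^ 2) * Real.exp (x / 4 * s ^ 2) := by
          rw [← Real.exp_add]; congr 1; ring
        rw [this]; ring

theorem continuous_line (c : ℝ) : Continuous fun s : ℝ => (c : ℂ) + s * Complex.I := by fun_prop

theorem ExpGrowth.continuous_line {b : ℝ} {f : ℂ → E} (hf : ExpGrowth b f) {c : ℝ} (hc : b < c) :
    Continuous fun s : ℝ => f ((c : ℂ) + s * Complex.I) :=
  hf.diff.continuousOn.comp_continuous (PointHeat.continuous_line c) (fun s => by simpa using hc)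

theorem integrable_gauss {x : ℝ} (hx : 0 < x) (K : ℝ) :
    Integrable fun s : ℝ => K * Real.exp (-(x / 4) * s ^ 2) :=
  (integrable_exp_neg_mul_sq (by positivity)).const_mul K

theorem ExpGrowth.integrable {b : ℝ} {f : ℂ → E} (hf : ExpGrowth b f) {c : ℝ} (hc : b < c) {z : ℂ}
    (hz : 0 < z.re) : Integrable fun s : ℝ => Complex.exp (z * ((c : ℂ) + s * Complex.I) ^ 2) •
      f ((c : ℂ) + s * Complex.I) := by
  obtain ⟨K, hK⟩ := hf.line_bound (c₂ := c) z.re |z.im| hc hz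
  refine (integrable_gauss hz K).mono' ?_ (Eventually.of_forall fun s =>
    hK c s z le_rfl le_rfl le_rfl le_rfl le_rfl)
  have := hf.continuous_line hc
  exact (Continuous.smul (by fun_prop) this).aestronglyMeasurable

theorem ExpGrowth.smul_pow {b : ℝ} {f : ℂ → E} (hf : ExpGrowth b f) (n : ℕ) :
    ExpGrowth b fun κ => κ ^ n • f κ := by
  refine ⟨DifferentiableOn.smul (by fun_prop) hf.diff, ?_⟩
  obtain ⟨K, hK, m, hm, h⟩ := hf.bound
  refine ⟨n.factorial * K, by positivity, m + 1, by positivity, fun κ hκ => ?_⟩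
  have h1 : ‖κ‖ ^ n ≤ n.factorial * Real.exp ‖κ‖ := by
    have := Real.pow_div_factorial_le_exp ‖κ‖ (norm_nonneg _) n
    rwa [div_le_iff₀ (by positivity), mul_comm] at this
  have : 0 < κ.re - b := by linarith
  rw [norm_smul, norm_pow]
  calc _ ≤ (n.factorial * Real.exp ‖κ‖) * (K * Real.exp (m * ‖κ‖) / (κ.re - b)) := by
        gcongr; exact h κ hκ
    _ = _ := by rw [show (m + 1) * ‖κ‖ = ‖κ‖ + m * ‖κ‖ by ring, Real.exp_add]; ring

theorem ExpGrowth.clm {b : ℝ} {f : ℂ → E} (hf : ExpGrowth b f) (A : E →L[ℂ] F) :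
    ExpGrowth b fun κ => A (f κ) := by
  refine ⟨fun κ hκ => A.differentiableAt.comp_differentiableWithinAt κ (hf.diff κ hκ), ?_⟩
  obtain ⟨K, hK, m, hm, h⟩ := hf.bound
  refine ⟨‖A‖ * K, by positivity, m, hm, fun κ hκ => ?_⟩
  refine (A.le_opNorm _).trans ?_
  rw [mul_assoc, mul_div_assoc]
  gcongr
  exact h κ hκ

theorem ExpGrowth.congr {b : ℝ} {f g : ℂ → E} (hf : ExpGrowth b f)
    (h : ∀ κ : ℂ, b < κ.re → g κ = f κ) : ExpGrowth b g := by
  refine ⟨hf.diff.congr h, ?_⟩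
  obtain ⟨K, hK, m, hm, h'⟩ := hf.bound
  exact ⟨K, hK, m, hm, fun κ hκ => by rw [h κ hκ]; exact h' κ hκ⟩

theorem lineInt_congr {b : ℝ} {f g : ℂ → E} {c : ℝ} (hc : b < c)
    (h : ∀ κ : ℂ, b < κ.re → g κ = f κ) (z : ℂ) : lineInt g c z = lineInt f c z := by
  unfold lineInt
  congr 2
  ext s
  rw [h _ (by simpa using hc)]

theorem lineInt_sub {b : ℝ} {f g : ℂ → E} (hf : ExpGrowth b f) (hg : ExpGrowth b g) {c : ℝ}
    (hc : b < c) {z : ℂ} (hz : 0 < z.re) :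
    lineInt (fun κ => f κ - g κ) c z = lineInt f c z - lineInt g c z := by
  unfold lineInt
  rw [← smul_sub, ← integral_sub (hf.integrable hc hz) (hg.integrable hc hz)]
  simp only [smul_sub]

theorem lineInt_clm [CompleteSpace E] [CompleteSpace F] {b : ℝ} {f : ℂ → E} (hf : ExpGrowth b f)
    {c : ℝ} (hc : b < c) {z : ℂ} (hz : 0 < z.re) (A : E →L[ℂ] F) :
    lineInt (fun κ => A (f κ)) c z = A (lineInt f c z) := by
  unfold lineInt
  rw [map_smul, ← ContinuousLinearMap.integral_comp_comm _ (hf.integrable hc hz)]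
  simp only [map_smul]

/-- Differentiation under the integral sign: on the ball of radius Re z / 2 around z, one Gaussian
dominates the integrands for κ² f. -/
theorem hasDerivAt_lineInt {b : ℝ} {f : ℂ → E} (hf : ExpGrowth b f) {c : ℝ} (hc : b < c) {z : ℂ}
    (hz : 0 < z.re) : HasDerivAt (lineInt f c) (lineInt (fun κ => κ ^ 2 • f κ) c z) z := by
  refine HasDerivAt.const_smul _ ?_
  obtain ⟨K, hK⟩ := (hf.smul_pow 2).line_bound (c₂ := c) (x := z.re / 2) (2 * z.re)
    (|z.im| + z.re / 2) hc (by linarith)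
  refine (hasDerivAt_integral_of_dominated_loc_of_deriv_le (𝕜 := ℂ)
    (F := fun (z : ℂ) (s : ℝ) => Complex.exp (z * ((c : ℂ) + s * Complex.I) ^ 2) •
      f ((c : ℂ) + s * Complex.I))
    (bound := fun s => K * Real.exp (-(z.re / 2 / 4) * s ^ 2))
    (F' := fun (z : ℂ) (s : ℝ) => Complex.exp (z * ((c : ℂ) + s * Complex.I) ^ 2) •
      (((c : ℂ) + s * Complex.I) ^ 2 • f ((c : ℂ) + s * Complex.I)))
    (Metric.ball_mem_nhds z (half_pos hz)) ?_ (hf.integrable hc hz) ?_ ?_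
    (integrable_gauss (by linarith) K) ?_).2
  · have := hf.continuous_line hc
    exact Eventually.of_forall fun w => (Continuous.smul (by fun_prop) this).aestronglyMeasurable
  · have := (hf.smul_pow 2).continuous_line hc
    exact (Continuous.smul (by fun_prop) this).aestronglyMeasurable
  · refine Eventually.of_forall fun s w hw => ?_
    rw [Metric.mem_ball, dist_eq_norm] at hw
    have h1 := (Complex.abs_re_le_norm (w - z)).trans hw.le
    have h2 := (Complex.abs_im_le_norm (w - z)).trans hw.le
    rw [Complex.sub_re, abs_le] at h1
    rw [Complex.sub_im] at h2
    have h3 := abs_sub_abs_le_abs_sub w.im z.im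
    exact hK c s w le_rfl le_rfl (by linarith) (by linarith) (by linarith)
  · refine Eventually.of_forall fun s w _ => ?_
    have := ((hasDerivAt_id w).mul_const (((c : ℂ) + s * Complex.I) ^ 2)).cexp.smul_const
      (f ((c : ℂ) + s * Complex.I))
    simpa [smul_smul] using this

/-- The line integral does not depend on the line. -/
theorem lineInt_eq [CompleteSpace E] {b : ℝ} {f : ℂ → E} (hf : ExpGrowth b f) {c₁ c₂ : ℝ} (h1 : b < c₁)
    (h12 : c₁ ≤ c₂) {z : ℂ} (hz : 0 < z.re) : lineInt f c₁ z = lineInt f c₂ z := by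
  obtain ⟨K, hK⟩ := hf.line_bound (c₂ := c₂) z.re |z.im| h1 hz
  have hK' : ∀ c s : ℝ, c₁ ≤ c → c ≤ c₂ → ‖Complex.exp (z * ((c : ℂ) + s * Complex.I) ^ 2) •
        f ((c : ℂ) + s * Complex.I)‖ ≤ K * Real.exp (-(z.re / 4) * s ^ 2) :=
    fun c s a1 a2 => hK c s z a1 a2 le_rfl le_rfl le_rfl
  set g : ℂ → E := fun κ => Complex.exp (z * κ ^ 2) • f κ with hg
  -- Cauchy's theorem on the rectangle [c₁, c₂] × [−R, R].
  have hrect : ∀ R : ℝ, (∫ s in (-R)..R, g (c₂ + s * Complex.I)) - ∫ s in (-R)..R, g (c₁ + s * Complex.I)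
      = Complex.I • ((∫ x in c₁..c₂, g (x + (-R : ℝ) * Complex.I)) -
        ∫ x in c₁..c₂, g (x + (R : ℝ) * Complex.I)) := by
    intro R
    have := Complex.integral_boundary_rect_eq_zero_of_differentiableOn g
      ((c₁ : ℂ) + (-R : ℝ) * Complex.I) ((c₂ : ℂ) + (R : ℝ) * Complex.I) ?_
    · simp only [Complex.add_re, Complex.ofReal_re, Complex.mul_re, Complex.I_re, mul_zero,
        Complex.ofReal_im, Complex.I_im, sub_zero, add_zero, Complex.add_im,
        Complex.mul_im, mul_one, zero_add] at this
      have h2 : (Complex.I • ∫ s in (-R)..R, g (c₂ + s * Complex.I)) -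
          (Complex.I • ∫ s in (-R)..R, g (c₁ + s * Complex.I)) =
          -((∫ x in c₁..c₂, g (x + (-R : ℝ) * Complex.I)) -
        ∫ x in c₁..c₂, g (x + (R : ℝ) * Complex.I)) := by
        rw [eq_neg_iff_add_eq_zero, ← this]; abel
      rw [← smul_sub] at h2
      have h3 := congrArg (fun v => (-Complex.I) • v) h2
      have h4 : ∀ a : E, -(Complex.I • a) = Complex.I • (-a) := fun a => (smul_neg _ _).symm
      simpa [smul_smul, h4, neg_sub] using h3
    · refine DifferentiableOn.smul (by fun_prop) (hf.diff.mono fun κ hκ => ?_)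
      have h5 := hκ.1
      simp only [Complex.add_re, Complex.ofReal_re, Complex.mul_re, Complex.I_re, mul_zero,
        Complex.ofReal_im, Complex.I_im, mul_one, sub_zero, add_zero, mem_preimage,
        uIcc_of_le h12] at h5
      exact h1.trans_le h5.1
  -- The horizontal sides, ε R = R and ε R = −R, vanish in the limit by the Gaussian bound.
  have hside : ∀ ε : ℝ → ℝ, (∀ R, ε R ^ 2 = R ^ 2) →
      Tendsto (fun R : ℝ => ∫ x in c₁..c₂, g (x + (ε R : ℝ) * Complex.I)) atTop (𝓝 0) := by
    intro ε hε
    have hlim : Tendsto (fun R : ℝ => K * Real.exp (-(z.re / 4) * R ^ 2) * |c₂ - c₁|) atTop (𝓝 0) := by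
      have : Tendsto (fun R : ℝ => -(z.re / 4) * R ^ 2) atTop atBot :=
        (tendsto_pow_atTop two_ne_zero).const_mul_atTop_of_neg (by linarith)
      simpa using ((Real.tendsto_exp_atBot.comp this).const_mul K).mul_const |c₂ - c₁|
    refine squeeze_zero_norm (fun R => ?_) hlim
    refine intervalIntegral.norm_integral_le_of_norm_le_const fun x hx => ?_
    rw [uIoc_of_le h12] at hx
    have := hK' x (ε R) hx.1.le hx.2
    rwa [hε] at this
  have hL := ((hside (fun R => -R) (fun R => by ring)).sub (hside (fun R => R) fun R => rfl)).const_smul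
    Complex.I
  simp only [sub_zero, smul_zero] at hL
  have hR := (intervalIntegral_tendsto_integral (hf.integrable (h1.trans_le h12) hz)
    tendsto_neg_atTop_atBot tendsto_id).sub (intervalIntegral_tendsto_integral
    (hf.integrable h1 hz) tendsto_neg_atTop_atBot tendsto_id)
  have := tendsto_nhds_unique (hR.congr fun R => hrect R) hL
  unfold lineInt
  rw [sub_eq_zero.1 this]

theorem expGrowth_pow (n : ℕ) {b : ℝ} (x : E) :
    ExpGrowth b fun κ : ℂ => κ ^ n • x := by
  refine ExpGrowth.smul_pow (f := fun _ => x) ?_ n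
  refine ⟨by fun_prop, ‖x‖ * Real.exp |b|, by positivity, 1, zero_le_one, fun κ hκ => ?_⟩
  have : 0 < κ.re - b := by linarith
  -- The growth bound carries a denominator Re κ − b, so even a constant needs an exponential
  -- factor: Re κ − b ≤ exp(|b| + |κ|).
  rw [le_div_iff₀ this, mul_assoc, ← Real.exp_add]
  gcongr
  have h1 := Real.add_one_le_exp (|b| + 1 * ‖κ‖)
  have h2 := Complex.re_le_norm κ
  have h3 := neg_abs_le b
  linarith

/-- Up to the factor 2iz, the integrand κ exp(zκ²) is the derivative in s of exp(zκ²), which decays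
at both ends. -/
theorem lineInt_id_smul [CompleteSpace E] {c : ℝ} {z : ℂ} (hz : 0 < z.re) (x : E) :
    lineInt (fun κ => κ • x) c z = 0 := by
  have hg : ExpGrowth (c - 1) fun κ : ℂ => κ ^ 0 • (1 : ℂ) := expGrowth_pow 0 _
  have hg' : ExpGrowth (c - 1) fun κ : ℂ => κ ^ 1 • (1 : ℂ) := expGrowth_pow 1 _
  have i1 := hg.integrable (c := c) (by linarith) hz
  have i2 := hg'.integrable (c := c) (by linarith) hz
  have hz0 : z ≠ 0 := by rintro rfl; simp at hz
  have key := integral_eq_zero_of_hasDerivAt_of_integrable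
    (f := fun s : ℝ => Complex.exp (z * ((c : ℂ) + s * Complex.I) ^ 2))
    (f' := fun s : ℝ => (z * 2 * Complex.I) * (Complex.exp (z * ((c : ℂ) + s * Complex.I) ^ 2) *
      ((c : ℂ) + s * Complex.I))) (fun s => ?_) ?_ ?_
  · rw [integral_const_mul, mul_eq_zero] at key
    have := key.resolve_left (by simp [hz0])
    unfold lineInt
    simp only [smul_smul]
    rw [integral_smul_const, this, zero_smul, smul_zero]
  · have h1 : HasDerivAt (fun s : ℝ => (c : ℂ) + s * Complex.I) Complex.I s := by
      simpa using ((hasDerivAt_id s).ofReal_comp.mul_const Complex.I).const_add (c : ℂ)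
    have h2 := ((h1.pow 2).const_mul z).cexp
    refine h2.congr_deriv ?_
    simp only [Pi.pow_apply, Nat.cast_ofNat]
    ring
  · simpa using i2.const_mul (z * 2 * Complex.I)
  · simpa using i1

theorem expGrowth_inv {b : ℝ} (hb : 0 ≤ b) : ExpGrowth b fun κ : ℂ => κ⁻¹ := by
  refine ⟨fun κ hκ => ?_, 1, zero_le_one, 0, le_rfl, fun κ hκ => ?_⟩
  · refine (differentiableAt_inv ?_).differentiableWithinAt
    rintro rfl
    simp at hκ; linarith
  · have : 0 < κ.re - b := by linarith
    rw [norm_inv, zero_mul, Real.exp_zero, mul_one, one_div]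
    gcongr
    linarith [Complex.re_le_norm κ]

end GaussLine

end

/-! ### The normalisation: the line integral of κ⁻¹ -/

section
-- On the line κ = 1 + is one has κ² = 1 − s² + 2is and κ⁻¹ = (1 − is)/(1 + s²). This is the
-- absolutely integrable half of κ⁻¹, treated by dominated convergence.
theorem tendsto_exp_gauss_cauchy :
    Tendsto (fun t : ℝ => ∫ s : ℝ, Complex.exp (t * ((1 : ℂ) - s ^ 2 + 2 * s * Complex.I)) *
      ((1 : ℂ) + s ^ 2)⁻¹) (𝓝[>] 0) (𝓝 Real.pi) := by
  have hpi : (Real.pi : ℂ) = ∫ s : ℝ, ((1 : ℂ) + s ^ 2)⁻¹ := by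
    rw [← integral_univ_inv_one_add_sq, ← integral_complex_ofReal]
    push_cast
    rfl
  rw [hpi]
  refine tendsto_integral_filter_of_dominated_convergence
    (fun s => Real.exp 1 * (1 + s ^ 2)⁻¹) ?_ ?_ (integrable_inv_one_add_sq.const_mul _) ?_
  · refine Eventually.of_forall fun t => ?_
    refine Continuous.aestronglyMeasurable ?_
    refine Continuous.mul (by fun_prop) (Continuous.inv₀ (by fun_prop) fun s => ?_)
    norm_cast; positivity
  · filter_upwards [Ioo_mem_nhdsGT (zero_lt_one (α := ℝ))] with t ht
    refine Eventually.of_forall fun s => ?_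
    rw [norm_mul, norm_inv, Complex.norm_exp]
    have e1 : ‖(1 : ℂ) + s ^ 2‖ = 1 + s ^ 2 := by
      rw [show (1 : ℂ) + s ^ 2 = ((1 + s ^ 2 : ℝ) : ℂ) by push_cast; rfl, Complex.norm_real,
        Real.norm_of_nonneg (by positivity)]
    rw [e1]
    gcongr
    have : ((t : ℂ) * ((1 : ℂ) - s ^ 2 + 2 * s * Complex.I)).re = t * (1 - s ^ 2) := by
      simp [pow_two]
    rw [this]
    nlinarith [ht.1, ht.2, sq_nonneg s]
  · refine Eventually.of_forall fun s => ?_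
    have : Continuous fun t : ℝ => Complex.exp (t * ((1 : ℂ) - s ^ 2 + 2 * s * Complex.I)) *
      ((1 : ℂ) + s ^ 2)⁻¹ := by fun_prop
    simpa using (this.tendsto 0).mono_left nhdsWithin_le_nhds

theorem integral_odd_eq_zero {f : ℝ → ℂ} (hf : ∀ s, f (-s) = -f s) : ∫ s, f s = 0 := by
  have h1 := integral_neg_eq_self f volume
  simp_rw [hf, integral_neg] at h1
  have h2 : (2 : ℂ) * ∫ s, f s = 0 := by linear_combination -h1
  exact (mul_eq_zero.1 h2).resolve_left two_ne_zero

/-- The other half of κ⁻¹. Since s/(1 + s²) is not integrable, no domination is available;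
subtracting the odd function exp(t(1 − s²)) s/(1 + s²), of integral zero, leaves a factor exp(2its)
− 1 of size at most 2t|s|. The result is t times a Gaussian integral of order t^{-1/2}. -/
theorem tendsto_exp_gauss_conj :
    Tendsto (fun t : ℝ => ∫ s : ℝ, Complex.exp (t * ((1 : ℂ) - s ^ 2 + 2 * s * Complex.I)) *
      (s * ((1 : ℂ) + s ^ 2)⁻¹)) (𝓝[>] 0) (𝓝 0) := by
  have e1 : ∀ s : ℝ, ‖(1 : ℂ) + s ^ 2‖ = 1 + s ^ 2 := fun s => by
    rw [show (1 : ℂ) + s ^ 2 = ((1 + s ^ 2 : ℝ) : ℂ) by push_cast; rfl, Complex.norm_real,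
      Real.norm_of_nonneg (by positivity)]
  have hnz : ∀ s : ℝ, (1 : ℂ) + s ^ 2 ≠ 0 := fun s => by norm_cast; positivity
  have hkey : ∀ t : ℝ, 0 < t → t < 1 → ‖∫ s : ℝ, Complex.exp (t * ((1 : ℂ) - s ^ 2 +
      2 * s * Complex.I)) * (s * ((1 : ℂ) + s ^ 2)⁻¹)‖ ≤
      2 * Real.exp 1 * (√Real.pi * √t) := by
    intro t ht ht1
    have n1 : ∀ s : ℝ, ‖Complex.exp (t * ((1 : ℂ) - s ^ 2))‖ = Real.exp t * Real.exp (-t * s ^ 2) := by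
      intro s
      rw [Complex.norm_exp, ← Real.exp_add]
      congr 1
      simp [pow_two]; ring
    have n2 : ∀ s : ℝ, ‖(s : ℂ) * ((1 : ℂ) + s ^ 2)⁻¹‖ ≤ 1 := by
      intro s
      rw [norm_mul, norm_inv, e1, ← div_eq_mul_inv, div_le_one (by positivity), Complex.norm_real,
        Real.norm_eq_abs, abs_le]
      constructor <;> nlinarith [sq_nonneg (s - 1), sq_nonneg (s + 1)]
    have c1 : Continuous fun s : ℝ => (s : ℂ) * ((1 : ℂ) + s ^ 2)⁻¹ :=
      Continuous.mul (by fun_prop) (Continuous.inv₀ (by fun_prop) hnz)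
    have i0 : Integrable fun s : ℝ => Complex.exp (t * ((1 : ℂ) - s ^ 2)) *
        (s * ((1 : ℂ) + s ^ 2)⁻¹) := by
      refine ((integrable_exp_neg_mul_sq ht).const_mul (Real.exp t)).mono'
        (Continuous.mul (by fun_prop) c1).aestronglyMeasurable (Eventually.of_forall fun s => ?_)
      rw [norm_mul, n1]
      exact mul_le_of_le_one_right (by positivity) (n2 s)
    have i1 : Integrable fun s : ℝ => Complex.exp (t * ((1 : ℂ) - s ^ 2 + 2 * s * Complex.I)) *
        (s * ((1 : ℂ) + s ^ 2)⁻¹) := by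
      refine i0.norm.mono' (Continuous.mul (by fun_prop) c1).aestronglyMeasurable
        (Eventually.of_forall fun s => ?_)
      have : ‖Complex.exp (t * (2 * s * Complex.I))‖ = 1 := by
        rw [Complex.norm_exp]; simp
      rw [mul_add, Complex.exp_add]
      simp only [norm_mul, this, mul_one, le_refl]
    have hz : ∫ s : ℝ, Complex.exp (t * ((1 : ℂ) - s ^ 2)) * (s * ((1 : ℂ) + s ^ 2)⁻¹) = 0 :=
      integral_odd_eq_zero fun s => by push_cast; ring_nf
    rw [← sub_zero (∫ s : ℝ, _), ← hz, ← integral_sub i1 i0]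
    have hg : ∫ s : ℝ, 2 * Real.exp 1 * t * Real.exp (-t * s ^ 2) =
        2 * Real.exp 1 * (√Real.pi * √t) := by
      rw [integral_const_mul, integral_gaussian, Real.sqrt_div' _ ht.le]
      have : √t ≠ 0 := (Real.sqrt_pos.2 ht).ne'
      field_simp
      rw [Real.sq_sqrt ht.le]
    rw [← hg]
    refine norm_integral_le_of_norm_le ((integrable_exp_neg_mul_sq ht).const_mul _)
      (Eventually.of_forall fun s => ?_)
    have n3 : ‖Complex.exp (t * (2 * s * Complex.I)) - 1‖ ≤ 2 * t * |s| := by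
      have := Real.norm_exp_I_mul_ofReal_sub_one_le (x := 2 * t * s)
      rw [show Complex.I * ((2 * t * s : ℝ) : ℂ) = t * (2 * s * Complex.I) by push_cast; ring] at this
      refine this.trans (le_of_eq ?_)
      rw [Real.norm_eq_abs, abs_mul, abs_of_pos (by positivity : 0 < 2 * t)]
    have : Complex.exp (t * ((1 : ℂ) - s ^ 2 + 2 * s * Complex.I)) * (s * ((1 : ℂ) + s ^ 2)⁻¹) -
        Complex.exp (t * ((1 : ℂ) - s ^ 2)) * (s * ((1 : ℂ) + s ^ 2)⁻¹) =
        Complex.exp (t * ((1 : ℂ) - s ^ 2)) * ((Complex.exp (t * (2 * s * Complex.I)) - 1) *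
        (s * ((1 : ℂ) + s ^ 2)⁻¹)) := by
      rw [mul_add, Complex.exp_add]; ring
    rw [this, norm_mul, n1, norm_mul]
    have n4 : ‖(s : ℂ) * ((1 : ℂ) + s ^ 2)⁻¹‖ = |s| * (1 + s ^ 2)⁻¹ := by
      rw [norm_mul, norm_inv, e1, Complex.norm_real, Real.norm_eq_abs]
    rw [n4]
    have n5 : 2 * t * |s| * (|s| * (1 + s ^ 2)⁻¹) ≤ 2 * t := by
      rw [show 2 * t * |s| * (|s| * (1 + s ^ 2)⁻¹) = 2 * t * ((|s| ^ 2) * (1 + s ^ 2)⁻¹) by ring,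
        sq_abs]
      refine mul_le_of_le_one_right (by positivity) ?_
      rw [← div_eq_mul_inv, div_le_one (by positivity)]
      linarith
    have n6 : Real.exp t ≤ Real.exp 1 := Real.exp_le_exp.2 ht1.le
    calc _ ≤ Real.exp t * Real.exp (-t * s ^ 2) * (2 * t * |s| * (|s| * (1 + s ^ 2)⁻¹)) := by gcongr
      _ ≤ Real.exp 1 * Real.exp (-t * s ^ 2) * (2 * t) := by gcongr
      _ = _ := by ring
  have hlim : Tendsto (fun t : ℝ => 2 * Real.exp 1 * (√Real.pi * √t)) (𝓝[>] 0) (𝓝 0) := by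
    have : Continuous fun t : ℝ => 2 * Real.exp 1 * (√Real.pi * √t) := by fun_prop
    simpa using (this.tendsto 0).mono_left nhdsWithin_le_nhds
  refine squeeze_zero_norm' ?_ hlim
  filter_upwards [Ioo_mem_nhdsGT (zero_lt_one (α := ℝ))] with t ht using hkey t ht.1 ht.2

/-- The derivative in z is the line integral of κ, which is zero, so the value is constant on the
half plane; it is read off on the line c = 1 as z = t → 0+. This identity is what makes the
semigroup tend to the identity. -/
theorem lineInt_inv {c : ℝ} (hc : 0 < c) {z : ℂ} (hz : 0 < z.re) :
    lineInt (fun κ => κ⁻¹) c z = 1 := by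
  have hg : ExpGrowth 0 fun κ : ℂ => κ⁻¹ := expGrowth_inv le_rfl
  have h1 : ∀ w : ℂ, 0 < w.re → lineInt (fun κ => κ⁻¹) c w = lineInt (fun κ => κ⁻¹) 1 w := by
    intro w hw
    rcases le_total c 1 with h | h
    · exact lineInt_eq hg hc h hw
    · exact (lineInt_eq hg one_pos h hw).symm
  have hd : ∀ w : ℂ, 0 < w.re → HasDerivAt (lineInt (fun κ : ℂ => κ⁻¹) 1) 0 w := by
    intro w hw
    refine (hasDerivAt_lineInt hg one_pos hw).congr_deriv ?_
    rw [← lineInt_id_smul (E := ℂ) (c := 1) hw 1]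
    refine lineInt_congr (b := 0) one_pos (fun κ hκ => ?_) w
    have : κ ≠ 0 := by rintro rfl; simp at hκ
    simp only [smul_eq_mul]
    field_simp
  have hopen : IsOpen {w : ℂ | 0 < w.re} := isOpen_lt continuous_const Complex.continuous_re
  have hconst : ∀ w : ℂ, 0 < w.re → lineInt (fun κ : ℂ => κ⁻¹) 1 z = lineInt (fun κ => κ⁻¹) 1 w :=
    fun w hw => hopen.is_const_of_deriv_eq_zero (convex_halfSpace_re_gt 0).isPreconnected
      (fun w hw => (hd w hw).differentiableAt.differentiableWithinAt)
      (fun w hw => (hd w hw).deriv) hz hw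
  rw [h1 z hz]
  have hlim : Tendsto (fun t : ℝ => lineInt (fun κ : ℂ => κ⁻¹) 1 (t : ℂ)) (𝓝[>] 0) (𝓝 1) := by
    have h2 := ((tendsto_exp_gauss_cauchy.sub (tendsto_exp_gauss_conj.const_mul Complex.I))).const_mul
      ((Real.pi : ℂ)⁻¹)
    rw [mul_zero, sub_zero, inv_mul_cancel₀ (by exact_mod_cast Real.pi_ne_zero)] at h2
    refine h2.congr' ?_
    filter_upwards [self_mem_nhdsWithin] with t ht
    have e1 : ∀ s : ℝ, ‖(1 : ℂ) + s ^ 2‖ = 1 + s ^ 2 := fun s => by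
      rw [show (1 : ℂ) + s ^ 2 = ((1 + s ^ 2 : ℝ) : ℂ) by push_cast; rfl, Complex.norm_real,
        Real.norm_of_nonneg (by positivity)]
    have hnz : ∀ s : ℝ, (1 : ℂ) + s ^ 2 ≠ 0 := fun s => by norm_cast; positivity
    have n1 : ∀ s : ℝ, ‖Complex.exp (t * ((1 : ℂ) - s ^ 2 + 2 * s * Complex.I))‖ =
        Real.exp t * Real.exp (-t * s ^ 2) := by
      intro s
      rw [Complex.norm_exp, ← Real.exp_add]
      congr 1
      simp [pow_two]; ring
    have hint : ∀ g : ℝ → ℂ, Continuous g → (∀ s, ‖g s‖ ≤ 1) → Integrable fun s : ℝ =>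
        Complex.exp (t * ((1 : ℂ) - s ^ 2 + 2 * s * Complex.I)) * g s := by
      intro g hg1 hg2
      refine ((integrable_exp_neg_mul_sq ht).const_mul (Real.exp t)).mono'
        (Continuous.mul (by fun_prop) hg1).aestronglyMeasurable (Eventually.of_forall fun s => ?_)
      rw [norm_mul, n1]
      exact mul_le_of_le_one_right (by positivity) (hg2 s)
    unfold lineInt
    rw [smul_eq_mul, ← integral_const_mul, ← integral_sub]
    · congr 2
      ext s
      have h3 : (1 : ℂ) + s * Complex.I ≠ 0 := by
        intro h; have := congrArg Complex.re h; simp at this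
      have h4 : ((1 : ℂ) + s * Complex.I)⁻¹ = (1 - s * Complex.I) * ((1 : ℂ) + s ^ 2)⁻¹ := by
        rw [eq_mul_inv_iff_mul_eq₀ (hnz s), inv_mul_eq_iff_eq_mul₀ h3]
        ring_nf; rw [Complex.I_sq]; ring
      have h5 : ((1 : ℂ) + s * Complex.I) ^ 2 = (1 : ℂ) - s ^ 2 + 2 * s * Complex.I := by
        ring_nf; rw [Complex.I_sq]; ring
      dsimp only
      rw [Complex.ofReal_one, h5, h4, smul_eq_mul]; ring
    · refine hint _ (Continuous.inv₀ (by fun_prop) hnz) fun s => ?_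
      rw [norm_inv, e1]
      exact inv_le_one_of_one_le₀ (by nlinarith)
    · refine (hint _ (Continuous.mul (by fun_prop) (Continuous.inv₀ (by fun_prop) hnz))
        fun s => ?_).const_mul _
      change ‖(s : ℂ) * ((1 : ℂ) + s ^ 2)⁻¹‖ ≤ 1
      rw [norm_mul, norm_inv, e1, ← div_eq_mul_inv, div_le_one (by positivity), Complex.norm_real,
        Real.norm_eq_abs, abs_le]
      constructor <;> nlinarith [sq_nonneg (s - 1), sq_nonneg (s + 1)]
  refine tendsto_nhds_unique ?_ hlim
  refine tendsto_const_nhds.congr' ?_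
  filter_upwards [self_mem_nhdsWithin] with t ht
  exact hconst t (by simpa using ht)

end

/-! ### Generation of an analytic semigroup from a parabolic resolvent estimate -/

section
section Generation

variable {V X : Type*} [NormedAddCommGroup V] [NormedSpace ℂ V]
  [NormedAddCommGroup X] [NormedSpace ℂ X]

/-- `ρ κ` is the inverse of `A + κ² j` for `Re κ > b`, with the growth typical of operators whose
spectrum lies in a parabola. -/
structure ParabolicResolvent (j A : V →L[ℂ] X) (ρ : ℂ → X →L[ℂ] V) (b C : ℝ) : Prop where
  one_le : 1 ≤ b
  right_inv : ∀ κ : ℂ, b < κ.re → ∀ x, A (ρ κ x) + κ ^ 2 • j (ρ κ x) = x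
  left_inv : ∀ κ : ℂ, b < κ.re → ∀ v, ρ κ (A v + κ ^ 2 • j v) = v
  norm_le : ∀ κ : ℂ, b < κ.re → ‖ρ κ‖ ≤ C * ‖κ‖ / (κ.re - b)
  diff : DifferentiableOn ℂ ρ {κ | b < κ.re}
  inj : Function.Injective j
  dense : DenseRange j

variable {j A : V →L[ℂ] X} {ρ : ℂ → X →L[ℂ] V} {b C : ℝ}

theorem mem_sector_pi_div_four {z : ℂ} (h : z ∈ sector (Real.pi / 4)) :
    0 < z.re ∧ |z.im| ≤ z.re := by
  obtain ⟨h0, h1⟩ := h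
  have hn : 0 < ‖z‖ := norm_pos_iff.2 h0
  have hpi := Real.pi_pos
  have a0 := abs_nonneg z.arg
  have hc : √2 / 2 ≤ Real.cos z.arg := by
    rw [← Real.cos_abs, ← Real.cos_pi_div_four]
    exact Real.cos_le_cos_of_nonneg_of_le_pi a0 (by linarith) h1.le
  have hs : |Real.sin z.arg| ≤ √2 / 2 := by
    rw [← Real.sin_pi_div_four, Real.abs_sin_eq_sin_abs_of_abs_le_pi (by linarith)]
    exact Real.sin_le_sin_of_le_of_le_pi_div_two (by linarith) (by linarith) h1.le
  have h2 : (0 : ℝ) < √2 / 2 := by positivity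
  rw [← Complex.norm_mul_cos_arg, ← Complex.norm_mul_sin_arg z, abs_mul, abs_of_pos hn]
  exact ⟨mul_pos hn (h2.trans_le hc), by gcongr; linarith⟩

/-- With |Im z| ≤ Re z the exponent in `norm_exp_line_le` adds up to 3 Re z c²; the Gaussian
integral is √(2π/Re z), and √(2π) ≤ π cancels the prefactor 1/π. -/
theorem norm_lineInt_le {E : Type*} [NormedAddCommGroup E] [NormedSpace ℂ E] {f : ℂ → E} {c B : ℝ}
    {z : ℂ} (hz : 0 < z.re) (hz' : |z.im| ≤ z.re) (hB : ∀ s : ℝ, ‖f ((c : ℂ) + s * Complex.I)‖ ≤ B) :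
    ‖lineInt f c z‖ ≤ Real.exp (3 * (z.re * c ^ 2)) * B / √z.re := by
  have hB0 : 0 ≤ B := (norm_nonneg _).trans (hB 0)
  have h1 : ‖∫ s : ℝ, Complex.exp (z * ((c : ℂ) + s * Complex.I) ^ 2) •
      f ((c : ℂ) + s * Complex.I)‖ ≤ ∫ s : ℝ, (Real.exp (3 * (z.re * c ^ 2)) * B) *
        Real.exp (-(z.re / 2) * s ^ 2) := by
    refine norm_integral_le_of_norm_le ((integrable_exp_neg_mul_sq (by positivity)).const_mul _)
      (Eventually.of_forall fun s => ?_)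
    rw [norm_smul]
    have h2 := norm_exp_line_le (c := c) (s := s) hz le_rfl le_rfl hz'
    rw [show z.re * c ^ 2 + 2 * c ^ 2 * z.re ^ 2 / z.re = 3 * (z.re * c ^ 2) by field_simp; ring] at h2
    calc _ ≤ _ := mul_le_mul h2 (hB s) (norm_nonneg _) (by positivity)
      _ = _ := by ring
  rw [integral_const_mul, integral_gaussian, Real.sqrt_div' _ (by positivity)] at h1
  unfold lineInt
  rw [norm_smul, norm_inv, Complex.norm_real, Real.norm_of_nonneg Real.pi_pos.le]
  have h3 : √Real.pi / √(z.re / 2) = √(2 * Real.pi) / √z.re := by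
    rw [← Real.sqrt_div' _ (by positivity), ← Real.sqrt_div' _ (by positivity)]
    congr 1; field_simp
  rw [h3] at h1
  have h4 : √(2 * Real.pi) ≤ Real.pi := by
    rw [Real.sqrt_le_left Real.pi_pos.le]
    nlinarith [Real.pi_gt_three]
  calc _ ≤ Real.pi⁻¹ * (Real.exp (3 * (z.re * c ^ 2)) * B * (Real.pi / √z.re)) := by
        gcongr
        refine h1.trans ?_
        gcongr
    _ = _ := by field_simp

namespace ParabolicResolvent

theorem C_nonneg (h : ParabolicResolvent j A ρ b C) : 0 ≤ C := by
  have h1 := (norm_nonneg _).trans (h.norm_le ((b + 1 : ℝ) : ℂ) (by simp))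
  have h2 : (0 : ℝ) < b + 1 := by linarith [h.one_le]
  rw [Complex.norm_real, Real.norm_of_nonneg h2.le, Complex.ofReal_re, add_sub_cancel_left,
    div_one] at h1
  exact nonneg_of_mul_nonneg_left h1 h2

theorem map_A (h : ParabolicResolvent j A ρ b C) {κ : ℂ} (hκ : b < κ.re) (v : V) :
    ρ κ (A v) = v - κ ^ 2 • ρ κ (j v) := by
  rw [eq_sub_iff_add_eq, ← map_smul, ← map_add]
  exact h.left_inv κ hκ v

theorem expGrowth (h : ParabolicResolvent j A ρ b C) : ExpGrowth b ρ := by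
  refine ⟨h.diff, C, h.C_nonneg, 1, zero_le_one, fun κ hκ => (h.norm_le κ hκ).trans ?_⟩
  have := h.C_nonneg
  have : 0 < κ.re - b := by linarith
  gcongr
  linarith [Real.add_one_le_exp (1 * ‖κ‖)]

theorem expGrowth_smul (h : ParabolicResolvent j A ρ b C) : ExpGrowth b fun κ => κ • ρ κ := by
  simpa using h.expGrowth.smul_pow 1

theorem expGrowth_comp (h : ParabolicResolvent j A ρ b C) :
    ExpGrowth b fun κ => κ • j.comp (ρ κ) := by
  have := h.expGrowth_smul.clm (ContinuousLinearMap.compL ℂ X V X j)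
  exact this.congr fun κ _ => by simp

/-- From κ² jρ = 1 − Aρ and the bound on ρ, after division by |κ|. Seen in X rather than in V, the
resolvent gains the factor |κ|, and the bound depends on Re κ only. -/
theorem norm_le_re {κ : ℂ} (h : ParabolicResolvent j A ρ b C) (hκ : b < κ.re) :
    ‖κ • j.comp (ρ κ)‖ ≤ (1 + ‖A‖ * C) / (κ.re - b) := by
  have h0 : 0 < κ.re - b := by linarith
  have h1 := h.one_le
  have h2 := Complex.re_le_norm κ
  have hκ0 : 0 < ‖κ‖ := by linarith
  have h3 : κ • (κ • j.comp (ρ κ)) = 1 - A.comp (ρ κ) := by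
    ext x
    have := h.right_inv κ hκ x
    simp only [smul_smul, smul_apply, ContinuousLinearMap.comp_apply,
      sub_apply, one_apply_eq_self]
    rw [eq_sub_iff_add_eq, ← pow_two, add_comm]
    exact this
  have h4 : ‖κ‖ * ‖κ • j.comp (ρ κ)‖ ≤ 1 + ‖A‖ * (C * ‖κ‖ / (κ.re - b)) := by
    rw [← norm_smul, h3]
    refine (norm_sub_le _ _).trans (add_le_add ?_ ?_)
    · exact ContinuousLinearMap.norm_id_le
    · exact (A.opNorm_comp_le _).trans (by gcongr; exact h.norm_le κ hκ)
  have h5 : 1 ≤ ‖κ‖ / (κ.re - b) := by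
    rw [one_le_div h0]; linarith
  rw [← mul_le_mul_iff_right₀ hκ0]
  refine h4.trans ?_
  calc _ ≤ ‖κ‖ / (κ.re - b) + ‖A‖ * (C * ‖κ‖ / (κ.re - b)) := by gcongr
    _ = _ := by ring

end ParabolicResolvent

variable [CompleteSpace V] [CompleteSpace X]

variable (j ρ b) in
/-- The holomorphic semigroup, given by a Dunford integral along the parabola `λ = (b + 1 + i s)²`. -/
noncomputable def dunford (z : ℂ) : X →L[ℂ] X := lineInt (fun κ => κ • j.comp (ρ κ)) (b + 1) z

variable (ρ b) in
/-- The semigroup `dunford`, as a map into the domain. -/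
noncomputable def dunfordV (z : ℂ) : X →L[ℂ] V := lineInt (fun κ => κ • ρ κ) (b + 1) z

namespace ParabolicResolvent

theorem j_dunfordV (h : ParabolicResolvent j A ρ b C) {z : ℂ} (hz : 0 < z.re) :
    j.comp (dunfordV ρ b z) = dunford j ρ b z := by
  have := lineInt_clm h.expGrowth_smul (lt_add_one b) hz (ContinuousLinearMap.compL ℂ X V X j)
  refine Eq.trans ?_ (this.symm.trans ?_)
  · rfl
  · unfold dunford; congr 1; ext κ x; simp

/-- The derivative has integrand κ³ jρ = κ − κ Aρ, and the line integral of κ vanishes. -/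
theorem hasDerivAt_dunford (h : ParabolicResolvent j A ρ b C) {z : ℂ} (hz : 0 < z.re) :
    HasDerivAt (dunford j ρ b) (-A.comp (dunfordV ρ b z)) z := by
  refine (hasDerivAt_lineInt h.expGrowth_comp (lt_add_one b) hz).congr_deriv ?_
  have g1 : ExpGrowth b fun κ : ℂ => κ • (1 : X →L[ℂ] X) := by simpa using expGrowth_pow 1 1
  have g2 := h.expGrowth_smul.clm (ContinuousLinearMap.compL ℂ X V X A)
  have e1 : lineInt (fun κ : ℂ => κ ^ 2 • κ • j.comp (ρ κ)) (b + 1) z =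
      lineInt (fun κ : ℂ => κ • (1 : X →L[ℂ] X) -
        ContinuousLinearMap.compL ℂ X V X A (κ • ρ κ)) (b + 1) z := by
    refine lineInt_congr (lt_add_one b) (fun κ hκ => ?_) z
    ext x
    have := h.right_inv κ hκ x
    simp only [smul_smul, smul_apply, ContinuousLinearMap.comp_apply,
      sub_apply, one_apply_eq_self, ContinuousLinearMap.compL_apply,
      map_smul]
    rw [eq_sub_of_add_eq this, smul_sub, sub_sub_cancel, smul_smul]
    congr 1; ring
  rw [e1, lineInt_sub g1 g2 (lt_add_one b) hz, lineInt_id_smul hz,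
    lineInt_clm h.expGrowth_smul (lt_add_one b) hz]
  simp [dunfordV]

theorem dunford_apply_A (h : ParabolicResolvent j A ρ b C) {z : ℂ} (hz : 0 < z.re) (v : V) :
    dunford j ρ b z (A v) = A (dunfordV ρ b z (j v)) := by
  have e1 := lineInt_clm h.expGrowth_comp (lt_add_one b) hz (ContinuousLinearMap.apply ℂ X (A v))
  have e2 := lineInt_clm h.expGrowth_smul (lt_add_one b) hz
    (A.comp (ContinuousLinearMap.apply ℂ V (j v)))
  refine e1.symm.trans (Eq.trans ?_ e2)
  refine lineInt_congr (lt_add_one b) (fun κ hκ => ?_) z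
  simp only [ContinuousLinearMap.apply_apply, ContinuousLinearMap.comp_apply, map_smul]
  have h2 := h.right_inv κ hκ (j v)
  rw [h.map_A hκ, map_sub, map_smul]
  congr 1
  exact (eq_sub_iff_add_eq.2 h2).symm

theorem dunford_apply_j (h : ParabolicResolvent j A ρ b C) {z : ℂ} (hz : 0 < z.re) (v : V) :
    dunford j ρ b z (j v) = j (dunfordV ρ b z (j v)) := by
  rw [← h.j_dunfordV hz]; rfl

/-- The constant in the bounds near zero. -/
theorem norm_dunford_le (h : ParabolicResolvent j A ρ b C) {z : ℂ} (hz : 0 < z.re)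
    (hz' : |z.im| ≤ z.re) (hz1 : z.re ≤ 1) :
    ‖dunford j ρ b z‖ ≤ Real.exp (3 * (b + 1) ^ 2) * (1 + ‖A‖ * C) := by
  have hb := h.one_le
  have hs : 0 < √z.re := Real.sqrt_pos.2 hz
  have hs1 : √z.re ≤ 1 := Real.sqrt_le_one.2 hz1
  have hss : √z.re ^ 2 = z.re := Real.sq_sqrt hz.le
  -- The line is moved to c = b + (Re z)^{-1/2}: there the integrand is O(√Re z), which compensates
  -- the Gaussian integral, while Re z c² ≤ (b + 1)² keeps the exponential bounded.
  have hc : b + 1 ≤ b + (√z.re)⁻¹ := by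
    gcongr; exact (one_le_inv₀ hs).2 hs1
  have hC := h.C_nonneg
  unfold dunford
  rw [lineInt_eq h.expGrowth_comp (lt_add_one b) hc hz]
  refine (norm_lineInt_le (B := (1 + ‖A‖ * C) * √z.re) hz hz' fun s => ?_).trans ?_
  · refine (h.norm_le_re (by simp [hs])).trans (le_of_eq ?_)
    simp
  · rw [← mul_assoc, mul_div_assoc, div_self hs.ne', mul_one]
    gcongr
    nth_rewrite 1 [← hss]
    rw [← mul_pow]
    gcongr
    rw [mul_add, mul_inv_cancel₀ hs.ne']
    nlinarith

/-- By `lineInt_inv`, jv is itself the line integral of κ⁻¹ jv, so the difference is the single line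
integral of κ⁻¹ jρ(Av). On the line Re κ = b + (Re z)^{-1/2} this integrand is O((Re z)^{3/2}). -/
theorem norm_dunford_sub_le (h : ParabolicResolvent j A ρ b C) {z : ℂ} (hz : 0 < z.re)
    (hz' : |z.im| ≤ z.re) (hz1 : z.re ≤ 1) (v : V) :
    ‖dunford j ρ b z (j v) - j v‖ ≤
      Real.exp (3 * (b + 1) ^ 2) * ((1 + ‖A‖ * C) * ‖A v‖) * z.re := by
  have hb := h.one_le
  have hs : 0 < √z.re := Real.sqrt_pos.2 hz
  have hs1 : √z.re ≤ 1 := Real.sqrt_le_one.2 hz1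
  have hss : √z.re ^ 2 = z.re := Real.sq_sqrt hz.le
  have hc : b + 1 ≤ b + (√z.re)⁻¹ := by
    gcongr; exact (one_le_inv₀ hs).2 hs1
  have hbc : b < b + (√z.re)⁻¹ := by linarith
  have hC := h.C_nonneg
  have g1 : ExpGrowth b fun κ : ℂ => κ⁻¹ • j v := by
    have := (expGrowth_inv (b := b) (by linarith)).clm
      (ContinuousLinearMap.toSpanSingleton ℂ (j v))
    exact this.congr fun κ _ => by simp
  have g2 : ExpGrowth b fun κ : ℂ => (κ • j.comp (ρ κ)) (j v) :=
    h.expGrowth_comp.clm (ContinuousLinearMap.apply ℂ X (j v))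
  have e0 : ∀ κ : ℂ, b < κ.re → κ⁻¹ • j v - (κ • j.comp (ρ κ)) (j v) = κ⁻¹ • j (ρ κ (A v)) := by
    intro κ hκ
    have hκ0 : κ ≠ 0 := by rintro rfl; simp at hκ; linarith
    rw [h.map_A hκ, map_sub, smul_sub, map_smul, smul_smul,
      show κ⁻¹ * κ ^ 2 = κ by field_simp]
    rfl
  have e1 : j v - dunford j ρ b z (j v) = lineInt (fun κ => κ⁻¹ • j (ρ κ (A v))) (b + 1) z := by
    rw [← lineInt_congr (lt_add_one b) e0, lineInt_sub g1 g2 (lt_add_one b) hz]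
    congr 1
    · have := lineInt_clm (expGrowth_inv (b := b) (by linarith)) (lt_add_one b) hz
        (ContinuousLinearMap.toSpanSingleton ℂ (j v))
      rw [lineInt_inv (by linarith) hz] at this
      simpa using this.symm
    · exact (lineInt_clm h.expGrowth_comp (lt_add_one b) hz
        (ContinuousLinearMap.apply ℂ X (j v))).symm
  have g3 : ExpGrowth b fun κ => κ⁻¹ • j (ρ κ (A v)) := by
    have := (g1.clm (1 : X →L[ℂ] X))
    refine ExpGrowth.congr (f := fun κ : ℂ => κ⁻¹ • j v - (κ • j.comp (ρ κ)) (j v)) ?_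
      fun κ hκ => (e0 κ hκ).symm
    refine ⟨g1.diff.sub g2.diff, ?_⟩
    obtain ⟨K, hK, m, hm, hb1⟩ := g1.bound
    obtain ⟨K', hK', m', hm', hb2⟩ := g2.bound
    refine ⟨K + K', by positivity, max m m', by positivity, fun κ hκ => ?_⟩
    have : 0 < κ.re - b := by linarith
    refine (norm_sub_le _ _).trans ((add_le_add (hb1 κ hκ) (hb2 κ hκ)).trans ?_)
    rw [← add_div, add_mul]
    gcongr
    · exact le_max_left _ _
    · exact le_max_right _ _
  rw [norm_sub_rev, e1, lineInt_eq g3 (lt_add_one b) hc hz]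
  refine (norm_lineInt_le (B := (1 + ‖A‖ * C) * ‖A v‖ * √z.re ^ 3) hz hz' fun s => ?_).trans ?_
  · set κ : ℂ := ((b + (√z.re)⁻¹ : ℝ) : ℂ) + s * Complex.I with hκd
    have hre : κ.re = b + (√z.re)⁻¹ := by simp [hκd]
    have hκ : b < κ.re := by rw [hre]; exact hbc
    have hκ0 : κ ≠ 0 := by intro h0; rw [h0] at hκ; simp at hκ; linarith
    have h1 := h.norm_le_re hκ
    rw [hre, add_sub_cancel_left, div_inv_eq_mul] at h1
    have h2 : κ⁻¹ • j (ρ κ (A v)) = (κ⁻¹) ^ 2 • ((κ • j.comp (ρ κ)) (A v)) := by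
      simp only [smul_apply, ContinuousLinearMap.comp_apply, smul_smul]
      congr 1; field_simp
    have h3 : ‖κ⁻¹‖ ≤ √z.re := by
      rw [norm_inv, inv_le_comm₀ (norm_pos_iff.2 hκ0) hs]
      have := Complex.re_le_norm κ
      rw [hre] at this
      linarith
    rw [h2, norm_smul, norm_pow]
    calc _ ≤ √z.re ^ 2 * ((1 + ‖A‖ * C) * √z.re * ‖A v‖) := by
          gcongr; exact ((κ • j.comp (ρ κ)).le_opNorm _).trans (by gcongr)
      _ = _ := by ring
  · rw [show Real.exp (3 * (z.re * (b + (√z.re)⁻¹) ^ 2)) * ((1 + ‖A‖ * C) * ‖A v‖ * √z.re ^ 3) / √z.re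
      = Real.exp (3 * (z.re * (b + (√z.re)⁻¹) ^ 2)) * ((1 + ‖A‖ * C) * ‖A v‖) * √z.re ^ 2 by
        field_simp, hss]
    gcongr
    nth_rewrite 1 [← hss]
    rw [← mul_pow]
    gcongr
    rw [mul_add, mul_inv_cancel₀ hs.ne']
    nlinarith

/-- A uniform bound near zero together with convergence on the dense range of j. -/
theorem tendsto_dunford (h : ParabolicResolvent j A ρ b C) (x : X) :
    Tendsto (fun z => dunford j ρ b z x) (𝓝[sector (Real.pi / 4)] 0) (𝓝 x) := by
  set M := Real.exp (3 * (b + 1) ^ 2) * (1 + ‖A‖ * C) with hM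
  have hC := h.C_nonneg
  have hM0 : 0 ≤ M := by positivity
  rw [Metric.tendsto_nhds]
  intro ε hε
  obtain ⟨v, hv⟩ := Metric.denseRange_iff.1 h.dense x (ε / (2 * (M + 2))) (by positivity)
  rw [dist_eq_norm] at hv
  have e1 : ∀ᶠ z : ℂ in 𝓝[sector (Real.pi / 4)] 0, z.re < 1 :=
    ((Complex.continuous_re.tendsto 0).eventually (gt_mem_nhds (by simp))).filter_mono
      nhdsWithin_le_nhds
  have e2 : ∀ᶠ z : ℂ in 𝓝[sector (Real.pi / 4)] 0,
      Real.exp (3 * (b + 1) ^ 2) * ((1 + ‖A‖ * C) * ‖A v‖) * z.re < ε / 2 :=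
    (((Complex.continuous_re.const_mul _).tendsto 0).eventually
      (gt_mem_nhds (by simp [hε]))).filter_mono nhdsWithin_le_nhds
  filter_upwards [e1, e2, self_mem_nhdsWithin] with z h1 h2 h3
  obtain ⟨hz, hz'⟩ := mem_sector_pi_div_four h3
  have k1 := h.norm_dunford_le hz hz' h1.le
  have k2 := h.norm_dunford_sub_le hz hz' h1.le v
  rw [dist_eq_norm]
  have : dunford j ρ b z x - x = dunford j ρ b z (x - j v) + (dunford j ρ b z (j v) - j v) -
      (x - j v) := by rw [map_sub]; abel
  rw [this]
  refine (norm_sub_le _ _).trans_lt ?_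
  have k3 : ‖dunford j ρ b z (x - j v)‖ ≤ M * ‖x - j v‖ :=
    ((dunford j ρ b z).le_opNorm _).trans (by gcongr)
  have k4 := norm_add_le (dunford j ρ b z (x - j v)) (dunford j ρ b z (j v) - j v)
  have k5 : (M + 1) * ‖x - j v‖ ≤ ε / 2 := by
    calc _ ≤ (M + 2) * (ε / (2 * (M + 2))) := by gcongr; linarith
      _ = _ := by field_simp
  linarith

/-- The function r ↦ S(z + w − rz) S(rz) x has derivative zero on (0, 1], because A commutes with S.
Its value at r = 1 is S(w)S(z)x and its limit at r = 0 is S(z + w)x; the limit uses strong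
continuity along the ray of z, hence the sector. -/
theorem dunford_add (h : ParabolicResolvent j A ρ b C) {z w : ℂ} (hz : z ∈ sector (Real.pi / 4))
    (hw : 0 < w.re) :
    dunford j ρ b (z + w) = dunford j ρ b w * dunford j ρ b z := by
  have hzr := (mem_sector_pi_div_four hz).1
  ext x
  set F : ℝ → X := fun r => dunford j ρ b (z + w - r * z) (dunford j ρ b (r * z) x) with hF
  have hre : ∀ r : ℝ, r ≤ 1 → 0 < (z + w - r * z).re := by
    intro r hr
    simp only [Complex.sub_re, Complex.add_re, Complex.mul_re, Complex.ofReal_re,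
      Complex.ofReal_im, zero_mul, sub_zero]
    nlinarith
  have hre' : ∀ r : ℝ, 0 < r → 0 < (r * z).re := by
    intro r hr
    simp only [Complex.mul_re, Complex.ofReal_re, Complex.ofReal_im, zero_mul, sub_zero]
    positivity
  have hder : ∀ r : ℝ, 0 < r → r ≤ 1 → HasDerivAt F 0 r := by
    intro r h0 h1
    have d0 : HasDerivAt (fun r : ℂ => r * z) z (r : ℂ) := by
      simpa using (hasDerivAt_id (r : ℂ)).mul_const z
    have d1 := (h.hasDerivAt_dunford (hre r h1)).scomp (r : ℂ) (d0.const_sub (z + w))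
    have d2 := (h.hasDerivAt_dunford (hre' r h0)).scomp (r : ℂ) d0
    have d3 := (d1.clm_apply (d2.clm_apply (hasDerivAt_const (r : ℂ) x)))
    have d4 := d3.scomp r (hasDerivAt_id r).ofReal_comp
    refine d4.congr_deriv ?_
    simp only [smul_apply, neg_apply, Complex.ofReal_one, one_smul,
      ContinuousLinearMap.comp_apply, Function.comp_apply, map_zero, add_zero, map_smul, map_neg]
    rw [h.dunford_apply_A (hre r h1), ← h.j_dunfordV (hre' r h0)]
    simp
  have hconst : ∀ r ∈ Ioc (0 : ℝ) 1, F r = F 1 := by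
    intro r hr
    have := constant_of_has_deriv_right_zero (f := F) (a := r) (b := 1)
      (fun s hs => (hder s (hr.1.trans_le hs.1) hs.2).continuousAt.continuousWithinAt)
      (fun s hs => (hder s (hr.1.trans_le hs.1) hs.2.le).hasDerivWithinAt) 1 ⟨hr.2, le_rfl⟩
    exact this.symm
  have hlim : Tendsto F (𝓝[>] 0) (𝓝 (dunford j ρ b (z + w) x)) := by
    have c1 : Tendsto (fun r : ℝ => dunford j ρ b (z + w - r * z)) (𝓝[>] 0)
        (𝓝 (dunford j ρ b (z + w))) := by
      have : Tendsto (fun r : ℝ => z + w - r * z) (𝓝 0) (𝓝 (z + w)) := by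
        have : Continuous fun r : ℝ => z + w - r * z := by fun_prop
        simpa using this.tendsto 0
      exact ((h.hasDerivAt_dunford (by simpa using by linarith)).continuousAt.tendsto.comp this).mono_left
        nhdsWithin_le_nhds
    have c2 : Tendsto (fun r : ℝ => dunford j ρ b (r * z) x) (𝓝[>] 0) (𝓝 x) := by
      refine (h.tendsto_dunford x).comp (tendsto_nhdsWithin_iff.2 ⟨?_, ?_⟩)
      · have : Continuous fun r : ℝ => (r : ℂ) * z := by fun_prop
        simpa using (this.tendsto 0).mono_left nhdsWithin_le_nhds
      · filter_upwards [self_mem_nhdsWithin] with r hr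
        refine ⟨mul_ne_zero (by simpa using (ne_of_gt hr)) hz.1, ?_⟩
        rw [Complex.arg_real_mul _ hr]
        exact hz.2
    have c3 := (isBoundedBilinearMap_apply (𝕜 := ℂ) (E := X) (F := X)).continuous.tendsto
      (dunford j ρ b (z + w), x)
    exact c3.comp (c1.prodMk_nhds c2)
  have : F 1 = dunford j ρ b (z + w) x := by
    refine tendsto_nhds_unique (tendsto_const_nhds.congr' ?_) hlim
    filter_upwards [Ioc_mem_nhdsGT (zero_lt_one (α := ℝ))] with r hr using (hconst r hr).symm
  rw [← this]
  simp [hF]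

variable (j ρ b) in
/-- The semigroup on `[0, ∞)`. -/
noncomputable def semigroup (t : ℝ≥0) : X →L[ℂ] X :=
  if t = 0 then 1 else dunford j ρ b ((t : ℝ) : ℂ)

theorem ofReal_mem_sector {t δ : ℝ} (ht : 0 < t) (hδ : 0 < δ) : (t : ℂ) ∈ sector δ :=
  ⟨by simpa using ht.ne', by rw [Complex.arg_ofReal_of_nonneg ht.le]; simpa⟩

theorem isAnalyticSemigroup (h : ParabolicResolvent j A ρ b C) :
    IsAnalyticSemigroup (semigroup j ρ b) := by
  have hpi := Real.pi_pos
  have hpos : ∀ t : ℝ≥0, t ≠ 0 → (0 : ℝ) < t := fun t ht => by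
    exact_mod_cast pos_iff_ne_zero.2 ht
  refine ⟨⟨by simp [semigroup], fun s t => ?_, fun x => ?_⟩, Real.pi / 4, by positivity, by linarith,
    -- At z = 0 the integral has no Gaussian decay, so the identity is put in by hand.
    fun z => if z = 0 then 1 else dunford j ρ b z, fun t => ?_, fun z hz w hw => ?_, ?_, ?_⟩
  · rcases eq_or_ne s 0 with rfl | hs
    · simp [semigroup]
    rcases eq_or_ne t 0 with rfl | ht
    · simp [semigroup]
    have hst : t + s ≠ 0 := by positivity
    have := h.dunford_add (ofReal_mem_sector (hpos t ht) (by positivity : 0 < Real.pi / 4))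
      (w := ((s : ℝ) : ℂ)) (by simpa using hpos s hs)
    rw [add_comm s t]
    simp only [semigroup, hs, ht, hst, if_false]
    rw [← this]
    push_cast
    rfl
  · rw [continuous_iff_continuousAt]
    intro t
    rcases eq_or_ne t 0 with rfl | ht
    · rw [continuousAt_iff_punctured_nhds]
      have h0 : semigroup j ρ b 0 x = x := by simp [semigroup]
      rw [h0]
      have : Tendsto (fun t : ℝ≥0 => ((t : ℝ) : ℂ)) (𝓝[≠] 0) (𝓝[sector (Real.pi / 4)] 0) := by
        refine tendsto_nhdsWithin_iff.2 ⟨?_, ?_⟩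
        · have : Continuous fun t : ℝ≥0 => ((t : ℝ) : ℂ) := by fun_prop
          simpa using (this.tendsto 0).mono_left nhdsWithin_le_nhds
        · filter_upwards [self_mem_nhdsWithin] with t ht
          exact ofReal_mem_sector (hpos t ht) (by positivity)
      refine ((h.tendsto_dunford x).comp this).congr' ?_
      filter_upwards [self_mem_nhdsWithin] with t ht
      have ht' : t ≠ 0 := ht
      simp [semigroup, ht']
    · have h1 : ContinuousAt (fun t : ℝ≥0 => dunford j ρ b ((t : ℝ) : ℂ) x) t := by
        have := (h.hasDerivAt_dunford (z := ((t : ℝ) : ℂ)) (by simpa using hpos t ht)).continuousAt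
        have h2 : ContinuousAt (fun t : ℝ≥0 => ((t : ℝ) : ℂ)) t := by fun_prop
        exact (ContinuousAt.comp (f := fun t : ℝ≥0 => ((t : ℝ) : ℂ)) this h2).clm_apply
          continuousAt_const
      refine h1.congr ?_
      filter_upwards [isOpen_ne.mem_nhds ht] with s hs
      have hs' : s ≠ 0 := hs
      simp [semigroup, hs']
  · by_cases ht : t = 0 <;> simp [semigroup, ht]
  · have hz1 := (mem_sector_pi_div_four hz).1
    have hw1 := (mem_sector_pi_div_four hw).1
    have hne : z + w ≠ 0 := by
      intro h0; have := congrArg Complex.re h0; simp at this; linarith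
    simp only [hz.1, hw.1, hne, if_false]
    rw [add_comm, h.dunford_add hw hz1]
  · intro z hz
    refine ((h.hasDerivAt_dunford (mem_sector_pi_div_four hz).1).differentiableAt.congr_of_eventuallyEq
      ?_).differentiableWithinAt
    filter_upwards [isOpen_ne.mem_nhds hz.1] with w hw
    have hw' : w ≠ 0 := hw
    simp [hw']
  · intro δ' h0 h1 x
    have hsub : sector δ' ⊆ sector (Real.pi / 4) := fun z hz => ⟨hz.1, hz.2.trans h1⟩
    refine ((h.tendsto_dunford x).mono_left (nhdsWithin_mono 0 hsub)).congr' ?_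
    filter_upwards [self_mem_nhdsWithin] with w hw
    simp [hw.1]

/-- The semigroup intertwines both A and j with its V-valued version, hence also A + κ² j and its
inverse. -/
theorem dunford_comm (h : ParabolicResolvent j A ρ b C) {κ : ℂ} (hκ : b < κ.re) {z : ℂ}
    (hz : 0 < z.re) (x : X) : dunford j ρ b z (j (ρ κ x)) = j (ρ κ (dunford j ρ b z x)) := by
  have h1 := h.dunford_apply_A hz (ρ κ x)
  have h2 := h.dunford_apply_j hz (ρ κ x)
  have h3 := h.left_inv κ hκ (dunfordV ρ b z (j (ρ κ x)))
  rw [← h1, ← h2, ← map_smul, ← map_add, h.right_inv κ hκ] at h3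
  rw [h2, h3]

theorem semigroup_comm (h : ParabolicResolvent j A ρ b C) {κ : ℂ} (hκ : b < κ.re) (t : ℝ≥0) (x : X) :
    semigroup j ρ b t (j (ρ κ x)) = j (ρ κ (semigroup j ρ b t x)) := by
  rcases eq_or_ne t 0 with rfl | ht
  · simp [semigroup]
  · simp only [semigroup, ht, if_false]
    exact h.dunford_comm hκ (by simpa using pos_iff_ne_zero.2 ht) x

/-- For t > 0 the derivative of S(t)jv is −S(t)Av, which tends to −Av; a continuous function whose
derivative has a limit at an endpoint is differentiable there from one side. -/
theorem tendsto_slope (h : ParabolicResolvent j A ρ b C) (v : V) :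
    Tendsto (fun t : ℝ≥0 => (((t : ℝ) : ℂ)⁻¹) • (semigroup j ρ b t (j v) - j v)) (𝓝[>] 0)
      (𝓝 (-A v)) := by
  set f : ℝ → X := fun t => semigroup j ρ b t.toNNReal (j v) with hf
  have hd : ∀ t : ℝ, 0 < t → HasDerivAt f (-dunford j ρ b t (A v)) t := by
    intro t ht
    have d1 := (h.hasDerivAt_dunford (z := (t : ℂ)) (by simpa using ht)).clm_apply
      (hasDerivAt_const (t : ℂ) (j v))
    have d2 := d1.scomp t (hasDerivAt_id t).ofReal_comp
    have d3 := d2.congr_of_eventuallyEq (f₁ := f) ?_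
    · refine d3.congr_deriv ?_
      rw [h.dunford_apply_A (by simpa using ht)]
      simp
    · filter_upwards [lt_mem_nhds ht] with s hs
      have hs' : ¬ s ≤ 0 := not_le.2 hs
      simp [hf, semigroup, hs', hs.le]
  have hcont : Continuous f :=
    (h.isAnalyticSemigroup.continuous (j v)).comp continuous_real_toNNReal
  have key : HasDerivWithinAt f (-A v) (Ici 0) 0 := by
    refine hasDerivWithinAt_Ici_of_tendsto_deriv (s := Ioi 0)
      (fun t ht => (hd t ht).differentiableAt.differentiableWithinAt)
      hcont.continuousWithinAt self_mem_nhdsWithin ?_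
    have h1 : Tendsto (fun t : ℝ => -dunford j ρ b t (A v)) (𝓝[>] 0) (𝓝 (-A v)) := by
      refine ((h.tendsto_dunford (A v)).comp (tendsto_nhdsWithin_iff.2 ⟨?_, ?_⟩)).neg
      · simpa using (Complex.continuous_ofReal.tendsto 0).mono_left nhdsWithin_le_nhds
      · filter_upwards [self_mem_nhdsWithin] with r hr
        exact ofReal_mem_sector hr (by positivity)
    refine h1.congr' ?_
    filter_upwards [self_mem_nhdsWithin] with t ht using (hd t ht).deriv.symm
  have key2 := (hasDerivWithinAt_iff_tendsto_slope' (by simp)).1 key.Ioi_of_Ici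
  have key3 : Tendsto (fun t : ℝ≥0 => (t : ℝ)) (𝓝[>] 0) (𝓝[>] 0) := by
    refine tendsto_nhdsWithin_iff.2 ⟨?_, ?_⟩
    · simpa using (NNReal.continuous_coe.tendsto 0).mono_left nhdsWithin_le_nhds
    · filter_upwards [self_mem_nhdsWithin] with t ht
      exact_mod_cast ht
  refine (key2.comp key3).congr fun t => ?_
  simp only [Function.comp_apply, slope_def_module, sub_zero, hf, Real.toNNReal_coe,
    Real.toNNReal_zero]
  rw [show semigroup j ρ b 0 (j v) = j v by simp [semigroup], ← Complex.ofReal_inv,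
    Complex.coe_smul]

theorem isGenerator (h : ParabolicResolvent j A ρ b C) (B : X →ₗ.[ℂ] X)
    (hB : ∀ x y, (x, y) ∈ B.graph ↔ ∃ v, x = j v ∧ y = -A v) :
    IsGenerator B (semigroup j ρ b) := by
  intro x y
  rw [hB]
  constructor
  · rintro ⟨v, rfl, rfl⟩
    exact h.tendsto_slope v
  · intro hxy
    -- Converse inclusion: if the slopes at x converge to y, applying jρ(κ) gives −Aρx = jρy, whence
    -- x = jρ(κ²x − y) lies in the domain. Any κ with Re κ > b would do.
    set κ : ℂ := ((b + 1 : ℝ) : ℂ) with hκd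
    have hκ : b < κ.re := by simp [hκd]
    have t1 := h.tendsto_slope (ρ κ x)
    have t2 := ((j.comp (ρ κ)).continuous.tendsto y).comp hxy
    have t3 : -A (ρ κ x) = j (ρ κ y) := by
      refine tendsto_nhds_unique t1 (t2.congr fun t => ?_)
      simp only [Function.comp_apply, map_smul, map_sub, h.semigroup_comm hκ, ContinuousLinearMap.comp_apply]
    have t4 : x = j (ρ κ (κ ^ 2 • x - y)) := by
      have := h.right_inv κ hκ x
      rw [map_sub, map_sub, ← t3, map_smul, map_smul, sub_neg_eq_add, add_comm, this]
    refine ⟨ρ κ (κ ^ 2 • x - y), t4, ?_⟩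
    refine tendsto_nhds_unique hxy ?_
    have := h.tendsto_slope (ρ κ (κ ^ 2 • x - y))
    rwa [← t4] at this

end ParabolicResolvent
end Generation

end

section
variable {L : ℝ}

/-! ### Functional analysis of `H¹₀(-L, L)` -/

theorem norm_sq_H10 (u : H10 L) : ‖u‖ ^ 2 = ‖fn L u‖ ^ 2 + ‖wderiv L u‖ ^ 2 :=
  WithLp.prod_norm_sq_eq_of_L2 (u : WithLp 2 (LTwo L × LTwo L))

theorem norm_fn_le (u : H10 L) : ‖fn L u‖ ≤ ‖u‖ := by
  have := norm_sq_H10 u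
  exact le_of_sq_le_sq (by nlinarith [sq_nonneg ‖wderiv L u‖]) (norm_nonneg _)

theorem integral_norm_mul_norm_le (f g : LTwo L) :
    ∫ x in Ioo (-L) L, ‖f x‖ * ‖g x‖ ≤ ‖f‖ * ‖g‖ := by
  have h1 := real_inner_le_norm ((Lp.memLp f).norm.toLp) ((Lp.memLp g).norm.toLp)
  rw [Lp.norm_toLp, Lp.norm_toLp, eLpNorm_norm, eLpNorm_norm, L2.inner_def] at h1
  refine (le_of_eq ?_).trans h1
  refine integral_congr_ae ?_
  filter_upwards [(Lp.memLp f).norm.coeFn_toLp, (Lp.memLp g).norm.coeFn_toLp] with x h2 h3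
  rw [h2, h3]
  simp [mul_comm]

theorem integrable_norm_mul_norm (f g : LTwo L) :
    IntegrableOn (fun x => ‖f x‖ * ‖g x‖) (Ioo (-L) L) :=
  (Lp.memLp f).norm.integrable_mul (Lp.memLp g).norm

theorem norm_setIntegral_mul_le (f g : LTwo L) (s : Set ℝ) :
    ‖∫ x in Ioo (-L) L ∩ s, f x * g x‖ ≤ ‖f‖ * ‖g‖ := by
  refine (norm_integral_le_integral_norm _).trans (le_trans ?_ (integral_norm_mul_norm_le f g))
  simp_rw [norm_mul]
  exact setIntegral_mono_set (integrable_norm_mul_norm f g)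
    (Eventually.of_forall fun x => by positivity) (inter_subset_left.eventuallyLE)

/-- The constant function `1`. -/
noncomputable def one (L : ℝ) : LTwo L := indicatorConstLp 2 MeasurableSet.univ (measure_ne_top _ _) 1

theorem one_ae (L : ℝ) : one L =ᵐ[volume.restrict (Ioo (-L) L)] fun _ => 1 := by
  refine indicatorConstLp_coeFn.trans ?_
  simp

theorem norm_dirac_le (x : ℝ) (u : H10 L) : ‖dirac L x u‖ ≤ ‖one L‖ * ‖wderiv L u‖ := by
  rw [dirac_apply]
  refine (le_of_eq ?_).trans (norm_setIntegral_mul_le (one L) (wderiv L u) (Iic x))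
  congr 1
  refine integral_congr_ae ?_
  filter_upwards [ae_restrict_of_ae_restrict_of_subset inter_subset_left (one_ae L)] with y hy
  rw [hy, one_mul]

theorem norm_fn_le_wderiv (u : H10 L) : ‖fn L u‖ ≤ ‖one L‖ * (‖one L‖ * ‖wderiv L u‖) := by
  have h : ‖fn L u‖ ≤ ‖((‖one L‖ * ‖wderiv L u‖ : ℝ) : ℂ) • one L‖ := by
    refine Lp.norm_le_norm_of_ae_le ?_
    filter_upwards [fn_ae_eq_dirac L u, one_ae L,
      Lp.coeFn_smul ((‖one L‖ * ‖wderiv L u‖ : ℝ) : ℂ) (one L)] with x h1 h2 h3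
    rw [h1, h3, Pi.smul_apply, h2]
    refine (norm_dirac_le x u).trans (le_of_eq ?_)
    simp
  rw [norm_smul, Complex.norm_real, Real.norm_of_nonneg (by positivity)] at h
  linarith

/-- Poincaré's inequality, from u(x) = ∫ u' up to x. It makes the range of the weak derivative
closed. -/
theorem norm_le_wderiv (u : H10 L) : ‖u‖ ≤ (1 + ‖one L‖ ^ 2) * ‖wderiv L u‖ := by
  refine le_of_sq_le_sq ?_ (by positivity)
  rw [norm_sq_H10]
  have := norm_fn_le_wderiv u
  have h2 : ‖fn L u‖ ^ 2 ≤ (‖one L‖ * (‖one L‖ * ‖wderiv L u‖)) ^ 2 := by gcongr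
  nlinarith [sq_nonneg (‖one L‖ * ‖wderiv L u‖)]

/-- At −L the boundary condition is built into the definition of the point evaluation; at L it has
to be inherited from test functions. -/
theorem dirac_right_end (u : H10 L) : dirac L L u = 0 := by
  refine closure_induction (P := fun u => dirac L L u = 0)
    (isClosed_eq (dirac L L).continuous continuous_const) ?_ u
  intro v φ h1 h2 h3 h4 h5
  rcases le_or_gt L (-L) with hL | hL
  · rw [dirac_apply]
    exact setIntegral_measure_zero _ (by rw [Ioo_eq_empty (not_lt.2 hL)]; simp)
  rw [dirac_apply]
  have e : Ioo (-L) L ∩ Iic L = Ioo (-L) L := inter_eq_left.2 fun x hx => hx.2.le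
  rw [e, integral_congr_ae h5, ← integral_Ioc_eq_integral_Ioo,
    ← intervalIntegral.integral_of_le hL.le,
    intervalIntegral.integral_deriv_eq_sub (fun y _ => h1.differentiable (by simp) y)
      ((h1.continuous_deriv (by simp)).intervalIntegrable _ _)]
  have a1 : φ (-L) = 0 := image_eq_zero_of_notMem_tsupport fun h => lt_irrefl _ (h3 h).1
  have a2 : φ L = 0 := image_eq_zero_of_notMem_tsupport fun h => lt_irrefl _ (h3 h).2
  rw [a1, a2, sub_zero]

theorem integral_wderiv (u : H10 L) : ∫ x in Ioo (-L) L, wderiv L u x = 0 := by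
  have := dirac_right_end u
  rw [dirac_apply] at this
  have e : Ioo (-L) L ∩ Iic L = Ioo (-L) L := inter_eq_left.2 fun x hx => hx.2.le
  rwa [e] at this

/-- From u(x)² = 2∫ u u'. Only one factor is the derivative, so point evaluations are dominated by
the Dirichlet form with a small constant, at the price of L² terms. -/
theorem norm_dirac_sq_le {x : ℝ} (hx : x ∈ Ioo (-L) L) (u : H10 L) :
    ‖dirac L x u‖ ^ 2 ≤ 2 * (‖fn L u‖ * ‖wderiv L u‖) := by
  refine closure_induction (P := fun u => ‖dirac L x u‖ ^ 2 ≤ 2 * (‖fn L u‖ * ‖wderiv L u‖))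
    (isClosed_le (by fun_prop) (by fun_prop)) ?_ u
  intro v φ h1 h2 h3 h4 h5
  have hd : ∀ y, HasDerivAt φ (deriv φ y) y := fun y => (h1.differentiable (by simp) y).hasDerivAt
  have e : Ioo (-L) L ∩ Iic x = Ioc (-L) x := by
    ext y; simp only [mem_inter_iff, mem_Ioo, mem_Iic, mem_Ioc]
    exact ⟨fun h => ⟨h.1.1, h.2⟩, fun h => ⟨⟨h.1, h.2.trans_lt hx.2⟩, h.2⟩⟩
  have h0 : φ (-L) = 0 := image_eq_zero_of_notMem_tsupport fun h => lt_irrefl _ (h3 h).1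
  have key : φ x ^ 2 = 2 * ∫ y in Ioo (-L) L ∩ Iic x, fn L v y * wderiv L v y := by
    have c1 := h1.continuous
    have c2 := h1.continuous_deriv (by simp)
    have := intervalIntegral.integral_eq_sub_of_hasDerivAt (a := -L) (b := x)
      (f := fun y => φ y ^ 2) (fun y _ => (hd y).pow 2)
      (Continuous.intervalIntegrable (by fun_prop) _ _)
    simp only [h0] at this
    rw [zero_pow two_ne_zero, sub_zero] at this
    rw [← this, intervalIntegral.integral_of_le hx.1.le, e, ← integral_const_mul]
    refine integral_congr_ae ?_
    have hsub : Ioc (-L) x ⊆ Ioo (-L) L := by rw [← e]; exact inter_subset_left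
    filter_upwards [ae_restrict_of_ae_restrict_of_subset hsub h4,
      ae_restrict_of_ae_restrict_of_subset hsub h5] with y k4 k5
    rw [k4, k5]
    push_cast; ring
  rw [dirac_test hx h1 h3 h5, ← norm_pow, key, norm_mul]
  have := norm_setIntegral_mul_le (fn L v) (wderiv L v) (Iic x)
  simpa using this

/-- The primitive of a test function with mean zero is a test function. -/
theorem exists_primitive_test {η : ℝ → ℂ} (h1 : ContDiff ℝ ∞ η) (h2 : HasCompactSupport η)
    (h3 : tsupport η ⊆ Ioo (-L) L) (h4 : ∫ x, η x = 0) : ∃ φ : ℝ → ℂ, ContDiff ℝ ∞ φ ∧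
      HasCompactSupport φ ∧ tsupport φ ⊆ Ioo (-L) L ∧ deriv φ = η := by
  rcases (tsupport η).eq_empty_or_nonempty with hem | hne
  · have : η = 0 := tsupport_eq_empty_iff.1 hem
    exact ⟨0, contDiff_const, HasCompactSupport.zero, by simp, by
      rw [this]; ext x; exact deriv_const x (0 : ℂ)⟩
  have hcpt : IsCompact (tsupport η) := h2
  obtain ⟨a, ha, ha'⟩ := hcpt.exists_isLeast hne
  obtain ⟨b, hb, hb'⟩ := hcpt.exists_isGreatest hne
  have ha1 := h3 ha
  have hb1 := h3 hb
  have hz : ∀ x, x ∉ Icc a b → η x = 0 := fun x hx =>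
    image_eq_zero_of_notMem_tsupport fun h => hx ⟨ha' h, hb' h⟩
  have hd : ∀ x, HasDerivAt (fun x => ∫ y in (-L)..x, η y) (η x) x := fun x =>
    intervalIntegral.integral_hasDerivAt_right (h1.continuous.intervalIntegrable _ _)
      (h1.continuous.stronglyMeasurableAtFilter _ _) h1.continuous.continuousAt
  have hderiv : deriv (fun x => ∫ y in (-L)..x, η y) = η := funext fun x => (hd x).deriv
  have hsupp : Function.support (fun x => ∫ y in (-L)..x, η y) ⊆ Icc a b := by
    intro x hx
    by_contra hx'
    refine hx ?_
    rcases not_and_or.1 hx' with h | h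
    · rw [not_le] at h
      refine intervalIntegral.integral_zero_ae (Eventually.of_forall fun y hy => ?_)
      refine hz y fun hy' => ?_
      rw [mem_uIoc] at hy
      rcases hy with hy | hy
      · linarith [hy'.1, hy.2]
      · linarith [hy'.1, hy.2, ha1.1]
    · rw [not_le] at h
      simp only
      rw [intervalIntegral.integral_eq_integral_of_support_subset, h4]
      intro y hy
      by_contra hy'
      refine hy (hz y fun hy2 => hy' ⟨ha1.1.trans_le hy2.1, hy2.2.trans h.le⟩)
  have hts : tsupport (fun x => ∫ y in (-L)..x, η y) ⊆ Icc a b :=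
    closure_minimal hsupp isClosed_Icc
  refine ⟨_, ?_, ?_, hts.trans fun x hx => ⟨ha1.1.trans_le hx.1, hx.2.trans_lt hb1.2⟩, hderiv⟩
  · rw [contDiff_infty_iff_deriv, hderiv]
    exact ⟨fun x => (hd x).differentiableAt, h1⟩
  · exact isCompact_Icc.of_isClosed_subset (isClosed_tsupport _) hts

theorem exists_test_integral_one (hL : 0 < L) : ∃ θ : ℝ → ℂ, ContDiff ℝ ∞ θ ∧
    HasCompactSupport θ ∧ tsupport θ ⊆ Ioo (-L) L ∧ ∫ x, θ x = 1 := by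
  let B : ContDiffBump (0 : ℝ) := ⟨L / 4, L / 2, by linarith, by linarith⟩
  refine ⟨fun x => (B.normed volume x : ℂ), Complex.ofRealCLM.contDiff.comp B.contDiff_normed,
    B.hasCompactSupport_normed.comp_left (g := fun x : ℝ => (x : ℂ)) (by simp),
    (tsupport_comp_subset (g := fun x : ℝ => (x : ℂ)) (by simp) _).trans ?_, ?_⟩
  · rw [B.tsupport_normed_eq, Real.closedBall_eq_Icc]
    intro x hx
    have h1 : (0 : ℝ) - L / 2 ≤ x := hx.1
    have h2 : x ≤ 0 + L / 2 := hx.2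
    exact ⟨by linarith, by linarith⟩
  · rw [integral_complex_ofReal, B.integral_normed, Complex.ofReal_one]

theorem setIntegral_test {f η : ℝ → ℂ} (h3 : tsupport η ⊆ Ioo (-L) L) :
    ∫ x in Ioo (-L) L, f x * η x = ∫ x, f x * η x := by
  refine setIntegral_eq_integral_of_forall_compl_eq_zero fun x hx => ?_
  rw [image_eq_zero_of_notMem_tsupport fun h => hx (h3 h), mul_zero]

/-- The lemma of du Bois-Reymond. -/
theorem exists_const_of_test (hL : 0 < L) (k : LTwo L) (h : ∀ φ : ℝ → ℂ, ContDiff ℝ ∞ φ →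
    HasCompactSupport φ → tsupport φ ⊆ Ioo (-L) L → ∫ x in Ioo (-L) L, k x * deriv φ x = 0) :
    ∃ c : ℂ, k = c • one L := by
  obtain ⟨θ, t1, t2, t3, t4⟩ := exists_test_integral_one hL
  set c := ∫ x in Ioo (-L) L, k x * θ x with hc
  refine ⟨c, sub_eq_zero.1 (ae_eq_zero_of_test _ fun η h1 h2 h3 => ?_)⟩
  set m := ∫ x, η x with hm
  have iη : Integrable η := h1.continuous.integrable_of_hasCompactSupport h2
  have iθ : Integrable θ := t1.continuous.integrable_of_hasCompactSupport t2
  have s3 : tsupport (fun x => η x - m * θ x) ⊆ Ioo (-L) L :=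
    -- Subtracting m θ makes the mean zero, so that η − mθ is the derivative of a test function.
    (tsupport_sub η fun x => m * θ x).trans
      (union_subset h3 ((tsupport_mul_subset_right (f := fun _ => m)).trans t3))
  have s4 : ∫ x, (η x - m * θ x) = 0 := by
    rw [integral_sub iη (iθ.const_mul m), integral_const_mul, t4]
    simp [hm]
  obtain ⟨φ, f1, f2, f3, f4⟩ := exists_primitive_test (L := L) (η := fun x => η x - m * θ x)
    (h1.sub (contDiff_const.mul t1)) (h2.sub t2.mul_left) s3 s4
  have hb : ∀ g : ℝ → ℂ, Continuous g → HasCompactSupport g →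
      IntegrableOn (fun x => k x * g x) (Ioo (-L) L) := fun g g1 g2 =>
    (Lp.memLp k).integrable_mul (q := 2) ((g1.memLp_of_hasCompactSupport g2).restrict _)
  have i1 := hb η h1.continuous h2
  have i2 := hb θ t1.continuous t2
  have h0 := h φ f1 f2 f3
  rw [f4] at h0
  have e1 : ∫ x in Ioo (-L) L, k x * (η x - m * θ x) =
      (∫ x in Ioo (-L) L, k x * η x) - m * c := by
    rw [hc, ← integral_const_mul, ← integral_sub i1 (i2.const_mul m)]
    refine integral_congr_ae (Eventually.of_forall fun x => ?_)
    simp only; ring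
  have e2 : ∫ x in Ioo (-L) L, (k - c • one L : LTwo L) x * η x =
      (∫ x in Ioo (-L) L, k x * η x) - c * m := by
    have e3 : m = ∫ x in Ioo (-L) L, η x := by
      have := setIntegral_test (f := fun _ => 1) h3
      simpa using this.symm
    rw [e3, ← integral_const_mul, ← integral_sub i1 (iη.integrableOn.const_mul c)]
    refine integral_congr_ae ?_
    filter_upwards [Lp.coeFn_sub k (c • one L), Lp.coeFn_smul c (one L), one_ae L] with x k1 k2 k3
    rw [k1, Pi.sub_apply, k2, Pi.smul_apply, k3]
    simp only [smul_eq_mul]; ring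
  rw [e2, ← h0, e1]; ring

theorem isClosed_range_wderiv (L : ℝ) : IsClosed (range (wderiv L)) := by
  refine AntilipschitzWith.isClosed_range (K := (1 + ‖one L‖ ^ 2).toNNReal) ?_
    (wderiv L).uniformContinuous
  refine AddMonoidHomClass.antilipschitz_of_bound _ fun u => ?_
  rw [Real.coe_toNNReal _ (by positivity)]
  exact norm_le_wderiv u

/-- The range of the weak derivative is closed and its orthogonal complement consists of constants
by du Bois-Reymond; a function of mean zero is orthogonal to those. This is the tool for building
elements of H¹₀ from their derivatives. -/
theorem exists_of_wderiv (hL : 0 < L) (g : LTwo L) (hg : ∫ x in Ioo (-L) L, g x = 0) :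
    ∃ u : H10 L, wderiv L u = g := by
  set S : Submodule ℂ (LTwo L) := LinearMap.range (wderiv L).toLinearMap with hS
  have hcl : IsClosed (S : Set (LTwo L)) := isClosed_range_wderiv L
  suffices g ∈ S by exact this
  rw [← hcl.submodule_topologicalClosure_eq, ← Submodule.orthogonal_orthogonal_eq_closure]
  rw [Submodule.mem_orthogonal]
  intro k hk
  rw [Submodule.mem_orthogonal] at hk
  obtain ⟨c, rfl⟩ := exists_const_of_test hL k fun φ h1 h2 h3 => by
    have h1' : ContDiff ℝ ∞ fun x => (starRingEnd ℂ) (φ x) := Complex.conjCLE.contDiff.comp h1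
    have h2' : HasCompactSupport fun x => (starRingEnd ℂ) (φ x) :=
      h2.comp_left (g := starRingEnd ℂ) (map_zero _)
    have h3' : tsupport (fun x => (starRingEnd ℂ) (φ x)) ⊆ Ioo (-L) L :=
      (tsupport_comp_subset (map_zero (starRingEnd ℂ)) φ).trans h3
    obtain ⟨u, -, hu⟩ := exists_test L h1' h2' h3'
    have := hk _ ⟨u, rfl⟩
    rw [L2.inner_def] at this
    rw [← this]
    refine integral_congr_ae ?_
    filter_upwards [hu] with x hx
    have hd : deriv (fun x => (starRingEnd ℂ) (φ x)) x = (starRingEnd ℂ) (deriv φ x) :=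
      ((h1.differentiable (by simp) x).hasDerivAt.star).deriv
    simp [hx, hd]
  rw [inner_smul_left, L2.inner_def]
  have : ∫ x in Ioo (-L) L, inner ℂ (one L x) (g x) = ∫ x in Ioo (-L) L, g x := by
    refine integral_congr_ae ?_
    filter_upwards [one_ae L] with x hx
    simp [hx]
  rw [this, hg, mul_zero]

/-- A continuous, piecewise differentiable function which vanishes at `±L` belongs to `H¹₀`. -/
theorem exists_of_piecewise (hL : 0 < L) {U U' : ℝ → ℂ} {s : Set ℝ} (hs : s.Countable)
    (hc : ContinuousOn U (Icc (-L) L)) (hd : ∀ x ∈ Ioo (-L) L \ s, HasDerivAt U (U' x) x) {C : ℝ}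
    (hC : ∀ x ∈ Ioo (-L) L, ‖U' x‖ ≤ C) (hl : U (-L) = 0) (hr : U L = 0) : ∃ u : H10 L,
      (∀ x ∈ Ioo (-L) L, dirac L x u = U x) ∧
      fn L u =ᵐ[volume.restrict (Ioo (-L) L)] U ∧
      wderiv L u =ᵐ[volume.restrict (Ioo (-L) L)] U' := by
  have hderiv : deriv U =ᵐ[volume.restrict (Ioo (-L) L)] U' := by
    filter_upwards [ae_restrict_mem measurableSet_Ioo,
      ae_restrict_of_ae (hs.ae_notMem volume)] with x h1 h2
    exact (hd x ⟨h1, h2⟩).deriv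
  have hm : MemLp U' 2 (volume.restrict (Ioo (-L) L)) := by
    refine MemLp.of_bound ((aestronglyMeasurable_deriv U _).congr hderiv) C ?_
    filter_upwards [ae_restrict_mem measurableSet_Ioo] with x hx using hC x hx
  have hi : IntegrableOn U' (Ioo (-L) L) := hm.integrable (by norm_num)
  have hftc : ∀ x ∈ Icc (-L) L, ∫ y in Ioo (-L) L ∩ Iic x, U' y = U x := by
    intro x hx
    have hii : IntervalIntegrable U' volume (-L) x := by
      rw [intervalIntegrable_iff_integrableOn_Ioo_of_le hx.1]
      exact hi.mono_set (Ioo_subset_Ioo_right hx.2)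
    have h1 := integral_eq_of_hasDerivAt_off_countable_of_le U U' hx.1 hs
      (hc.mono (Icc_subset_Icc_right hx.2))
      (fun y hy => hd y ⟨⟨hy.1.1, hy.1.2.trans_le hx.2⟩, hy.2⟩) hii
    rw [hl, sub_zero, intervalIntegral.integral_of_le hx.1, integral_Ioc_eq_integral_Ioo] at h1
    rw [← h1]
    refine setIntegral_congr_set ?_
    have : ({x} : Set ℝ)ᶜ ∈ ae volume := compl_mem_ae_iff.2 (measure_singleton x)
    filter_upwards [this] with y hy
    have hy' : y ≠ x := hy
    apply propext
    change y ∈ Ioo (-L) L ∩ Iic x ↔ y ∈ Ioo (-L) x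
    simp only [mem_inter_iff, mem_Ioo, mem_Iic]
    exact ⟨fun h => ⟨h.1.1, lt_of_le_of_ne h.2 hy'⟩, fun h => ⟨⟨h.1, h.2.trans_le hx.2⟩, h.2.le⟩⟩
  obtain ⟨u, hu⟩ := exists_of_wderiv hL hm.toLp (by
    rw [integral_congr_ae hm.coeFn_toLp, ← hr, ← hftc L ⟨by linarith, le_rfl⟩]
    have e : Ioo (-L) L ∩ Iic L = Ioo (-L) L := inter_eq_left.2 fun x hx => hx.2.le
    rw [e])
  have hw : wderiv L u =ᵐ[volume.restrict (Ioo (-L) L)] U' := by rw [hu]; exact hm.coeFn_toLp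
  have hdir : ∀ x ∈ Ioo (-L) L, dirac L x u = U x := by
    intro x hx
    rw [dirac_apply, ← hftc x ⟨hx.1.le, hx.2.le⟩]
    exact integral_congr_ae (ae_restrict_of_ae_restrict_of_subset inter_subset_left hw)
  refine ⟨u, hdir, ?_, hw⟩
  filter_upwards [fn_ae_eq_dirac L u, ae_restrict_mem measurableSet_Ioo] with x h1 h2
  rw [h1, hdir x h2]

/-- Integration of an `L²` function up to `x`. -/
noncomputable def intTo (L x : ℝ) : LTwo L →L[ℂ] ℂ :=
  innerSL ℂ (indicatorConstLp 2 (μ := volume.restrict (Ioo (-L) L)) (s := Iic x)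
    measurableSet_Iic (measure_ne_top _ _) (1 : ℂ))

theorem dirac_eq_intTo (L x : ℝ) (u : H10 L) : dirac L x u = intTo L x (wderiv L u) := rfl

/-- Multiplication by a bounded function on `L²`. -/
noncomputable def mulOp (m : Lp ℂ ∞ (volume.restrict (Ioo (-L) L))) : LTwo L →L[ℂ] LTwo L :=
  (ContinuousLinearMap.mul ℂ ℂ).holderL (volume.restrict (Ioo (-L) L)) ∞ 2 2 m

theorem mulOp_ae (m : Lp ℂ ∞ (volume.restrict (Ioo (-L) L))) (f : LTwo L) :
    mulOp m f =ᵐ[volume.restrict (Ioo (-L) L)] fun x => m x * f x :=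
  (ContinuousLinearMap.mul ℂ ℂ).coeFn_holder m f

/-- A real Lipschitz function, given with its derivative off a countable set. -/
structure IsMultiplier (L : ℝ) (M M' : ℝ → ℝ) : Prop where
  cont : ContinuousOn M (Icc (-L) L)
  deriv : ∃ s : Set ℝ, s.Countable ∧ ∀ x ∈ Ioo (-L) L \ s, HasDerivAt M (M' x) x
  bound : ∃ C, ∀ x ∈ Ioo (-L) L, |M' x| ≤ C

theorem IsMultiplier.exists_bound {M M' : ℝ → ℝ} (h : IsMultiplier L M M') :
    ∃ C, ∀ x ∈ Icc (-L) L, |M x| ≤ C :=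
  isCompact_Icc.exists_bound_of_continuousOn h.cont

theorem IsMultiplier.memLp {M M' : ℝ → ℝ} (h : IsMultiplier L M M') :
    MemLp (fun x => (M x : ℂ)) ∞ (volume.restrict (Ioo (-L) L)) := by
  obtain ⟨C, hC⟩ := h.exists_bound
  refine memLp_top_of_bound ?_ C ?_
  · have : ContinuousOn (fun x => (M x : ℂ)) (Ioo (-L) L) :=
      Complex.continuous_ofReal.comp_continuousOn (h.cont.mono Ioo_subset_Icc_self)
    exact this.aestronglyMeasurable measurableSet_Ioo
  · filter_upwards [ae_restrict_mem measurableSet_Ioo] with x hx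
    simpa using hC x (Ioo_subset_Icc_self hx)

theorem IsMultiplier.memLp_deriv {M M' : ℝ → ℝ} (h : IsMultiplier L M M') :
    MemLp (fun x => (M' x : ℂ)) ∞ (volume.restrict (Ioo (-L) L)) := by
  obtain ⟨C, hC⟩ := h.bound
  obtain ⟨s, hs, hd⟩ := h.deriv
  refine memLp_top_of_bound ?_ C ?_
  · refine Complex.continuous_ofReal.comp_aestronglyMeasurable (g := Complex.ofReal) ?_
    refine (aestronglyMeasurable_deriv M _).congr ?_
    filter_upwards [ae_restrict_mem measurableSet_Ioo,
      ae_restrict_of_ae (hs.ae_notMem volume)] with x h1 h2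
    exact (hd x ⟨h1, h2⟩).deriv
  · filter_upwards [ae_restrict_mem measurableSet_Ioo] with x hx
    simpa using hC x hx

/-- The multiplication operator on `L²`. -/
noncomputable def IsMultiplier.op {M M' : ℝ → ℝ} (h : IsMultiplier L M M') : LTwo L →L[ℂ] LTwo L :=
  mulOp h.memLp.toLp

theorem IsMultiplier.op_ae {M M' : ℝ → ℝ} (h : IsMultiplier L M M') (f : LTwo L) :
    h.op f =ᵐ[volume.restrict (Ioo (-L) L)] fun x => M x * f x := by
  filter_upwards [mulOp_ae h.memLp.toLp f, h.memLp.coeFn_toLp] with x h1 h2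
  rw [IsMultiplier.op, h1, h2]

/-- The operator `u ↦ (M u)' = M u' + M' u`. -/
noncomputable def IsMultiplier.dop {M M' : ℝ → ℝ} (h : IsMultiplier L M M') : H10 L →L[ℂ] LTwo L :=
  h.op.comp (wderiv L) + (mulOp h.memLp_deriv.toLp).comp (fn L)

theorem IsMultiplier.dop_ae {M M' : ℝ → ℝ} (h : IsMultiplier L M M') (u : H10 L) :
    h.dop u =ᵐ[volume.restrict (Ioo (-L) L)] fun x => M x * wderiv L u x + M' x * fn L u x := by
  filter_upwards [Lp.coeFn_add (h.op (wderiv L u)) (mulOp h.memLp_deriv.toLp (fn L u)),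
    h.op_ae (wderiv L u), mulOp_ae h.memLp_deriv.toLp (fn L u), h.memLp_deriv.coeFn_toLp]
    with x h1 h2 h3 h4
  change (h.op (wderiv L u) + mulOp h.memLp_deriv.toLp (fn L u) : LTwo L) x = _
  rw [h1, Pi.add_apply, h2, h3, h4]

/-- For a test function the product is continuous and piecewise differentiable, so it lies in H¹₀;
since the range of the weak derivative is closed, the assertion passes to limits. -/
theorem IsMultiplier.exists_mul {M M' : ℝ → ℝ} (h : IsMultiplier L M M') (hL : 0 < L) (w : H10 L) :
    ∃ v : H10 L, wderiv L v = h.dop w ∧ ∀ x ∈ Ioo (-L) L, dirac L x v = M x * dirac L x w := by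
  have key : h.dop w ∈ range (wderiv L) ∧
      ∀ x ∈ Ioo (-L) L, intTo L x (h.dop w) = M x * dirac L x w := by
    refine closure_induction (P := fun w => h.dop w ∈ range (wderiv L) ∧
      ∀ x ∈ Ioo (-L) L, intTo L x (h.dop w) = M x * dirac L x w) ?_ ?_ w
    · simp only [ofPred_and, ofPred_forall]
      refine ((isClosed_range_wderiv L).preimage h.dop.continuous).inter
        (isClosed_iInter fun x => isClosed_iInter fun _ => ?_)
      exact isClosed_eq (by fun_prop) (by fun_prop)
    · intro w φ h1 h2 h3 h4 h5
      obtain ⟨s, hs, hd⟩ := h.deriv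
      obtain ⟨C, hC⟩ := h.bound
      obtain ⟨D, hD⟩ := h.exists_bound
      obtain ⟨E, hE⟩ := h2.exists_bound_of_continuous h1.continuous
      obtain ⟨F, hF⟩ := h2.deriv.exists_bound_of_continuous (h1.continuous_deriv (by simp))
      have z1 : φ (-L) = 0 := image_eq_zero_of_notMem_tsupport fun h => lt_irrefl _ (h3 h).1
      have z2 : φ L = 0 := image_eq_zero_of_notMem_tsupport fun h => lt_irrefl _ (h3 h).2
      obtain ⟨u, u1, -, u3⟩ := exists_of_piecewise hL (U := fun x => (M x : ℂ) * φ x)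
        (U' := fun x => (M x : ℂ) * _root_.deriv φ x + M' x * φ x) (C := D * F + C * E) hs
        ((Complex.continuous_ofReal.comp_continuousOn h.cont).mul h1.continuous.continuousOn)
        (fun x hx => (((hd x hx).ofReal_comp).mul
          (h1.differentiable (by simp) x).hasDerivAt).congr_deriv (add_comm _ _))
        (fun x hx => by
          have a1 := hC x hx
          have a2 := hD x (Ioo_subset_Icc_self hx)
          refine (norm_add_le _ _).trans ?_
          rw [norm_mul, norm_mul, Complex.norm_real, Complex.norm_real, Real.norm_eq_abs,
            Real.norm_eq_abs]
          have := (abs_nonneg _).trans a1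
          have := (abs_nonneg _).trans a2
          gcongr
          · exact hF x
          · exact hE x)
        (by simp [z1]) (by simp [z2])
      have e : wderiv L u = h.dop w := by
        refine Lp.ext ?_
        filter_upwards [u3, h.dop_ae w, h4, h5] with x k1 k2 k3 k4
        rw [k1, k2, k3, k4]
      refine ⟨⟨u, e⟩, fun x hx => ?_⟩
      rw [← e, ← dirac_eq_intTo, u1 x hx, dirac_test hx h1 h3 h5]
  obtain ⟨⟨v, hv⟩, hx⟩ := key
  exact ⟨v, hv, fun x hx' => by rw [dirac_eq_intTo, hv, hx x hx']⟩

/-- Complex conjugation on `H¹₀`. -/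
theorem exists_conj (hL : 0 < L) (u : H10 L) : ∃ v : H10 L,
    wderiv L v = star (wderiv L u) ∧ (∀ x, dirac L x v = (starRingEnd ℂ) (dirac L x u)) ∧
    fn L v = star (fn L u) ∧ ‖v‖ = ‖u‖ := by
  obtain ⟨v, hv⟩ := exists_of_wderiv hL (star (wderiv L u)) (by
    rw [integral_congr_ae (Lp.coeFn_star (wderiv L u))]
    have := integral_conj (f := wderiv L u) (μ := volume.restrict (Ioo (-L) L))
    simp only [Pi.star_apply, RCLike.star_def]
    rw [this, integral_wderiv, map_zero])
  have hd : ∀ x, dirac L x v = (starRingEnd ℂ) (dirac L x u) := by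
    intro x
    rw [dirac_apply, dirac_apply, hv, ← integral_conj]
    refine integral_congr_ae ?_
    filter_upwards [ae_restrict_of_ae_restrict_of_subset inter_subset_left
      (Lp.coeFn_star (wderiv L u))] with y hy
    rw [hy]; rfl
  have hf : fn L v = star (fn L u) := by
    refine Lp.ext ?_
    filter_upwards [fn_ae_eq_dirac L u, fn_ae_eq_dirac L v, Lp.coeFn_star (fn L u)] with x h1 h2 h3
    rw [h2, h3, hd, Pi.star_apply, h1]; rfl
  have hn : ∀ f : LTwo L, ‖star f‖ = ‖f‖ := fun f => by
    refine le_antisymm (Lp.norm_le_norm_of_ae_le ?_) (Lp.norm_le_norm_of_ae_le ?_) <;>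
    · filter_upwards [Lp.coeFn_star f] with x hx
      rw [hx, Pi.star_apply, norm_star]
  refine ⟨v, hv, hd, hf, ?_⟩
  rw [← sq_eq_sq₀ (norm_nonneg _) (norm_nonneg _), norm_sq_H10, norm_sq_H10, hv, hf, hn, hn]

end

section
variable {L : ℝ}

/-! ### The resolvent of `A_{L,β}` -/

/-- The Riesz isomorphism carries S to a subspace of the Hilbert space H¹₀ whose orthogonal
complement is the annihilator of S. -/
theorem dense_of_annihilator {S : Submodule ℂ (Hm1 L)} (h : ∀ z : H10 L, (∀ f ∈ S, f z = 0) → z = 0) :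
    Dense (S : Set (Hm1 L)) := by
  set D := InnerProductSpace.toDual ℂ (H10 L) with hD
  set K : Submodule ℂ (H10 L) := S.comap (D.toLinearEquiv : H10 L →ₛₗ[starRingEnd ℂ] Hm1 L) with hK
  have hK0 : K.topologicalClosure = ⊤ := by
    rw [Submodule.topologicalClosure_eq_top_iff, Submodule.eq_bot_iff]
    intro z hz
    refine h z fun f hf => ?_
    rw [Submodule.mem_orthogonal] at hz
    have := hz (D.symm f) (by simpa [hK] using hf)
    rwa [← InnerProductSpace.toDual_apply_apply, ← hD, D.apply_symm_apply] at this
  have hd : Dense (K : Set (H10 L)) := Submodule.dense_iff_topologicalClosure_eq_top.2 hK0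
  have h2 := D.surjective.denseRange.dense_image D.continuous hd
  refine h2.mono (image_subset_iff.2 fun z hz => ?_)
  simpa [hK] using hz

section Generic

variable {V X : Type*} [NormedAddCommGroup V] [NormedSpace ℂ V] [CompleteSpace V]
  [NormedAddCommGroup X] [NormedSpace ℂ X] [CompleteSpace X]

/-- A lower bound gives injectivity and closed range, and density of the range then gives
surjectivity. -/
theorem exists_equiv_of_bounded_below (T : V →L[ℂ] X) {c : ℝ} (hc : 0 < c)
    (h : ∀ u, c * ‖u‖ ≤ ‖T u‖) (hd : DenseRange T) : ∃ e : V ≃L[ℂ] X, (e : V →L[ℂ] X) = T := by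
  have hanti : AntilipschitzWith c⁻¹.toNNReal T := by
    refine ContinuousLinearMap.antilipschitz_of_bound T fun u => ?_
    rw [Real.coe_toNNReal _ (by positivity), inv_mul_eq_div, le_div_iff₀ hc, mul_comm]
    exact h u
  have hinj : LinearMap.ker T.toLinearMap = ⊥ := LinearMap.ker_eq_bot.2 hanti.injective
  have hcl : IsClosed (range T) := hanti.isClosed_range T.uniformContinuous
  have hsurj : LinearMap.range T.toLinearMap = ⊤ := by
    rw [Submodule.eq_top_iff']
    intro f
    have : f ∈ closure (range T) := hd f
    rwa [hcl.closure_eq] at this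
  exact ⟨ContinuousLinearEquiv.ofBijective T hinj hsurj, by ext; rfl⟩

theorem ParabolicResolvent.of_bounded_below {j A : V →L[ℂ] X} {b : ℝ} (hb : 1 ≤ b)
    (hj : Function.Injective j) (hd : DenseRange j)
    (h : ∀ κ : ℂ, b < κ.re → ∀ u, (κ.re - b) * ‖u‖ ≤ ‖κ‖ * ‖(A + κ ^ 2 • j) u‖)
    (hr : ∀ κ : ℂ, b < κ.re → DenseRange (A + κ ^ 2 • j)) :
    ParabolicResolvent j A (fun κ => (A + κ ^ 2 • j).inverse) b 1 := by
  have key : ∀ κ : ℂ, b < κ.re → ∃ e : V ≃L[ℂ] X, (e : V →L[ℂ] X) = A + κ ^ 2 • j := by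
    intro κ hκ
    have h1 := Complex.re_le_norm κ
    have h2 : 0 < ‖κ‖ := by linarith
    refine exists_equiv_of_bounded_below _ (div_pos (sub_pos.2 hκ) h2) (fun u => ?_) (hr κ hκ)
    rw [div_mul_eq_mul_div, div_le_iff₀ h2, mul_comm _ ‖κ‖]
    exact h κ hκ u
  refine ⟨hb, fun κ hκ f => ?_, fun κ hκ u => ?_, fun κ hκ => ?_, fun κ hκ => ?_, hj, hd⟩
  · obtain ⟨e, he⟩ := key κ hκ
    change (A + κ ^ 2 • j) ((A + κ ^ 2 • j).inverse f) = f
    rw [← he, ContinuousLinearMap.inverse_equiv]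
    simp
  · obtain ⟨e, he⟩ := key κ hκ
    change (A + κ ^ 2 • j).inverse ((A + κ ^ 2 • j) u) = u
    rw [← he, ContinuousLinearMap.inverse_equiv]
    simp
  · obtain ⟨e, he⟩ := key κ hκ
    have hpos : 0 < κ.re - b := by linarith
    refine ContinuousLinearMap.opNorm_le_bound _ (by positivity) fun f => ?_
    have h1 := h κ hκ ((A + κ ^ 2 • j).inverse f)
    have h2 : (A + κ ^ 2 • j) ((A + κ ^ 2 • j).inverse f) = f := by
      rw [← he, ContinuousLinearMap.inverse_equiv]; simp
    rw [h2] at h1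
    rw [one_mul, div_mul_eq_mul_div, le_div_iff₀ hpos, mul_comm]
    exact h1
  · obtain ⟨e, he⟩ := key κ hκ
    have h1 : DifferentiableAt ℂ (ContinuousLinearMap.inverse : (V →L[ℂ] X) → _)
        (A + κ ^ 2 • j) := by
      rw [← he]
      exact (contDiffAt_map_inverse (n := 1) e).differentiableAt (by simp)
    have h2 : DifferentiableAt ℂ (fun κ : ℂ => A + κ ^ 2 • j) κ := by fun_prop
    exact (h1.comp κ h2).differentiableWithinAt

end Generic

/-- `v` is the complex conjugate of `u`. -/
structure IsConj (u v : H10 L) : Prop where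
  wderiv : wderiv L v = star (wderiv L u)
  fn : fn L v = star (fn L u)
  dirac : ∀ x, dirac L x v = (starRingEnd ℂ) (dirac L x u)
  norm : ‖v‖ = ‖u‖

theorem exists_isConj (hL : 0 < L) (u : H10 L) : ∃ v, IsConj u v := by
  obtain ⟨v, h1, h2, h3, h4⟩ := exists_conj hL u
  exact ⟨v, h1, h3, h2, h4⟩

theorem IsConj.symm {u v : H10 L} (h : IsConj u v) : IsConj v u :=
  ⟨by rw [h.wderiv, star_star], by rw [h.fn, star_star], fun x => by rw [h.dirac, Complex.conj_conj],
    h.norm.symm⟩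

theorem pairing_star (f g : LTwo L) : pairing L f (star g) = inner ℂ g f := by
  rw [pairing_apply, L2.inner_def]
  refine integral_congr_ae ?_
  filter_upwards [Lp.coeFn_star g] with x hx
  rw [hx]
  simp

theorem IsConj.opA {u v : H10 L} (h : IsConj u v) : PointHeat.opA L u v = (‖PointHeat.wderiv L u‖ : ℂ) ^ 2 := by
  have : PointHeat.opA L u v = pairing L (PointHeat.wderiv L u) (PointHeat.wderiv L v) := rfl
  rw [this, h.wderiv, pairing_star, inner_self_eq_norm_sq_to_K]
  rfl

theorem IsConj.emb {u v : H10 L} (h : IsConj u v) : PointHeat.emb L u v = (‖PointHeat.fn L u‖ : ℂ) ^ 2 := by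
  have : PointHeat.emb L u v = pairing L (PointHeat.fn L u) (PointHeat.fn L v) := rfl
  rw [this, h.fn, pairing_star, inner_self_eq_norm_sq_to_K]
  rfl

theorem fn_injective (L : ℝ) : Function.Injective (fn L) := by
  intro u v h
  refine emb_injective L ?_
  ext w
  rw [emb_apply, emb_apply, h]

theorem denseRange_emb (hL : 0 < L) : DenseRange (emb L) := by
  have := dense_of_annihilator (S := LinearMap.range (emb L).toLinearMap) fun z hz => by
    obtain ⟨v, hv⟩ := exists_isConj hL z
    have h1 := hz (emb L v) ⟨v, rfl⟩
    rw [hv.symm.emb] at h1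
    have h2 : ‖fn L v‖ = 0 := by exact_mod_cast pow_eq_zero_iff two_ne_zero |>.1 h1
    have h3 : fn L z = 0 := by
      rw [hv.symm.fn, norm_eq_zero.1 h2]
      refine Lp.ext ?_
      filter_upwards [Lp.coeFn_star (0 : LTwo L), Lp.coeFn_zero ℂ 2 (volume.restrict (Ioo (-L) L))]
        with x k1 k2
      rw [k1, Pi.star_apply, k2]; simp
    exact fn_injective L (h3.trans (map_zero _).symm)
  exact this

/-- The operator `A_{L,β} + κ²`. -/
noncomputable def shifted (L x₀ β : ℝ) (κ : ℂ) : H10 L →L[ℂ] Hm1 L := opAβ L x₀ β + κ ^ 2 • emb L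

theorem shifted_apply (L x₀ β : ℝ) (κ : ℂ) (u : H10 L) :
    shifted L x₀ β κ u = opAβ L x₀ β u + κ ^ 2 • emb L u := rfl

theorem norm_dirac_mul_le {x y : ℝ} (hx : x ∈ Ioo (-L) L) (hy : y ∈ Ioo (-L) L) (u : H10 L) :
    ‖dirac L x u‖ * ‖dirac L y u‖ ≤ 2 * (‖fn L u‖ * ‖wderiv L u‖) := by
  have h1 := norm_dirac_sq_le hx u
  have h2 := norm_dirac_sq_le hy u
  nlinarith [sq_nonneg (‖dirac L x u‖ - ‖dirac L y u‖)]

variable {x₀ : ℝ}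

/-- After multiplication by the conjugate of κ, the two main terms have real part Re κ (‖u'‖² +
|κ|²‖u‖²). The Dirac term is at most |β| |κ| 2‖u‖‖u'‖ ≤ |β| (‖u'‖² + |κ|²‖u‖²), the same quantity;
this rotation is what produces a parabolic region. -/
theorem shifted_coercive (hx : x₀ ∈ Ioo (-L) L) (β : ℝ) {κ : ℂ} (hκ : 1 ≤ ‖κ‖)
    (hκβ : |β| ≤ κ.re) {u v : H10 L} (h : IsConj u v) :
    (κ.re - |β|) * ‖u‖ ^ 2 ≤ ((starRingEnd ℂ) κ * shifted L x₀ β κ u v).re := by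
  have h0 : (0 : ℝ) ∈ Ioo (-L) L := ⟨by linarith [hx.1, hx.2], by linarith [hx.1, hx.2]⟩
  have e : (starRingEnd ℂ) κ * shifted L x₀ β κ u v = (starRingEnd ℂ) κ * (‖wderiv L u‖ : ℂ) ^ 2 +
      κ * (((starRingEnd ℂ) κ * κ) * (‖fn L u‖ : ℂ) ^ 2) +
      (starRingEnd ℂ) κ * (β * (dirac L x₀ u * (starRingEnd ℂ) (dirac L 0 u))) := by
    rw [shifted_apply, add_apply, smul_apply, opAβ_apply, h.opA, h.emb, h.dirac, smul_eq_mul]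
    ring
  have n1 : -(‖κ‖ * (|β| * (‖dirac L x₀ u‖ * ‖dirac L 0 u‖))) ≤
      ((starRingEnd ℂ) κ * (β * (dirac L x₀ u * (starRingEnd ℂ) (dirac L 0 u)))).re := by
    have := (abs_le.1 (Complex.abs_re_le_norm
      ((starRingEnd ℂ) κ * (β * (dirac L x₀ u * (starRingEnd ℂ) (dirac L 0 u)))))).1
    simpa using this
  have n2 := norm_dirac_mul_le hx h0 u
  have n3 : ‖κ‖ * (2 * (‖fn L u‖ * ‖wderiv L u‖)) ≤ ‖wderiv L u‖ ^ 2 + ‖κ‖ ^ 2 * ‖fn L u‖ ^ 2 := by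
    nlinarith [sq_nonneg (‖wderiv L u‖ - ‖κ‖ * ‖fn L u‖)]
  have n4 : ‖κ‖ * (|β| * (‖dirac L x₀ u‖ * ‖dirac L 0 u‖)) ≤
      |β| * (‖wderiv L u‖ ^ 2 + ‖κ‖ ^ 2 * ‖fn L u‖ ^ 2) := by
    calc _ ≤ ‖κ‖ * (|β| * (2 * (‖fn L u‖ * ‖wderiv L u‖))) := by gcongr
      _ = |β| * (‖κ‖ * (2 * (‖fn L u‖ * ‖wderiv L u‖))) := by ring
      _ ≤ _ := by gcongr
  have r1 : ((starRingEnd ℂ) κ * (‖wderiv L u‖ : ℂ) ^ 2).re = κ.re * ‖wderiv L u‖ ^ 2 := by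
    rw [← Complex.ofReal_pow, Complex.re_mul_ofReal, Complex.conj_re]
  have r2 : (κ * (((starRingEnd ℂ) κ * κ) * (‖fn L u‖ : ℂ) ^ 2)).re =
      κ.re * (‖κ‖ ^ 2 * ‖fn L u‖ ^ 2) := by
    rw [mul_comm ((starRingEnd ℂ) κ), Complex.mul_conj, ← Complex.ofReal_pow, ← Complex.ofReal_mul,
      Complex.re_mul_ofReal, Complex.normSq_eq_norm_sq]
  rw [e, Complex.add_re, Complex.add_re, r1, r2, norm_sq_H10]
  have n5 : ‖fn L u‖ ^ 2 ≤ ‖κ‖ ^ 2 * ‖fn L u‖ ^ 2 :=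
    le_mul_of_one_le_left (by positivity) (one_le_pow₀ hκ)
  nlinarith [mul_nonneg (sub_nonneg.2 hκβ) (sub_nonneg.2 n5)]

theorem norm_le_shifted (hL : 0 < L) (hx : x₀ ∈ Ioo (-L) L) (β : ℝ) {κ : ℂ} (hκ : 1 ≤ ‖κ‖)
    (hκβ : |β| ≤ κ.re) (u : H10 L) : (κ.re - |β|) * ‖u‖ ≤ ‖κ‖ * ‖shifted L x₀ β κ u‖ := by
  obtain ⟨v, hv⟩ := exists_isConj hL u
  have h1 := shifted_coercive hx β hκ hκβ hv
  have h2 := (h1.trans (Complex.re_le_norm _))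
  rw [norm_mul, RCLike.norm_conj] at h2
  have h3 := (shifted L x₀ β κ u).le_opNorm v
  rw [hv.norm] at h3
  rcases (norm_nonneg u).eq_or_lt with h0 | h0
  · rw [← h0, mul_zero]; positivity
  · rw [← mul_le_mul_iff_left₀ h0]
    calc _ = (κ.re - |β|) * ‖u‖ ^ 2 := by ring
      _ ≤ _ := h2
      _ ≤ ‖κ‖ * (‖shifted L x₀ β κ u‖ * ‖u‖) := by gcongr
      _ = _ := by ring

/-- If z annihilates the range, coercivity tested at the conjugate of z forces z = 0, so no separate
estimate for the adjoint is needed. -/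
theorem denseRange_shifted (hL : 0 < L) (hx : x₀ ∈ Ioo (-L) L) (β : ℝ) {κ : ℂ} (hκ : 1 ≤ ‖κ‖)
    (hκβ : |β| < κ.re) : DenseRange (shifted L x₀ β κ) := by
  have := dense_of_annihilator (S := LinearMap.range (shifted L x₀ β κ).toLinearMap) fun z hz => by
    obtain ⟨v, hv⟩ := exists_isConj hL z
    have h1 := hz (shifted L x₀ β κ v) ⟨v, rfl⟩
    have h2 := shifted_coercive hx β hκ hκβ.le hv.symm
    rw [h1, mul_zero, Complex.zero_re, hv.norm] at h2
    have h3 : ‖z‖ ^ 2 ≤ 0 := nonpos_of_mul_nonpos_right h2 (sub_pos.2 hκβ)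
    exact norm_eq_zero.1 (pow_eq_zero_iff two_ne_zero |>.1 (le_antisymm h3 (by positivity)))
  exact this

/-- The resolvent `(A_{L,β} + κ²)⁻¹ : H⁻¹ → H¹₀`. -/
noncomputable def res (L x₀ β : ℝ) (κ : ℂ) : Hm1 L →L[ℂ] H10 L := (shifted L x₀ β κ).inverse

theorem parabolicResolvent (hL : 0 < L) (hx : x₀ ∈ Ioo (-L) L) (β : ℝ) :
    ParabolicResolvent (V := H10 L) (X := Hm1 L) (emb L) (opAβ L x₀ β) (res L x₀ β) (|β| + 1) 1 := by
  -- Coercivity only needs Re κ > |β|; the extra 1 in b secures |κ| ≥ 1.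
  have hk : ∀ κ : ℂ, |β| + 1 < κ.re → 1 ≤ ‖κ‖ ∧ |β| < κ.re := fun κ hκ => by
    have := Complex.re_le_norm κ
    have := abs_nonneg β
    exact ⟨by linarith, by linarith⟩
  refine ParabolicResolvent.of_bounded_below (V := H10 L) (X := Hm1 L) (by simp) (emb_injective L)
    (denseRange_emb hL) (fun κ hκ u => ?_)
    fun κ hκ => denseRange_shifted hL hx β (hk κ hκ).1 (hk κ hκ).2
  refine le_trans ?_ (norm_le_shifted hL hx β (hk κ hκ).1 (hk κ hκ).2.le u)
  gcongr
  linarith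

/-- The semigroup generated by `-A_{L,β}`. -/
noncomputable def heat (L x₀ β : ℝ) : ℝ≥0 → Hm1 L →L[ℂ] Hm1 L :=
  ParabolicResolvent.semigroup (V := H10 L) (X := Hm1 L) (emb L) (res L x₀ β) (|β| + 1)

theorem isAnalyticSemigroup_heat (hL : 0 < L) (hx : x₀ ∈ Ioo (-L) L) (β : ℝ) :
    IsAnalyticSemigroup (X := Hm1 L) (heat L x₀ β) := (parabolicResolvent hL hx β).isAnalyticSemigroup

theorem mem_graph_neg_unbddA (L x₀ β : ℝ) (f g : Hm1 L) :
    (f, g) ∈ (-unbddA L x₀ β).graph ↔ ∃ u : H10 L, f = emb L u ∧ g = -opAβ L x₀ β u := by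
  have key := mem_graph_unbddA L x₀ β f (-g)
  rw [LinearPMap.mem_graph_iff] at key ⊢
  constructor
  · rintro ⟨y, h1, h2⟩
    obtain ⟨u, h3, h4⟩ := key.1 ⟨y, h1, neg_eq_iff_eq_neg.1 h2⟩
    exact ⟨u, h3, by rw [← h4, neg_neg]⟩
  · rintro ⟨u, h1, h2⟩
    obtain ⟨y, h3, h4⟩ := key.2 ⟨u, h1, by rw [h2, neg_neg]⟩
    exact ⟨y, h3, by change _ = g; rw [LinearPMap.neg_apply, h4, neg_neg]⟩

theorem isGenerator_heat (hL : 0 < L) (hx : x₀ ∈ Ioo (-L) L) (β : ℝ) :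
    IsGenerator (X := Hm1 L) (-unbddA L x₀ β) (heat L x₀ β) :=
  (parabolicResolvent hL hx β).isGenerator _ (mem_graph_neg_unbddA L x₀ β)

end

/-! ### Time derivatives of orbits with values in the domain -/

section
section Orbit

variable {V X : Type*} [NormedAddCommGroup V] [NormedSpace ℂ V]
  [NormedAddCommGroup X] [NormedSpace ℂ X] {j A : V →L[ℂ] X} {ρ : ℂ → X →L[ℂ] V} {b C : ℝ}

variable (ρ b) in
/-- The `n`-th derivative of the semigroup, as a map into the domain. -/
noncomputable def orbit (n : ℕ) (z : ℂ) : X →L[ℂ] V :=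
  lineInt (fun κ => (κ ^ 2) ^ n • κ • ρ κ) (b + 1) z

namespace ParabolicResolvent

theorem expGrowth_orbit (h : ParabolicResolvent j A ρ b C) (n : ℕ) :
    ExpGrowth b fun κ => (κ ^ 2) ^ n • κ • ρ κ := by
  simpa only [← pow_mul] using h.expGrowth_smul.smul_pow (2 * n)

theorem hasDerivAt_orbit (h : ParabolicResolvent j A ρ b C) (n : ℕ) {z : ℂ} (hz : 0 < z.re) :
    HasDerivAt (orbit ρ b n) (orbit ρ b (n + 1) z) z := by
  refine (hasDerivAt_lineInt (h.expGrowth_orbit n) (lt_add_one b) hz).congr_deriv ?_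
  unfold orbit
  simp only [pow_succ' _ n, mul_smul]

variable [CompleteSpace V] [CompleteSpace X]

theorem orbit_zero (z : ℂ) : orbit ρ b 0 z = dunfordV ρ b z := by
  simp [orbit, dunfordV]

/-- The evolution equation for every derivative: differentiate the previous identity and use
uniqueness of derivatives. -/
theorem j_orbit_succ (h : ParabolicResolvent j A ρ b C) (n : ℕ) {z : ℂ} (hz : 0 < z.re) :
    j.comp (orbit ρ b (n + 1) z) = -A.comp (orbit ρ b n z) := by
  have hopen : IsOpen {w : ℂ | 0 < w.re} := isOpen_lt continuous_const Complex.continuous_re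
  have hcomp : ∀ (B : V →L[ℂ] X) (n : ℕ) {z : ℂ}, 0 < z.re →
      HasDerivAt (fun z => B.comp (orbit ρ b n z)) (B.comp (orbit ρ b (n + 1) z)) z := by
    intro B n z hz
    exact (ContinuousLinearMap.compL ℂ X V X B).hasFDerivAt.comp_hasDerivAt z (h.hasDerivAt_orbit n hz)
  induction n generalizing z with
  | zero =>
    have h1 := hcomp j 0 hz
    have h2 : HasDerivAt (fun z => j.comp (orbit ρ b 0 z)) (-A.comp (orbit ρ b 0 z)) z := by
      rw [orbit_zero]
      refine (h.hasDerivAt_dunford hz).congr_of_eventuallyEq ?_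
      filter_upwards [hopen.mem_nhds hz] with w hw
      rw [orbit_zero, h.j_dunfordV hw]
    exact h1.unique h2
  | succ n ih =>
    have h1 := hcomp j (n + 1) hz
    have h2 : HasDerivAt (fun z => j.comp (orbit ρ b (n + 1) z)) (-A.comp (orbit ρ b (n + 1) z)) z := by
      refine (hcomp A n hz).neg.congr_of_eventuallyEq ?_
      filter_upwards [hopen.mem_nhds hz] with w hw using ih hw
    exact h1.unique h2

theorem j_orbit_zero (h : ParabolicResolvent j A ρ b C) {t : ℝ≥0} (ht : 0 < t) (x : X) :
    j (orbit ρ b 0 ((t : ℝ) : ℂ) x) = semigroup j ρ b t x := by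
  have h1 := h.j_dunfordV (z := ((t : ℝ) : ℂ)) (by simpa using ht)
  rw [orbit_zero]
  simp only [semigroup, ht.ne', if_false, ← h1]
  rfl

theorem hasDerivAt_orbit_real (h : ParabolicResolvent j A ρ b C) (n : ℕ) {t : ℝ} (ht : 0 < t) (x : X) :
    HasDerivAt (fun t : ℝ => orbit ρ b n (t : ℂ) x) (orbit ρ b (n + 1) (t : ℂ) x) t := by
  have d1 := (h.hasDerivAt_orbit n (z := (t : ℂ)) (by simpa using ht)).clm_apply
    (hasDerivAt_const (t : ℂ) x)
  have d2 := d1.scomp t (hasDerivAt_id t).ofReal_comp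
  refine d2.congr_deriv ?_
  simp

theorem A_orbit (h : ParabolicResolvent j A ρ b C) (n : ℕ) {t : ℝ} (ht : 0 < t) (x : X) :
    A (orbit ρ b n (t : ℂ) x) = -j (orbit ρ b (n + 1) (t : ℂ) x) := by
  have := congrArg (fun B : X →L[ℂ] X => B x) (h.j_orbit_succ n (z := (t : ℂ)) (by simpa using ht))
  simp only [ContinuousLinearMap.comp_apply, neg_apply] at this
  rw [this, neg_neg]

/-- Commuting resolvent and semigroup turns this orbit into ρ(κ) S(t) x, so it converges in the norm
of V and not merely in X. -/
theorem tendsto_orbit (h : ParabolicResolvent j A ρ b C) {κ : ℂ} (hκ : b < κ.re) (x : X) :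
    Tendsto (fun t : ℝ => orbit ρ b 0 (t : ℂ) (j (ρ κ x))) (𝓝[>] 0) (𝓝 (ρ κ x)) := by
  have h1 : Tendsto (fun t : ℝ => ρ κ (semigroup j ρ b t.toNNReal x)) (𝓝[>] 0) (𝓝 (ρ κ x)) := by
    have hc : Continuous fun t : ℝ => ρ κ (semigroup j ρ b t.toNNReal x) :=
      (ρ κ).continuous.comp ((h.isAnalyticSemigroup.continuous x).comp continuous_real_toNNReal)
    have := hc.tendsto 0
    rw [Real.toNNReal_zero, h.isAnalyticSemigroup.map_zero] at this
    exact this.mono_left nhdsWithin_le_nhds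
  refine h1.congr' ?_
  filter_upwards [self_mem_nhdsWithin] with t ht
  have ht' : (0 : ℝ) < t := ht
  refine h.inj ?_
  have h2 := h.j_orbit_zero (t := t.toNNReal) (by simpa using ht') (j (ρ κ x))
  rw [Real.coe_toNNReal _ ht'.le] at h2
  rw [h2, h.semigroup_comm hκ]

end ParabolicResolvent
end Orbit

variable {L x₀ : ℝ}

/-! ### Invariance of sets under the semigroup -/

/-- In L² the form is bounded below by −β²‖y‖², because 2|β|‖y‖‖y'‖ ≤ ‖y'‖² + β²‖y‖². -/
theorem contraction_of_implicit_step (hL : 0 < L) (hx : x₀ ∈ Ioo (-L) L) {β h : ℝ} (hh : 0 ≤ h)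
    {y f : H10 L} (hy : emb L y + (h : ℂ) • opAβ L x₀ β y = emb L f) :
    (1 - h * β ^ 2) * ‖fn L y‖ ≤ ‖fn L f‖ := by
  have h0 : (0 : ℝ) ∈ Ioo (-L) L := ⟨by linarith, hL⟩
  obtain ⟨v, hv⟩ := exists_isConj hL y
  have h1 := congrArg (fun g : Hm1 L => (g v).re) hy
  simp only [add_apply, smul_apply, opAβ_apply, hv.opA, hv.emb, hv.dirac, smul_eq_mul] at h1
  have h2 : (emb L f v).re ≤ ‖fn L f‖ * ‖fn L y‖ := by
    have : emb L f v = inner ℂ (fn L y) (fn L f) := by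
      rw [← pairing_star, ← hv.fn]; rfl
    rw [this, mul_comm]
    exact (Complex.re_le_norm _).trans (norm_inner_le_norm _ _)
  rw [← h1] at h2
  have h3 : -(|β| * (2 * (‖fn L y‖ * ‖wderiv L y‖))) ≤
      (β * (dirac L x₀ y * (starRingEnd ℂ) (dirac L 0 y))).re := by
    have h4 := (abs_le.1 (Complex.abs_re_le_norm
      (β * (dirac L x₀ y * (starRingEnd ℂ) (dirac L 0 y))))).1
    rw [norm_mul, norm_mul, RCLike.norm_conj, Complex.norm_real, Real.norm_eq_abs] at h4
    have h5 := norm_dirac_mul_le hx h0 y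
    have h6 := mul_le_mul_of_nonneg_left h5 (abs_nonneg β)
    linarith
  rw [Complex.add_re, Complex.re_ofReal_mul, Complex.add_re, ← Complex.ofReal_pow,
    ← Complex.ofReal_pow, Complex.ofReal_re, Complex.ofReal_re] at h2
  have h7 : -(β ^ 2 * ‖fn L y‖ ^ 2) ≤ ‖wderiv L y‖ ^ 2 +
      (β * (dirac L x₀ y * (starRingEnd ℂ) (dirac L 0 y))).re := by
    have := sq_nonneg (‖wderiv L y‖ - |β| * ‖fn L y‖)
    rw [← sq_abs β]
    nlinarith
  have h8 : (1 - h * β ^ 2) * ‖fn L y‖ * ‖fn L y‖ ≤ ‖fn L f‖ * ‖fn L y‖ := by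
    have := mul_le_mul_of_nonneg_left h7 hh
    nlinarith
  rcases (norm_nonneg (fn L y)).eq_or_lt with h9 | h9
  · rw [← h9, mul_zero]; positivity
  · exact le_of_mul_le_mul_right h8 h9

/-- The implicit Euler step. -/
noncomputable def euler (L x₀ β h : ℝ) : H10 L →L[ℂ] H10 L :=
  ((h : ℂ)⁻¹ • res L x₀ β ((√h)⁻¹ : ℝ)).comp (emb L)

theorem euler_eq (hL : 0 < L) (hx : x₀ ∈ Ioo (-L) L) {β h : ℝ} (hh : 0 < h)
    (hβ : |β| + 1 < (√h)⁻¹) (u : H10 L) :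
    emb L (euler L x₀ β h u) + (h : ℂ) • opAβ L x₀ β (euler L x₀ β h u) = emb L u := by
  have h1 := (parabolicResolvent hL hx β).right_inv (((√h)⁻¹ : ℝ) : ℂ) (by simpa using hβ) (emb L u)
  -- The choice κ = h^{-1/2} makes the resolvent of A at κ², divided by h, the inverse of 1 + hA.
  have h2 : (((√h)⁻¹ : ℝ) : ℂ) ^ 2 = (h : ℂ)⁻¹ := by
    rw [← Complex.ofReal_pow, inv_pow, Real.sq_sqrt hh.le, Complex.ofReal_inv]
  rw [h2] at h1
  have h3 : (h : ℂ) ≠ 0 := by exact_mod_cast hh.ne'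
  simp only [euler, ContinuousLinearMap.comp_apply, smul_apply, map_smul]
  rw [smul_smul, mul_inv_cancel₀ h3, one_smul, add_comm, h1]

/-- Let d(t) be the L² distance from the orbit to K. The implicit Euler step maps K into itself, has
Lipschitz constant (1 − hβ²)⁻¹, and differs from the orbit by o(h); hence the right Dini derivative
of d is at most β² d. As d(0+) = 0, Gronwall's inequality gives d = 0. Starting from a resolvent
provides the limit at 0. -/
theorem fn_orbit_mem_closure (hL : 0 < L) (hx : x₀ ∈ Ioo (-L) L) (β : ℝ) (K : Set (H10 L))
    {h₀ : ℝ} (hh₀ : 0 < h₀) (hK : ∀ h, 0 < h → h < h₀ → ∀ k ∈ K, euler L x₀ β h k ∈ K)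
    {κ : ℂ} (hκ : |β| + 1 < κ.re) {g : Hm1 L} (hg : res L x₀ β κ g ∈ K) {t : ℝ} (ht : 0 < t) :
    fn L (orbit (V := H10 L) (X := Hm1 L) (res L x₀ β) (|β| + 1) 0 (t : ℂ)
      (emb L (res L x₀ β κ g))) ∈ closure (fn L '' K) := by
  have P := parabolicResolvent hL hx β
  set f := emb L (res L x₀ β κ g) with hf
  set u : ℕ → ℝ → H10 L := fun n t => orbit (V := H10 L) (X := Hm1 L) (res L x₀ β) (|β| + 1) n (t : ℂ) f
    with hu
  have hu' : ∀ n t, 0 < t → HasDerivAt (u n) (u (n + 1) t) t := fun n t ht =>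
    P.hasDerivAt_orbit_real n ht f
  have hAu : ∀ n t, 0 < t → opAβ L x₀ β (u n t) = -emb L (u (n + 1) t) := fun n t ht =>
    P.A_orbit n ht f
  set S := fn L '' K with hS
  have hSne : S.Nonempty := ⟨_, _, hg, rfl⟩
  set d : ℝ → ℝ := fun t => Metric.infDist (fn L (u 0 t)) S with hd
  have hdc : ∀ t, 0 < t → ContinuousAt d t := fun t ht =>
    (Metric.continuous_infDist_pt S).continuousAt.comp
      ((fn L).continuous.continuousAt.comp (hu' 0 t ht).continuousAt)
  have hd0 : Tendsto d (𝓝[>] 0) (𝓝 0) := by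
    have h1 := P.tendsto_orbit hκ g
    have h2 := (((Metric.continuous_infDist_pt S).comp (fn L).continuous).tendsto
      (res L x₀ β κ g)).comp h1
    have h3 : Metric.infDist (fn L (res L x₀ β κ g)) S = 0 :=
      Metric.infDist_zero_of_mem ⟨_, hg, rfl⟩
    rw [Function.comp_apply, h3] at h2
    exact h2
  -- one implicit Euler step
  have hstep : ∀ t, 0 < t → ∀ r, β ^ 2 * d t < r → ∃ᶠ z in 𝓝[>] t, (z - t)⁻¹ * (d z - d t) < r := by
    intro t ht r hr
    refine Eventually.frequently ?_
    -- Bound for the difference quotient of d: excess of the Lipschitz constant over 1, second-order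
    -- error of the Euler step, and remainder in the derivative of the orbit.
    set F : ℝ → ℝ := fun h => ((1 - h * β ^ 2)⁻¹ * β ^ 2) * d t +
      h * ((1 - h * β ^ 2)⁻¹ * ‖fn L (u 2 t)‖) + ‖h⁻¹ • (u 0 (t + h) - u 0 t) - u 1 t‖ with hF
    have hFlim : Tendsto F (𝓝[>] 0) (𝓝 (β ^ 2 * d t)) := by
      have a1 : ContinuousAt (fun h : ℝ => ((1 - h * β ^ 2)⁻¹ * β ^ 2) * d t +
          h * ((1 - h * β ^ 2)⁻¹ * ‖fn L (u 2 t)‖)) 0 := by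
        have : (1 - (0 : ℝ) * β ^ 2) ≠ 0 := by simp
        fun_prop (disch := assumption)
      have a2 := (hu' 0 t ht).hasDerivWithinAt (s := Ioi t)
      have a3 : Tendsto (fun h : ℝ => ‖h⁻¹ • (u 0 (t + h) - u 0 t) - u 1 t‖) (𝓝[>] 0) (𝓝 0) := by
        have := ((hasDerivAt_iff_tendsto_slope_zero.1 (hu' 0 t ht)).sub_const (u 1 t)).norm
        rw [zero_add, sub_self, norm_zero] at this
        exact this.mono_left (nhdsWithin_mono _ fun x hx => ne_of_gt hx)
      have := (a1.tendsto.mono_left nhdsWithin_le_nhds).add a3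
      have e : ((1 - (0 : ℝ) * β ^ 2)⁻¹ * β ^ 2) * d t +
          0 * ((1 - (0 : ℝ) * β ^ 2)⁻¹ * ‖fn L (u 2 t)‖) + 0 = β ^ 2 * d t := by simp
      rw [e] at this
      exact this
    have e1 : ∀ᶠ h in 𝓝[>] (0 : ℝ), F h < r := hFlim.eventually (gt_mem_nhds hr)
    have e2 : ∀ᶠ h in 𝓝[>] (0 : ℝ), |β| + 1 < (√h)⁻¹ := by
      have : Tendsto (fun h : ℝ => (√h)⁻¹) (𝓝[>] 0) atTop := by
        refine tendsto_inv_nhdsGT_zero.comp (tendsto_nhdsWithin_iff.2 ⟨?_, ?_⟩)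
        · simpa using (Real.continuous_sqrt.tendsto 0).mono_left nhdsWithin_le_nhds
        · filter_upwards [self_mem_nhdsWithin] with h hh using Real.sqrt_pos.2 hh
      exact this.eventually_gt_atTop _
    have e3 : ∀ᶠ h in 𝓝[>] (0 : ℝ), 0 < 1 - h * β ^ 2 := by
      have : Continuous fun h : ℝ => 1 - h * β ^ 2 := by fun_prop
      exact ((this.tendsto 0).eventually (lt_mem_nhds (by simp))).filter_mono nhdsWithin_le_nhds
    have e4 : ∀ᶠ h in 𝓝[>] (0 : ℝ), h < h₀ := (gt_mem_nhds hh₀).filter_mono nhdsWithin_le_nhds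
    have key : ∀ᶠ h in 𝓝[>] (0 : ℝ), h⁻¹ * (d (t + h) - d t) < r := by
      filter_upwards [e1, e2, e3, e4, self_mem_nhdsWithin] with h h1 h2 h3 h4 h5
      have hpos : 0 < h := h5
      refine lt_of_le_of_lt ?_ h1
      set J := euler L x₀ β h with hJ
      have hc : ∀ v, ‖fn L (J v)‖ ≤ (1 - h * β ^ 2)⁻¹ * ‖fn L v‖ := fun v => by
        rw [inv_mul_eq_div, le_div_iff₀ h3, mul_comm]
        exact contraction_of_implicit_step hL hx hpos.le (euler_eq hL hx hpos h2 v)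
      have s1 : Metric.infDist (fn L (J (u 0 t))) S ≤ (1 - h * β ^ 2)⁻¹ * d t := by
        rw [inv_mul_eq_div, le_div_iff₀ h3, mul_comm, hd]
        simp only
        rw [Metric.le_infDist hSne]
        rintro _ ⟨k, hk, rfl⟩
        have a1 := Metric.infDist_le_dist_of_mem (x := fn L (J (u 0 t)))
          (mem_image_of_mem (fn L) (hK h hpos h4 k hk))
        rw [dist_eq_norm, ← map_sub, ← map_sub] at a1
        have a2 := hc (u 0 t - k)
        rw [inv_mul_eq_div, le_div_iff₀ h3, mul_comm] at a2
        rw [dist_eq_norm, ← map_sub]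
        exact (mul_le_mul_of_nonneg_left a1 h3.le).trans a2
      -- Taylor expansion of the Euler step along the orbit: since Au₀ = −u₁ and Au₁ = −u₂, both
      -- sides solve the same implicit equation, whose solution is unique by the contraction
      -- estimate.
      have s2 : J (u 0 t) = u 0 t + (h : ℂ) • u 1 t + (h : ℂ) ^ 2 • J (u 2 t) := by
        have a1 := euler_eq hL hx hpos h2 (u 0 t)
        have a2 := euler_eq hL hx hpos h2 (u 2 t)
        have a3 : (1 - h * β ^ 2) * ‖fn L (J (u 0 t) - (u 0 t + (h : ℂ) • u 1 t +
            (h : ℂ) ^ 2 • J (u 2 t)))‖ ≤ ‖fn L 0‖ := by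
          refine contraction_of_implicit_step hL hx hpos.le ?_
          have b0 : opAβ L x₀ β (u 0 t) = -emb L (u 1 t) := hAu 0 t ht
          have b1 : opAβ L x₀ β (u 1 t) = -emb L (u 2 t) := hAu 1 t ht
          simp only [map_sub, map_add, map_smul, map_zero, b0, b1]
          have a4 : emb L (J (u 0 t)) = emb L (u 0 t) - (h : ℂ) • opAβ L x₀ β (J (u 0 t)) :=
            eq_sub_of_add_eq a1
          have a5 : emb L (J (u 2 t)) = emb L (u 2 t) - (h : ℂ) • opAβ L x₀ β (J (u 2 t)) :=
            eq_sub_of_add_eq a2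
          rw [a4, a5]
          module
        rw [map_zero, norm_zero] at a3
        have a6 := nonpos_of_mul_nonpos_right a3 h3
        have a7 := norm_le_zero_iff.1 a6
        exact sub_eq_zero.1 (fn_injective L (a7.trans (map_zero _).symm))
      have s3 : d (t + h) ≤ Metric.infDist (fn L (J (u 0 t))) S + ‖fn L (u 0 (t + h) - J (u 0 t))‖ := by
        have := Metric.infDist_le_infDist_add_dist (s := S) (x := fn L (u 0 (t + h)))
          (y := fn L (J (u 0 t)))
        rwa [dist_eq_norm, ← map_sub] at this
      have s4 : ‖fn L (u 0 (t + h) - J (u 0 t))‖ ≤ h * ‖h⁻¹ • (u 0 (t + h) - u 0 t) - u 1 t‖ +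
          h ^ 2 * ((1 - h * β ^ 2)⁻¹ * ‖fn L (u 2 t)‖) := by
        have a1 : u 0 (t + h) - J (u 0 t) = (h : ℂ) • (h⁻¹ • (u 0 (t + h) - u 0 t) - u 1 t) -
            (h : ℂ) ^ 2 • J (u 2 t) := by
          have a0 : ∀ v : H10 L, h⁻¹ • v = ((h : ℂ)⁻¹) • v := fun v => by
            rw [← Complex.ofReal_inv]; rfl
          have a2 : (h : ℂ) ≠ 0 := by exact_mod_cast hpos.ne'
          rw [s2, smul_sub, a0, smul_smul, mul_inv_cancel₀ a2, one_smul]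
          abel
        rw [a1, map_sub]
        refine (norm_sub_le _ _).trans (add_le_add ?_ ?_)
        · refine (norm_fn_le _).trans ?_
          rw [norm_smul, Complex.norm_real, Real.norm_of_nonneg hpos.le]
        · rw [map_smul, norm_smul, norm_pow, Complex.norm_real, Real.norm_of_nonneg hpos.le]
          gcongr
          exact hc _
      rw [inv_mul_le_iff₀ hpos, hF]
      simp only
      have s5 : (1 - h * β ^ 2)⁻¹ * d t - d t = h * ((1 - h * β ^ 2)⁻¹ * β ^ 2 * d t) := by
        field_simp
        ring
      linarith
    have hmap : Tendsto (fun z => z - t) (𝓝[>] t) (𝓝[>] 0) := by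
      refine tendsto_nhdsWithin_iff.2 ⟨?_, ?_⟩
      · have : Continuous fun z : ℝ => z - t := by fun_prop
        simpa using (this.tendsto t).mono_left nhdsWithin_le_nhds
      · filter_upwards [self_mem_nhdsWithin] with z hz
        exact (show (0 : ℝ) < z - t from sub_pos.2 hz)
    filter_upwards [hmap.eventually key] with z hz
    simpa using hz
  have hgron : ∀ ε, 0 < ε → ε ≤ t → d t ≤ d ε * Real.exp (β ^ 2 * (t - ε)) := by
    intro ε h1 h2
    have := le_gronwallBound_of_liminf_deriv_right_le (f := d) (f' := fun s => β ^ 2 * d s) (δ := d ε)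
      (K := β ^ 2) (ε := 0) (a := ε) (b := t)
      (fun s hs => (hdc s (h1.trans_le hs.1)).continuousWithinAt)
      (fun s hs => hstep s (h1.trans_le hs.1)) le_rfl (fun s _ => by simp) t ⟨h2, le_rfl⟩
    rwa [gronwallBound_ε0] at this
  have hzero : d t ≤ 0 := by
    have hlim : Tendsto (fun ε => d ε * Real.exp (β ^ 2 * (t - ε))) (𝓝[>] 0)
        (𝓝 (0 * Real.exp (β ^ 2 * (t - 0)))) := by
      refine hd0.mul ?_
      have : Continuous fun ε : ℝ => Real.exp (β ^ 2 * (t - ε)) := by fun_prop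
      exact (this.tendsto 0).mono_left nhdsWithin_le_nhds
    rw [zero_mul] at hlim
    refine ge_of_tendsto hlim ?_
    filter_upwards [Ioc_mem_nhdsGT ht] with ε hε using hgron ε hε.1 hε.2
  rw [Metric.mem_closure_iff_infDist_zero hSne]
  exact le_antisymm hzero Metric.infDist_nonneg

end

section
variable {L x₀ : ℝ}

/-! ### Green functions -/

/-- `s` and `c = s'` solve `y'' = -ν y` with `s(0) = 0`, `s'(0) = 1`. -/
structure SinePair (ν : ℝ) (s c : ℝ → ℝ) : Prop where
  hasDerivAt_sin : ∀ y, HasDerivAt s (c y) y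
  hasDerivAt_cos : ∀ y, HasDerivAt c (-ν * s y) y
  sin_zero : s 0 = 0
  cos_zero : c 0 = 1

/-- The (unnormalised) Green function of `-∂² - ν` with Dirichlet conditions at `±L`. -/
noncomputable def greenFn (s : ℝ → ℝ) (L y x : ℝ) : ℝ := s (L + min x y) * s (L - max x y)

/-- The derivative of `greenFn`. -/
noncomputable def greenDer (s c : ℝ → ℝ) (L y x : ℝ) : ℝ :=
  if x ≤ y then c (L + x) * s (L - y) else -(s (L + y) * c (L - x))

theorem greenFn_comm (s : ℝ → ℝ) (L y x : ℝ) : greenFn s L y x = greenFn s L x y := by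
  rw [greenFn, greenFn, min_comm, max_comm]

theorem opA_comm (u v : H10 L) : opA L u v = opA L v u := by
  rw [opA_apply, opA_apply]; simp only [mul_comm]

theorem emb_comm (u v : H10 L) : emb L u v = emb L v u := by
  rw [emb_apply, emb_apply]; simp only [mul_comm]

namespace SinePair

variable {ν : ℝ} {s c : ℝ → ℝ}

theorem continuous_sin (h : SinePair ν s c) : Continuous s :=
  continuous_iff_continuousAt.2 fun y => (h.hasDerivAt_sin y).continuousAt

theorem continuous_cos (h : SinePair ν s c) : Continuous c :=
  continuous_iff_continuousAt.2 fun y => (h.hasDerivAt_cos y).continuousAt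

theorem hasDerivAt_sin_add (h : SinePair ν s c) (L x : ℝ) :
    HasDerivAt (fun x => s (L + x)) (c (L + x)) x := by
  simpa using (h.hasDerivAt_sin (L + x)).comp_const_add L x

theorem hasDerivAt_cos_add (h : SinePair ν s c) (L x : ℝ) :
    HasDerivAt (fun x => c (L + x)) (-ν * s (L + x)) x := by
  simpa using (h.hasDerivAt_cos (L + x)).comp_const_add L x

theorem hasDerivAt_sin_sub (h : SinePair ν s c) (L x : ℝ) :
    HasDerivAt (fun x => s (L - x)) (-c (L - x)) x := by
  simpa using (h.hasDerivAt_sin (L - x)).comp_const_sub L x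

theorem hasDerivAt_cos_sub (h : SinePair ν s c) (L x : ℝ) :
    HasDerivAt (fun x => c (L - x)) (ν * s (L - x)) x := by
  have := (h.hasDerivAt_cos (L - x)).comp_const_sub L x
  simpa using this

/-- The derivative in y vanishes, so the value is that at y = 0. It is the jump of the derivative of
the Green function across its pole, independent of the pole. -/
theorem wronskian (h : SinePair ν s c) (L y : ℝ) :
    s (L + y) * c (L - y) + c (L + y) * s (L - y) = 2 * s L * c L := by
  have hd : ∀ x, HasDerivAt (fun y => s (L + y) * c (L - y) + c (L + y) * s (L - y)) 0 x := by
    intro x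
    refine (((h.hasDerivAt_sin_add L x).mul (h.hasDerivAt_cos_sub L x)).add
      ((h.hasDerivAt_cos_add L x).mul (h.hasDerivAt_sin_sub L x))).congr_deriv ?_
    ring
  have := is_const_of_deriv_eq_zero (fun x => (hd x).differentiableAt) (fun x => (hd x).deriv) y 0
  simp only [add_zero, sub_zero] at this
  rw [this]
  ring

theorem continuous_greenFn (h : SinePair ν s c) (L y : ℝ) : Continuous (greenFn s L y) := by
  have := h.continuous_sin
  unfold greenFn
  fun_prop

theorem hasDerivAt_greenFn (h : SinePair ν s c) {L y x : ℝ} (hx : x ≠ y) :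
    HasDerivAt (greenFn s L y) (greenDer s c L y x) x := by
  rcases hx.lt_or_gt with hx | hx
  · have e : greenFn s L y =ᶠ[𝓝 x] fun x => s (L + x) * s (L - y) := by
      filter_upwards [gt_mem_nhds hx] with z hz
      rw [greenFn, min_eq_left hz.le, max_eq_right hz.le]
    rw [greenDer, if_pos hx.le]
    exact ((h.hasDerivAt_sin_add L x).mul_const _).congr_of_eventuallyEq e
  · have e : greenFn s L y =ᶠ[𝓝 x] fun x => s (L + y) * s (L - x) := by
      filter_upwards [lt_mem_nhds hx] with z hz
      rw [greenFn, min_eq_right (le_of_lt hz), max_eq_left (le_of_lt hz)]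
    rw [greenDer, if_neg hx.not_ge]
    refine (((h.hasDerivAt_sin_sub L x).const_mul _).congr_of_eventuallyEq e).congr_deriv ?_
    ring

theorem exists_bound_greenDer (h : SinePair ν s c) (L y : ℝ) :
    ∃ C, ∀ x ∈ Icc (-L) L, |greenDer s c L y x| ≤ C := by
  have := h.continuous_cos
  obtain ⟨C, hC⟩ := isCompact_Icc.exists_bound_of_continuousOn (s := Icc (-L) L)
    (f := fun x => c (L + x) * s (L - y)) (by fun_prop)
  obtain ⟨D, hD⟩ := isCompact_Icc.exists_bound_of_continuousOn (s := Icc (-L) L)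
    (f := fun x => -(s (L + y) * c (L - x))) (by fun_prop)
  refine ⟨max C D, fun x hx => ?_⟩
  unfold greenDer
  split_ifs
  · exact (hC x hx).trans (le_max_left _ _)
  · exact (hD x hx).trans (le_max_right _ _)

/-- On either side of y the integrand is a total derivative; the boundary terms at ±L vanish and
those at y add up to the Wronskian. -/
theorem green_identity_test (h : SinePair ν s c) {y : ℝ} (hy : y ∈ Ioo (-L) L) {φ : ℝ → ℂ}
    (h1 : ContDiff ℝ ∞ φ) (hl : φ (-L) = 0) (hr : φ L = 0) :
    (∫ x in Ioo (-L) L, (greenDer s c L y x : ℂ) * deriv φ x) -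
      ν * ∫ x in Ioo (-L) L, (greenFn s L y x : ℂ) * φ x = (2 * s L * c L : ℝ) * φ y := by
  have hs := h.continuous_sin
  have hc := h.continuous_cos
  have hφ := h1.continuous
  have hφ' := h1.continuous_deriv (by simp)
  have hd : ∀ x, HasDerivAt φ (deriv φ x) x := fun x => (h1.differentiable (by simp) x).hasDerivAt
  have hLL : -L ≤ L := by linarith [hy.1, hy.2]
  set F : ℝ → ℂ := fun x => (greenDer s c L y x : ℂ) * deriv φ x - ν * (greenFn s L y x * φ x) with hF
  set F1 : ℝ → ℂ := fun x => (s (L - y) : ℂ) * (c (L + x) * deriv φ x + -ν * s (L + x) * φ x) with hF1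
  set F2 : ℝ → ℂ := fun x => -(s (L + y) : ℂ) * (c (L - x) * deriv φ x + ν * s (L - x) * φ x) with hF2
  have c1 : Continuous F1 := by fun_prop
  have c2 : Continuous F2 := by fun_prop
  have e1 : ∀ x ∈ uIoc (-L) y, F1 x = F x := by
    intro x hx
    rw [uIoc_of_le hy.1.le] at hx
    simp only [hF, hF1, greenDer, greenFn, if_pos hx.2, min_eq_left hx.2, max_eq_right hx.2]
    push_cast
    ring
  have e2 : ∀ x ∈ uIoc y L, F2 x = F x := by
    intro x hx
    rw [uIoc_of_le hy.2.le] at hx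
    simp only [hF, hF2, greenDer, greenFn, if_neg hx.1.not_ge, min_eq_right hx.1.le, max_eq_left hx.1.le]
    push_cast
    ring
  have i1 : IntervalIntegrable F volume (-L) y := (c1.intervalIntegrable _ _).congr e1
  have i2 : IntervalIntegrable F volume y L := (c2.intervalIntegrable _ _).congr e2
  have v1 : ∫ x in (-L)..y, F x = s (L - y) * (c (L + y) * φ y) := by
    rw [← intervalIntegral.integral_congr_ae (ae_of_all _ e1),
      intervalIntegral.integral_eq_sub_of_hasDerivAt
      (f := fun x => (s (L - y) : ℂ) * (c (L + x) * φ x)) (fun x _ => ?_) (c1.intervalIntegrable _ _)]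
    · simp [hl]
    · refine ((((h.hasDerivAt_cos_add L x).ofReal_comp).mul (hd x)).const_mul _).congr_deriv ?_
      simp only [hF1]; push_cast; ring
  have v2 : ∫ x in y..L, F x = s (L + y) * (c (L - y) * φ y) := by
    rw [← intervalIntegral.integral_congr_ae (ae_of_all _ e2),
      intervalIntegral.integral_eq_sub_of_hasDerivAt
      (f := fun x => -(s (L + y) : ℂ) * (c (L - x) * φ x)) (fun x _ => ?_) (c2.intervalIntegrable _ _)]
    · simp [hr]
    · refine ((((h.hasDerivAt_cos_sub L x).ofReal_comp).mul (hd x)).const_mul _).congr_deriv ?_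
      simp only [hF2]; push_cast; ring
  have g1 : IntegrableOn (fun x => (greenFn s L y x : ℂ) * φ x) (Ioo (-L) L) := by
    have := h.continuous_greenFn L y
    have : Continuous fun x => (greenFn s L y x : ℂ) * φ x := by fun_prop
    exact (this.continuousOn.integrableOn_Icc).mono_set Ioo_subset_Icc_self
  have g2 : IntegrableOn F (Ioo (-L) L) :=
    ((intervalIntegrable_iff_integrableOn_Ioo_of_le hLL).1 (i1.trans i2))
  have g3 : IntegrableOn (fun x => (greenDer s c L y x : ℂ) * deriv φ x) (Ioo (-L) L) := by
    refine (g2.add (g1.const_mul (ν : ℂ))).congr (ae_of_all _ fun x => ?_)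
    simp only [hF, Pi.add_apply]
    ring
  rw [← integral_const_mul, ← integral_sub g3 (g1.const_mul _), ← integral_Ioc_eq_integral_Ioo,
    ← intervalIntegral.integral_of_le hLL]
  change ∫ x in (-L)..L, F x = _
  rw [← intervalIntegral.integral_add_adjacent_intervals i1 i2, v1, v2, ← h.wronskian L y]
  push_cast
  ring

/-- Leaving the Green function unnormalised keeps the identity valid when the Wronskian 2s(L)c(L)
vanishes, as it does at the first eigenvalue for β = 0. -/
theorem exists_green (h : SinePair ν s c) (hL : 0 < L) {y : ℝ} (hy : y ∈ Ioo (-L) L) :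
    ∃ G : H10 L, (∀ x ∈ Ioo (-L) L, dirac L x G = greenFn s L y x) ∧
      fn L G =ᵐ[volume.restrict (Ioo (-L) L)] (fun x => (greenFn s L y x : ℂ)) ∧
      wderiv L G =ᵐ[volume.restrict (Ioo (-L) L)] (fun x => (greenDer s c L y x : ℂ)) ∧
      ∀ v, opA L G v - ν * emb L G v = (2 * s L * c L : ℝ) * dirac L y v := by
  obtain ⟨C, hC⟩ := h.exists_bound_greenDer L y
  obtain ⟨G, g1, g2, g3⟩ := exists_of_piecewise hL (U := fun x => (greenFn s L y x : ℂ))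
    (U' := fun x => (greenDer s c L y x : ℂ)) (countable_singleton y)
    ((Complex.continuous_ofReal.comp (h.continuous_greenFn L y)).continuousOn)
    (fun x hx => (h.hasDerivAt_greenFn hx.2).ofReal_comp) (C := C)
    (fun x hx => by simpa using hC x (Ioo_subset_Icc_self hx))
    (by simp [greenFn, min_eq_left hy.1.le, h.sin_zero])
    (by simp [greenFn, max_eq_left hy.2.le, h.sin_zero])
  refine ⟨G, g1, g2, g3, fun v => ?_⟩
  refine closure_induction (P := fun v => opA L G v - ν * emb L G v =
    (2 * s L * c L : ℝ) * dirac L y v) (isClosed_eq (by fun_prop) (by fun_prop)) ?_ v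
  intro v φ h1 h2 h3 h4 h5
  rw [dirac_test hy h1 h3 h5, ← h.green_identity_test hy h1
    (image_eq_zero_of_notMem_tsupport fun h => lt_irrefl _ (h3 h).1)
    (image_eq_zero_of_notMem_tsupport fun h => lt_irrefl _ (h3 h).2), opA_apply, emb_apply]
  congr 1
  · refine integral_congr_ae ?_
    filter_upwards [g3, h5] with x k1 k2
    rw [k1, k2]
  · congr 1
    refine integral_congr_ae ?_
    filter_upwards [g2, h4] with x k1 k2
    rw [k1, k2]

end SinePair

theorem sinePair_sinh {κ : ℝ} (hκ : κ ≠ 0) :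
    SinePair (-κ ^ 2) (fun y => Real.sinh (κ * y) / κ) (fun y => Real.cosh (κ * y)) where
  hasDerivAt_sin y := by
    have h1 : HasDerivAt (fun y => κ * y) κ y := by simpa using (hasDerivAt_id y).const_mul κ
    refine (h1.sinh.div_const κ).congr_deriv ?_
    field_simp
  hasDerivAt_cos y := by
    have h1 : HasDerivAt (fun y => κ * y) κ y := by simpa using (hasDerivAt_id y).const_mul κ
    refine h1.cosh.congr_deriv ?_
    field_simp
  sin_zero := by simp
  cos_zero := by simp

/-- The solution of `(A_{L,β} + κ²) u = f` in terms of the Green functions. -/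
theorem green_representation {β ν : ℝ} {s c : ℝ → ℝ} (h : SinePair ν s c) (hL : 0 < L) {a b : ℝ}
    (hb : b ∈ Ioo (-L) L) {u : H10 L} {f : Hm1 L}
    (hu : ∀ v, opA L u v + β * (dirac L a u * dirac L b v) - ν * emb L u v = f v) {y : ℝ}
    (hy : y ∈ Ioo (-L) L) : ∃ G : H10 L, (∀ x ∈ Ioo (-L) L, dirac L x G = greenFn s L y x) ∧
      (2 * s L * c L : ℝ) * dirac L y u = f G - β * dirac L a u * greenFn s L y b := by
  obtain ⟨G, g1, -, -, g4⟩ := h.exists_green hL hy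
  refine ⟨G, g1, ?_⟩
  rw [← hu G, g1 b hb, ← g4 u, opA_comm u G, emb_comm u G]
  ring

end

section
variable {L x₀ : ℝ}

/-! ### Reality and positivity of the semigroup -/

/-- The real numbers, or the nonnegative real numbers if `p` holds. -/
def realCone (p : Prop) : Set ℂ := {z | z.im = 0 ∧ (p → 0 ≤ z.re)}

theorem mem_realCone_true {z : ℂ} : z ∈ realCone True ↔ 0 ≤ z := by
  simp only [realCone, mem_ofPred_eq, forall_const, Complex.nonneg_iff]
  tauto

theorem mem_realCone_of_nonneg {p : Prop} {z : ℂ} (h : 0 ≤ z) : z ∈ realCone p := by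
  rw [Complex.nonneg_iff] at h
  exact ⟨h.2.symm, fun _ => h.1⟩

theorem isClosed_realCone (p : Prop) : IsClosed (realCone p) := by
  have h1 : IsClosed {z : ℂ | z.im = 0} := isClosed_eq Complex.continuous_im continuous_const
  by_cases hp : p
  · simp only [realCone, hp, forall_const]
    exact h1.inter (isClosed_le continuous_const Complex.continuous_re)
  · simpa [realCone, hp] using h1

theorem realCone_add {p : Prop} {z w : ℂ} (hz : z ∈ realCone p) (hw : w ∈ realCone p) :
    z + w ∈ realCone p :=
  ⟨by rw [Complex.add_im, hz.1, hw.1, add_zero], fun hp => add_nonneg (hz.2 hp) (hw.2 hp)⟩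

theorem realCone_smul {p : Prop} {r : ℝ} (hr : p → 0 ≤ r) {z : ℂ} (hz : z ∈ realCone p) :
    (r : ℂ) * z ∈ realCone p :=
  ⟨by rw [Complex.im_ofReal_mul, hz.1, mul_zero], fun hp => by
    rw [Complex.re_ofReal_mul]; exact mul_nonneg (hr hp) (hz.2 hp)⟩

theorem realCone_integral {p : Prop} {F : ℝ → ℂ} {μ : Measure ℝ} (hi : Integrable F μ)
    (hF : ∀ᵐ x ∂μ, F x ∈ realCone p) : ∫ x, F x ∂μ ∈ realCone p := by
  have h1 := integral_im hi
  have h2 := integral_re hi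
  simp only [RCLike.im_to_complex, RCLike.re_to_complex] at h1 h2
  refine ⟨?_, fun hp => ?_⟩
  · rw [← h1]
    refine integral_eq_zero_of_ae ?_
    filter_upwards [hF] with x hx using hx.1
  · rw [← h2]
    refine integral_nonneg_of_ae ?_
    filter_upwards [hF] with x hx using hx.2 hp

theorem pairing_mem_realCone {p : Prop} {u v : H10 L} (hu : ∀ x ∈ Ioo (-L) L, dirac L x u ∈ realCone p)
    (hv : NonnegH10 v) : pairing L (fn L u) (fn L v) ∈ realCone p := by
  rw [pairing_apply]
  refine realCone_integral ?_ ?_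
  · have h1 : MemLp (fun x => fn L u x * fn L v x) 1 (volume.restrict (Ioo (-L) L)) :=
      (Lp.memLp (fn L v)).mul (Lp.memLp (fn L u))
    exact h1.integrable le_rfl
  · filter_upwards [fn_ae_eq_dirac L u, fn_ae_eq_dirac L v, ae_restrict_mem measurableSet_Ioo]
      with x h1 h2 h3
    have h4 := Complex.nonneg_iff.1 (hv x h3)
    have h5 : dirac L x v = ((dirac L x v).re : ℂ) := Complex.ext rfl (by simp [← h4.2])
    rw [h1, h2, h5, mul_comm]
    exact realCone_smul (fun _ => h4.1) (hu x h3)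

/-- With W = 2s(L)c(L) one has W u(y) = f(G_y) − β u(x₀) G_y(0) and G_y ≥ 0. At y = x₀ this can be
solved for u(x₀), with a positive factor; inserting the result, the second term has the right sign
when β ≤ 0. -/
theorem res_mem_realCone (hx₀ : 0 < x₀) (hL : x₀ < L) {p : Prop} {β : ℝ} (hβ : p → β ≤ 0) {κ : ℝ}
    (hκ : |β| + 1 < κ) {f : Hm1 L} (hf : ∀ v, NonnegH10 v → f v ∈ realCone p) :
    ∀ x ∈ Ioo (-L) L, dirac L x (res L x₀ β κ f) ∈ realCone p := by
  have hL0 : 0 < L := hx₀.trans hL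
  have hx : x₀ ∈ Ioo (-L) L := ⟨by linarith, hL⟩
  have h0 : (0 : ℝ) ∈ Ioo (-L) L := ⟨by linarith, hL0⟩
  have hβ0 := abs_nonneg β
  have hκ0 : 0 < κ := by linarith
  set u := res L x₀ β κ f with hu
  have h1 : ∀ v, opA L u v + β * (dirac L x₀ u * dirac L 0 v) - (-κ ^ 2 : ℝ) * emb L u v = f v := by
    intro v
    have := congrArg (fun g : Hm1 L => g v)
      ((parabolicResolvent hL0 hx β).right_inv κ (by simpa using hκ) f)
    simp only [add_apply, smul_apply, opAβ_apply, smul_eq_mul] at this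
    rw [← this, hu]
    push_cast
    ring
  have hs := sinePair_sinh hκ0.ne'
  set s : ℝ → ℝ := fun y => Real.sinh (κ * y) / κ with hsdef
  set c : ℝ → ℝ := fun y => Real.cosh (κ * y) with hcdef
  have hs0 : ∀ y, 0 ≤ y → 0 ≤ s y := fun y hy =>
    div_nonneg (Real.sinh_nonneg_iff.2 (by positivity)) hκ0.le
  have hspos : 0 < s L := div_pos (Real.sinh_pos_iff.2 (by positivity)) hκ0
  have hcpos : 0 < c L := Real.cosh_pos _
  have hG : ∀ y ∈ Ioo (-L) L, ∀ x ∈ Ioo (-L) L, 0 ≤ greenFn s L y x := fun y hy x hx =>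
    mul_nonneg (hs0 _ (by linarith [lt_min hx.1 hy.1])) (hs0 _ (by linarith [max_lt hx.2 hy.2]))
  have key := fun y (hy : y ∈ Ioo (-L) L) => green_representation hs hL0 h0 h1 hy
  have hGn : ∀ y ∈ Ioo (-L) L, ∀ G : H10 L, (∀ x ∈ Ioo (-L) L, dirac L x G = greenFn s L y x) →
      NonnegH10 G := fun y hy G hG' x hx => by
    rw [hG' x hx]; exact_mod_cast hG y hy x hx
  have hx0 : dirac L x₀ u ∈ realCone p := by
    obtain ⟨G, g1, g2⟩ := key x₀ hx
    -- Holds for either sign of β, since κ > |β| and κ s(L − x₀) = sinh(κ(L − x₀)) ≤ cosh(κL).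
    have hpos : 0 < 2 * s L * c L + β * greenFn s L x₀ 0 := by
      rw [greenFn, min_eq_left hx₀.le, max_eq_right hx₀.le, add_zero]
      have a1 : κ * s (L - x₀) ≤ c L := by
        have b1 : κ * s (L - x₀) = Real.sinh (κ * (L - x₀)) := by
          simp only [hsdef]; field_simp
        rw [b1]
        refine (Real.sinh_le_sinh.2 ?_).trans (Real.sinh_lt_cosh _).le
        exact mul_le_mul_of_nonneg_left (by linarith) hκ0.le
      have a2 : -(κ * s (L - x₀)) ≤ β * s (L - x₀) := by
        have := hs0 (L - x₀) (by linarith)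
        have := (abs_le.1 (show |β| ≤ κ by linarith)).1
        nlinarith
      have : 0 < s L * (2 * c L + β * s (L - x₀)) := mul_pos hspos (by linarith)
      linarith
    have e : dirac L x₀ u = ((2 * s L * c L + β * greenFn s L x₀ 0)⁻¹ : ℝ) * f G := by
      rw [eq_sub_iff_add_eq] at g2
      rw [← g2]
      have : ((2 * s L * c L + β * greenFn s L x₀ 0 : ℝ) : ℂ) ≠ 0 := by exact_mod_cast hpos.ne'
      rw [Complex.ofReal_inv, eq_inv_mul_iff_mul_eq₀ this]
      push_cast
      ring
    rw [e]
    exact realCone_smul (fun _ => inv_nonneg.2 hpos.le) (hf G (hGn _ hx G g1))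
  intro y hy
  obtain ⟨G, g1, g2⟩ := key y hy
  have hW : 0 < 2 * s L * c L := by positivity
  have e : dirac L y u = ((2 * s L * c L)⁻¹ : ℝ) * (f G + (-β * greenFn s L y 0 : ℝ) * dirac L x₀ u) := by
    have : ((2 * s L * c L : ℝ) : ℂ) ≠ 0 := by exact_mod_cast hW.ne'
    rw [Complex.ofReal_inv, eq_inv_mul_iff_mul_eq₀ this, g2]
    push_cast
    ring
  rw [e]
  refine realCone_smul (fun _ => inv_nonneg.2 hW.le) (realCone_add (hf G (hGn _ hy G g1)) ?_)
  exact realCone_smul (fun hp => mul_nonneg (by linarith [hβ hp]) (hG y hy 0 h0)) hx0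

/-- Uniform boundedness plus convergence on the range of j. It lets rough functionals be
approximated by elements coming from V, positivity included. -/
theorem ParabolicResolvent.tendsto_smul_res {V X : Type*} [NormedAddCommGroup V] [NormedSpace ℂ V]
    [NormedAddCommGroup X] [NormedSpace ℂ X] [CompleteSpace X] {j A : V →L[ℂ] X}
    {ρ : ℂ → X →L[ℂ] V} {b C : ℝ} (h : ParabolicResolvent j A ρ b C) (x : X) :
    Tendsto (fun κ : ℝ => (κ : ℂ) ^ 2 • j (ρ κ x)) atTop (𝓝 x) := by
  have hb := h.one_le
  have hC : 0 ≤ C := by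
    have := h.norm_le ((b + 1 : ℝ) : ℂ) (by simp)
    rw [Complex.ofReal_re, add_sub_cancel_left, div_one] at this
    by_contra hc
    have h1 : 0 < ‖((b + 1 : ℝ) : ℂ)‖ := by
      rw [Complex.norm_real, Real.norm_eq_abs]; positivity
    have := norm_nonneg (ρ ((b + 1 : ℝ) : ℂ))
    nlinarith
  have hρ : ∀ κ : ℝ, 2 * b < κ → ‖ρ κ‖ ≤ 2 * C := fun κ hκ => by
    have h1 := h.norm_le κ (by rw [Complex.ofReal_re]; linarith)
    rw [Complex.ofReal_re, Complex.norm_real, Real.norm_of_nonneg (by linarith)] at h1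
    refine h1.trans ?_
    rw [div_le_iff₀ (by linarith)]
    nlinarith
  have hnorm : ∀ κ : ℝ, 2 * b < κ → ∀ y, ‖(κ : ℂ) ^ 2 • j (ρ κ y)‖ ≤ (1 + ‖A‖ * (2 * C)) * ‖y‖ := by
    intro κ hκ y
    have h1 := h.right_inv κ (by rw [Complex.ofReal_re]; linarith) y
    rw [eq_sub_of_add_eq' h1, add_mul, one_mul]
    refine (norm_sub_le _ _).trans (add_le_add le_rfl ?_)
    rw [mul_assoc]
    refine (A.le_opNorm _).trans (mul_le_mul_of_nonneg_left ?_ (norm_nonneg _))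
    exact (ρ κ).le_of_opNorm_le (hρ κ hκ) y
  have hdense : ∀ v, Tendsto (fun κ : ℝ => (κ : ℂ) ^ 2 • j (ρ κ (j v))) atTop (𝓝 (j v)) := by
    intro v
    rw [tendsto_iff_norm_sub_tendsto_zero]
    have hb2 : Tendsto (fun κ : ℝ => (1 + ‖A‖ * C) * ‖A v‖ * ((κ - b)⁻¹ * 1)) atTop (𝓝 0) := by
      have := ((tendsto_inv_atTop_zero.comp (tendsto_atTop_add_const_right atTop (-b)
        tendsto_id)).mul_const 1).const_mul ((1 + ‖A‖ * C) * ‖A v‖)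
      simpa [sub_eq_add_neg] using this
    refine squeeze_zero' (Eventually.of_forall fun _ => norm_nonneg _) ?_ hb2
    filter_upwards [eventually_gt_atTop (b + 1)] with κ hκ
    have hκ' : b < (κ : ℂ).re := by rw [Complex.ofReal_re]; linarith
    have h1 := h.left_inv κ hκ' v
    rw [map_add, map_smul] at h1
    have h2 : (κ : ℂ) ^ 2 • j (ρ κ (j v)) - j v = -j (ρ κ (A v)) := by
      rw [← map_smul, ← map_sub, ← map_neg]
      congr 1
      rw [eq_sub_of_add_eq' h1]; abel
    have h3 : ‖κ • j (ρ κ (A v))‖ ≤ (1 + ‖A‖ * C) / (κ - b) * ‖A v‖ := by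
      have := ((κ : ℂ) • j.comp (ρ κ)).le_of_opNorm_le (h.norm_le_re hκ') (A v)
      simpa using this
    rw [h2, norm_neg]
    rw [norm_smul, Real.norm_of_nonneg (by linarith)] at h3
    have h4 : ‖j (ρ κ (A v))‖ ≤ κ * ‖j (ρ κ (A v))‖ := by
      have := norm_nonneg (j (ρ κ (A v)))
      nlinarith
    refine (h4.trans h3).trans (le_of_eq ?_)
    rw [div_eq_mul_inv]; ring
  rw [Metric.tendsto_atTop]
  intro ε hε
  set D := 1 + ‖A‖ * (2 * C) with hD
  have hD0 : 0 < D := by positivity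
  obtain ⟨v, hv⟩ := Metric.denseRange_iff.1 h.dense x (ε / (2 * (D + 1))) (by positivity)
  obtain ⟨N, hN⟩ := Metric.tendsto_atTop.1 (hdense v) (ε / 2) (by positivity)
  refine ⟨max N (2 * b + 1), fun κ hκ => ?_⟩
  have h1 := hN κ ((le_max_left _ _).trans hκ)
  have h2 := hnorm κ (by linarith [(le_max_right _ _).trans hκ]) (x - j v)
  rw [map_sub, map_sub, smul_sub] at h2
  rw [dist_eq_norm] at hv h1 ⊢
  have h3 : (κ : ℂ) ^ 2 • j (ρ κ x) - x = ((κ : ℂ) ^ 2 • j (ρ κ x) - (κ : ℂ) ^ 2 • j (ρ κ (j v))) +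
      ((κ : ℂ) ^ 2 • j (ρ κ (j v)) - j v) - (x - j v) := by abel
  rw [h3]
  refine (norm_sub_le _ _).trans_lt ((add_le_add_left (norm_add_le _ _) _).trans_lt ?_)
  have h4 : (D + 1) * ‖x - j v‖ < ε / 2 := by
    rw [lt_div_iff₀ (by positivity)] at hv
    linarith
  linarith

/-- The cone of u in H¹₀ with values in `realCone p` is invariant under small Euler steps, hence
under the flow; f is approximated by κ²(A + κ²)⁻¹f. The parameter p handles two facts at once:
positivity for β ≤ 0 (p true) and reality for every β (p false). -/
theorem heat_mem_realCone (hx₀ : 0 < x₀) (hL : x₀ < L) {p : Prop} {β : ℝ} (hβ : p → β ≤ 0)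
    {f : Hm1 L} (hf : ∀ v, NonnegH10 v → f v ∈ realCone p) (t : ℝ≥0) :
    ∀ v, NonnegH10 v → heat L x₀ β t f v ∈ realCone p := by
  have hL0 : 0 < L := hx₀.trans hL
  have hx : x₀ ∈ Ioo (-L) L := ⟨by linarith, hL⟩
  have P := parabolicResolvent hL0 hx β
  have hβ0 := abs_nonneg β
  rcases eq_or_ne t 0 with rfl | ht
  · rw [(isAnalyticSemigroup_heat hL0 hx β).map_zero]; exact hf
  have ht : 0 < t := pos_iff_ne_zero.2 ht
  set K : Set (H10 L) := {u | ∀ x ∈ Ioo (-L) L, dirac L x u ∈ realCone p} with hK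
  have hsmul : ∀ r : ℝ, 0 ≤ r → ∀ u ∈ K, (r : ℂ) • u ∈ K := fun r hr u hu x hx => by
    rw [map_smul, smul_eq_mul]; exact realCone_smul (fun _ => hr) (hu x hx)
  have heuler : ∀ h, 0 < h → h < ((|β| + 1) ^ 2)⁻¹ → ∀ k ∈ K, euler L x₀ β h k ∈ K := by
    intro h h0 h1 k hk
    have h2 : |β| + 1 < (√h)⁻¹ := by
      rw [lt_inv_comm₀ (by positivity) (Real.sqrt_pos.2 h0)]
      refine (Real.sqrt_lt_sqrt h0.le h1).trans_le ?_
      rw [Real.sqrt_inv, Real.sqrt_sq (by positivity)]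
    have h3 := hsmul h⁻¹ (by positivity) _ (res_mem_realCone hx₀ hL hβ h2 (f := emb L k)
      fun v hv => pairing_mem_realCone hk hv)
    rw [Complex.ofReal_inv] at h3
    exact h3
  have happrox : ∀ κ : ℝ, |β| + 1 < κ → ∀ v, NonnegH10 v →
      heat L x₀ β t ((κ : ℂ) ^ 2 • emb L (res L x₀ β κ f)) v ∈ realCone p := by
    intro κ hκ v hv
    have h1 : res L x₀ β κ ((κ : ℂ) ^ 2 • f) ∈ K := by
      rw [map_smul, ← Complex.ofReal_pow]
      exact hsmul _ (by positivity) _ (res_mem_realCone hx₀ hL hβ hκ hf)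
    have h2 := fn_orbit_mem_closure hL0 hx β K (h₀ := ((|β| + 1) ^ 2)⁻¹) (by positivity) heuler
      (κ := κ) (by simpa using hκ) h1 (t := t) (by simpa using ht)
    have h3 := P.j_orbit_zero ht (emb L (res L x₀ β κ ((κ : ℂ) ^ 2 • f)))
    have h4 : closure (fn L '' K) ⊆ {g | pairing L g (fn L v) ∈ realCone p} := by
      refine closure_minimal ?_ ((isClosed_realCone p).preimage (by fun_prop))
      rintro _ ⟨k, hk, rfl⟩
      exact pairing_mem_realCone hk hv
    have h5 := h4 h2
    rw [← map_smul, ← map_smul]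
    have h6 : heat L x₀ β t (emb L (res L x₀ β κ ((κ : ℂ) ^ 2 • f))) =
      emb L (orbit (V := H10 L) (X := Hm1 L) (res L x₀ β) (|β| + 1) 0 ((t : ℝ) : ℂ)
        (emb L (res L x₀ β κ ((κ : ℂ) ^ 2 • f)))) := h3.symm
    rw [h6]
    exact h5
  intro v hv
  have hlim : Tendsto (fun κ : ℝ => heat L x₀ β t ((κ : ℂ) ^ 2 • emb L (res L x₀ β κ f)) v) atTop
      (𝓝 (heat L x₀ β t f v)) := by
    have h1 := P.tendsto_smul_res f
    have h2 : Continuous fun g : Hm1 L => heat L x₀ β t g v := by fun_prop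
    exact (h2.tendsto f).comp h1
  refine (isClosed_realCone p).mem_of_tendsto hlim ?_
  filter_upwards [eventually_gt_atTop (|β| + 1)] with κ hκ using happrox κ hκ v hv

theorem isPositive_heat (hx₀ : 0 < x₀) (hL : x₀ < L) {β : ℝ} (hβ : β ≤ 0) :
    IsPositive (heat L x₀ β) := by
  intro t f hf v hv
  exact mem_realCone_true.1 (heat_mem_realCone hx₀ hL (p := True) (fun _ => hβ)
    (fun v hv => mem_realCone_true.2 (hf v hv)) t v hv)

/-- A nonnegative test function supported near `y` with value `1` at `y`. -/
theorem exists_bump {y r : ℝ} (hr : 0 < r) (hy : Metric.closedBall y r ⊆ Ioo (-L) L) :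
    ∃ (u : H10 L) (φ : ℝ → ℂ), NonnegH10 u ∧ dirac L y u = 1 ∧
      tsupport φ ⊆ Metric.closedBall y r ∧ fn L u =ᵐ[volume.restrict (Ioo (-L) L)] φ ∧
      wderiv L u =ᵐ[volume.restrict (Ioo (-L) L)] deriv φ := by
  let η : ContDiffBump y := ⟨r / 2, r, by positivity, by linarith⟩
  have h1 : ContDiff ℝ ∞ fun x => (η x : ℂ) := Complex.ofRealCLM.contDiff.comp η.contDiff
  have h2 : HasCompactSupport fun x => (η x : ℂ) :=
    η.hasCompactSupport.comp_left (g := fun x : ℝ => (x : ℂ)) (by simp)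
  have h3 : tsupport (fun x => (η x : ℂ)) ⊆ Metric.closedBall y r :=
    (tsupport_comp_subset (g := fun x : ℝ => (x : ℂ)) (by simp) η).trans η.tsupport_eq.le
  obtain ⟨u, u1, u2⟩ := exists_test L h1 h2 (h3.trans hy)
  have hd : ∀ x ∈ Ioo (-L) L, dirac L x u = η x := fun x hx => dirac_test hx h1 (h3.trans hy) u2
  refine ⟨u, _, fun x hx => ?_, ?_, h3, u1, u2⟩
  · rw [hd x hx]; exact_mod_cast η.nonneg
  · rw [hd y (hy (Metric.mem_closedBall_self hr.le))]
    rw [η.one_of_mem_closedBall (Metric.mem_closedBall_self (by positivity))]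
    simp

/-- For disjointly supported bumps u at x₀ and v at 0 the pairing with the flow starts at 0, and its
initial slope is −β u(x₀) v(0) = −β < 0; positivity would make the slope nonnegative. -/
theorem not_isPositive_heat (hx₀ : 0 < x₀) (hL : x₀ < L) {β : ℝ} (hβ : 0 < β) :
    ¬ IsPositive (heat L x₀ β) := by
  intro hT
  have hL0 : 0 < L := hx₀.trans hL
  have hx : x₀ ∈ Ioo (-L) L := ⟨by linarith, hL⟩
  obtain ⟨r, hr, hr1, hr2⟩ : ∃ r, 0 < r ∧ x₀ + r < L ∧ 2 * r < x₀ :=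
    ⟨min (L - x₀) x₀ / 3, by have := lt_min (sub_pos.2 hL) hx₀; positivity,
      by linarith [min_le_left (L - x₀) x₀], by linarith [min_le_right (L - x₀) x₀]⟩
  obtain ⟨u, φ, u1, u2, u3, u4, u5⟩ := exists_bump (L := L) (y := x₀) hr fun x hx => by
    rw [Real.closedBall_eq_Icc] at hx
    exact ⟨by linarith [hx.1], by linarith [hx.2]⟩
  obtain ⟨v, ψ, v1, v2, v3, v4, v5⟩ := exists_bump (L := L) (y := 0) hr fun x hx => by
    rw [Real.closedBall_eq_Icc] at hx
    exact ⟨by linarith [hx.1], by linarith [hx.2]⟩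
  have hdisj : ∀ x, x ∈ tsupport φ → x ∉ tsupport ψ := fun x h1 h2 => by
    have h3 := u3 h1
    have h4 := v3 h2
    rw [Real.closedBall_eq_Icc] at h3 h4
    linarith [h3.1, h4.2]
  have hemb : emb L u v = 0 := by
    rw [emb_apply]
    refine integral_eq_zero_of_ae ?_
    filter_upwards [u4, v4] with x h1 h2
    rw [h1, h2]
    by_cases hm : x ∈ tsupport φ
    · simp [image_eq_zero_of_notMem_tsupport (hdisj x hm)]
    · simp [image_eq_zero_of_notMem_tsupport hm]
  have hopA : opA L u v = 0 := by
    rw [opA_apply]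
    refine integral_eq_zero_of_ae ?_
    filter_upwards [u5, v5] with x h1 h2
    rw [h1, h2]
    by_cases hm : x ∈ tsupport φ
    · have := image_eq_zero_of_notMem_tsupport
        (fun h => hdisj x hm (tsupport_deriv_subset h : x ∈ tsupport ψ))
      simp [this]
    · have := image_eq_zero_of_notMem_tsupport
        (fun h => hm (tsupport_deriv_subset h : x ∈ tsupport φ))
      simp [this]
  have hlim := (parabolicResolvent hL0 hx β).tendsto_slope u
  have hev : Continuous fun g : Hm1 L => (g v).re := by fun_prop
  have h1 := (hev.tendsto _).comp hlim
  have h2 : (0 : ℝ) ≤ ((-opAβ L x₀ β u : Hm1 L) v).re := by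
    refine ge_of_tendsto' h1 fun t => ?_
    have h3 : 0 ≤ (heat L x₀ β t (emb L u) v).re :=
      (Complex.nonneg_iff.1 (hT t (emb L u) (fun w hw => by
        have := pairing_mem_realCone (p := True) (u := u)
          (fun x hx => mem_realCone_true.2 (u1 x hx)) hw
        exact mem_realCone_true.1 this) v v1)).1
    have h4 : ((((t : ℝ) : ℂ)⁻¹ • (heat L x₀ β t (emb L u) - emb L u)) v).re =
        (t : ℝ)⁻¹ * (heat L x₀ β t (emb L u) v).re := by
      rw [smul_apply, sub_apply, hemb, sub_zero, smul_eq_mul, ← Complex.ofReal_inv,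
        Complex.re_ofReal_mul]
    exact le_of_le_of_eq (mul_nonneg (by positivity) h3) h4.symm
  rw [neg_apply, opAβ_apply, hopA, u2, v2] at h2
  simp at h2
  linarith

end

section
/-! ### The principal eigenfunctions and their quotient -/

/-- The data from which the principal eigenfunctions `G_b`, `G_a` of the operator
`-∂² + β δ_a ⊗ δ_b` and of its adjoint are built. -/
structure Principal (L β μ a b : ℝ) (s c : ℝ → ℝ) : Prop where
  pair : SinePair μ s c
  left_mem : a ∈ Ico 0 L
  right_mem : b ∈ Ico 0 L
  pos : ∀ y, 0 < y → y ≤ L + max a b → 0 < s y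
  eig : 2 * s L * c L + β * greenFn s L b a = 0
  small : ∀ x ∈ Icc (min a b) (max a b),
    β * greenFn s L b a ^ 2 * |b - a| ≤ greenFn s L a x * greenFn s L b x

/-- The quotient `G_a / G_b` of Green functions (which is constant near `±L`). -/
noncomputable def weight (s : ℝ → ℝ) (L a b x : ℝ) : ℝ :=
  greenFn s L a (max (min a b) (min (max a b) x)) / greenFn s L b (max (min a b) (min (max a b) x))

/-- The derivative of `weight`. -/
noncomputable def weightDer (s c : ℝ → ℝ) (L a b x : ℝ) : ℝ :=
  (greenDer s c L a x * greenFn s L b x - greenFn s L a x * greenDer s c L b x) /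
    greenFn s L b x ^ 2

theorem SinePair.measurable_greenDer {ν : ℝ} {s c : ℝ → ℝ} (h : SinePair ν s c) (L y : ℝ) :
    Measurable (greenDer s c L y) := by
  have := h.continuous_cos
  unfold greenDer
  refine Measurable.ite measurableSet_Iic ?_ ?_
  · exact Continuous.measurable (by fun_prop)
  · exact Continuous.measurable (by fun_prop)

/-- A solution of `y'' = -ν y`, `y(0) = 0`, `y'(0) = 1` that is positive on `(0, R]` is comparable
to the identity there. -/
theorem SinePair.exists_linear_bounds {ν : ℝ} {s c : ℝ → ℝ} (h : SinePair ν s c) {R : ℝ} (hR : 0 < R)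
    (hpos : ∀ y, 0 < y → y ≤ R → 0 < s y) :
    ∃ k K : ℝ, 0 < k ∧ 0 < K ∧ ∀ y, 0 ≤ y → y ≤ R → k * y ≤ s y ∧ s y ≤ K * y := by
  -- The quotient s(y)/y extends continuously to 0 by s'(0) = 1 and is positive on the compact
  -- interval, so it has positive extrema.
  have hc : ContinuousOn (dslope s 0) (Icc 0 R) := by
    intro y _
    refine ContinuousAt.continuousWithinAt ?_
    rcases eq_or_ne y 0 with rfl | hy
    · exact continuousAt_dslope_same.2 (h.hasDerivAt_sin 0).differentiableAt
    · exact (continuousAt_dslope_of_ne hy).2 h.continuous_sin.continuousAt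
  have hv : ∀ y, y ≠ 0 → dslope s 0 y * y = s y := fun y hy => by
    rw [dslope_of_ne _ hy, slope_def_field, h.sin_zero, sub_zero, sub_zero, div_mul_cancel₀ _ hy]
  have hp : ∀ y ∈ Icc 0 R, 0 < dslope s 0 y := by
    intro y hy
    rcases hy.1.eq_or_lt with h0 | h0
    · rw [← h0, dslope_same, (h.hasDerivAt_sin 0).deriv, h.cos_zero]; exact one_pos
    · have := hpos y h0 hy.2
      rw [← hv y h0.ne'] at this
      exact pos_of_mul_pos_left this h0.le
  obtain ⟨y1, m1, h1⟩ := isCompact_Icc.exists_isMinOn (nonempty_Icc.2 hR.le) hc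
  obtain ⟨y2, m2, h2⟩ := isCompact_Icc.exists_isMaxOn (nonempty_Icc.2 hR.le) hc
  refine ⟨_, _, hp y1 m1, hp y2 m2, fun y hy0 hyR => ?_⟩
  rcases hy0.eq_or_lt with rfl | h0
  · simp [h.sin_zero]
  · rw [← hv y h0.ne']
    exact ⟨mul_le_mul_of_nonneg_right (h1 ⟨hy0, hyR⟩) hy0, mul_le_mul_of_nonneg_right (h2 ⟨hy0, hyR⟩) hy0⟩

namespace Principal

variable {L β μ a b : ℝ} {s c : ℝ → ℝ}

/-- Exchanging the two points is passing to the adjoint operator, with the same μ and s; all that is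
proved for φ thus holds for ψ. -/
theorem symm (P : Principal L β μ a b s c) : Principal L β μ b a s c where
  pair := P.pair
  left_mem := P.right_mem
  right_mem := P.left_mem
  pos := by rw [max_comm]; exact P.pos
  eig := by rw [greenFn_comm]; exact P.eig
  small := by
    rw [min_comm, max_comm, greenFn_comm, abs_sub_comm]
    intro x hx
    rw [mul_comm (greenFn s L b x)]
    exact P.small x hx

theorem L_pos (P : Principal L β μ a b s c) : 0 < L := P.left_mem.1.trans_lt P.left_mem.2

theorem left_mem_Ioo (P : Principal L β μ a b s c) : a ∈ Ioo (-L) L :=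
  ⟨by linarith [P.L_pos, P.left_mem.1], P.left_mem.2⟩

theorem right_mem_Ioo (P : Principal L β μ a b s c) : b ∈ Ioo (-L) L := P.symm.left_mem_Ioo

theorem green_right_pos (P : Principal L β μ a b s c) {x : ℝ} (hx : x ∈ Ioo (-L) L) :
    0 < greenFn s L b x := by
  have h1 := P.right_mem
  have h2 := P.right_mem_Ioo
  refine mul_pos (P.pos _ ?_ ?_) (P.pos _ ?_ ?_)
  · linarith [lt_min hx.1 h2.1]
  · linarith [min_le_right x b, le_max_right a b]
  · linarith [max_lt hx.2 h2.2]
  · linarith [le_max_right x b, le_max_right a b, h1.1]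

theorem green_left_pos (P : Principal L β μ a b s c) {x : ℝ} (hx : x ∈ Ioo (-L) L) :
    0 < greenFn s L a x := P.symm.green_right_pos hx

/-- The Green function is comparable to the distance to the boundary. -/
theorem exists_green_bounds (P : Principal L β μ a b s c) : ∃ k K : ℝ, 0 < k ∧ 0 < K ∧
    ∀ x ∈ Ioo (-L) L, k * (L - |x|) ≤ greenFn s L b x ∧ greenFn s L b x ≤ K * (L - |x|) := by
  have hL := P.L_pos
  have h1 := P.right_mem
  have h2 := P.right_mem_Ioo
  have hab := le_max_right a b
  obtain ⟨k, K, hk, hK, hb⟩ := P.pair.exists_linear_bounds (R := L + max a b) (by linarith [h1.1]) P.pos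
  refine ⟨k ^ 2 * (L - b), K ^ 2 * (2 * L), by have := h1.2; have := sub_pos.2 this; positivity,
    by positivity, fun x hx => ?_⟩
  have hx1 := hx.1
  have hx2 := hx.2
  have p1 : 0 < L + min x b := by linarith [lt_min hx.1 h2.1]
  have p2 : 0 < L - max x b := by linarith [max_lt hx.2 h2.2]
  obtain ⟨b1, b2⟩ := hb (L + min x b) p1.le (by linarith [min_le_right x b])
  obtain ⟨b3, b4⟩ := hb (L - max x b) p2.le (by linarith [le_max_right x b, h1.1])
  have b0 := h1.1
  have bL := h1.2
  have e1 : (L - b) * (L - |x|) ≤ (L + min x b) * (L - max x b) := by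
    rcases le_total x 0 with h | h
    · rw [min_eq_left (h.trans b0), max_eq_right (h.trans b0), abs_of_nonpos h]
      nlinarith
    · rw [abs_of_nonneg h]
      rcases le_total x b with h' | h'
      · rw [min_eq_left h', max_eq_right h']
        nlinarith
      · rw [min_eq_right h', max_eq_left h']
        nlinarith
  have e2 : (L + min x b) * (L - max x b) ≤ 2 * L * (L - |x|) := by
    rcases le_total x 0 with h | h
    · rw [min_eq_left (h.trans b0), max_eq_right (h.trans b0), abs_of_nonpos h]
      nlinarith
    · rw [abs_of_nonneg h]
      refine mul_le_mul ?_ ?_ p2.le (by linarith)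
      · linarith [min_le_right x b]
      · linarith [le_max_left x b]
  constructor
  · calc k ^ 2 * (L - b) * (L - |x|) = k ^ 2 * ((L - b) * (L - |x|)) := by ring
      _ ≤ k ^ 2 * ((L + min x b) * (L - max x b)) := by gcongr
      _ = (k * (L + min x b)) * (k * (L - max x b)) := by ring
      _ ≤ _ := mul_le_mul b1 b3 (by positivity) (le_trans (by positivity) b1)
  · calc greenFn s L b x ≤ (K * (L + min x b)) * (K * (L - max x b)) :=
        mul_le_mul b2 b4 (le_trans (by positivity) b3) (by positivity)
      _ = K ^ 2 * ((L + min x b) * (L - max x b)) := by ring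
      _ ≤ K ^ 2 * (2 * L * (L - |x|)) := by gcongr
      _ = _ := by ring

theorem clamp_mem (a b x : ℝ) :
    max (min a b) (min (max a b) x) ∈ Icc (min a b) (max a b) :=
  ⟨le_max_left _ _, max_le min_le_max (min_le_left _ _)⟩

theorem Icc_subset (P : Principal L β μ a b s c) : Icc (min a b) (max a b) ⊆ Ioo (-L) L :=
  fun _ hx => ⟨(lt_min P.left_mem_Ioo.1 P.right_mem_Ioo.1).trans_le hx.1,
    hx.2.trans_lt (max_lt P.left_mem_Ioo.2 P.right_mem_Ioo.2)⟩

/-- To the left of both poles, and to the right of both, the two Green functions are proportional,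
so clamping x between the poles does not change the quotient. The clamped form avoids 0/0 at ±L. -/
theorem weight_eq (P : Principal L β μ a b s c) {x : ℝ} (hx : x ∈ Ioo (-L) L) :
    weight s L a b x = greenFn s L a x / greenFn s L b x := by
  have hp := P.green_right_pos hx
  have hq := P.green_right_pos (P.Icc_subset (clamp_mem a b x))
  rcases le_total x (min a b) with h | h
  · have hxa : x ≤ a := h.trans (min_le_left _ _)
    have hxb : x ≤ b := h.trans (min_le_right _ _)
    have e : max (min a b) (min (max a b) x) = min a b :=
      max_eq_left ((min_le_right _ _).trans h)
    rw [e] at hq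
    rw [weight, e, div_eq_div_iff hq.ne' hp.ne']
    simp only [greenFn, min_eq_left hxa, min_eq_left hxb, max_eq_right hxa, max_eq_right hxb,
      min_eq_left (min_le_left a b), min_eq_left (min_le_right a b), max_eq_right (min_le_left a b),
      max_eq_right (min_le_right a b)]
    ring
  rcases le_total (max a b) x with h' | h'
  · have hxa : a ≤ x := (le_max_left _ _).trans h'
    have hxb : b ≤ x := (le_max_right _ _).trans h'
    have e : max (min a b) (min (max a b) x) = max a b := by
      rw [min_eq_left h', max_eq_right min_le_max]
    rw [e] at hq
    rw [weight, e, div_eq_div_iff hq.ne' hp.ne']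
    simp only [greenFn, min_eq_right hxa, min_eq_right hxb, max_eq_left hxa, max_eq_left hxb,
      min_eq_right (le_max_left a b), min_eq_right (le_max_right a b), max_eq_left (le_max_left a b),
      max_eq_left (le_max_right a b)]
    ring
  · rw [weight, min_eq_right h', max_eq_right h]

theorem continuous_weight (P : Principal L β μ a b s c) : Continuous (weight s L a b) := by
  have h1 := P.pair.continuous_greenFn L a
  have h2 := P.pair.continuous_greenFn L b
  unfold weight
  refine Continuous.div (by fun_prop) (by fun_prop) fun x => ?_
  exact (P.green_right_pos (P.Icc_subset (clamp_mem a b x))).ne'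

theorem weight_pos (P : Principal L β μ a b s c) (x : ℝ) : 0 < weight s L a b x :=
  div_pos (P.green_left_pos (P.Icc_subset (clamp_mem a b x)))
    (P.green_right_pos (P.Icc_subset (clamp_mem a b x)))

theorem hasDerivAt_weight (P : Principal L β μ a b s c) {x : ℝ} (hx : x ∈ Ioo (-L) L) (ha : x ≠ a)
    (hb : x ≠ b) : HasDerivAt (weight s L a b) (weightDer s c L a b x) x := by
  refine ((P.pair.hasDerivAt_greenFn ha).div (P.pair.hasDerivAt_greenFn hb)
    (P.green_right_pos hx).ne').congr_of_eventuallyEq ?_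
  filter_upwards [isOpen_Ioo.mem_nhds hx] with y hy using P.weight_eq hy

/-- The derivative vanishes outside the interval between the poles, on which G_b is bounded away
from zero. -/
theorem exists_bound_weightDer (P : Principal L β μ a b s c) :
    ∃ C, ∀ x ∈ Ioo (-L) L, |weightDer s c L a b x| ≤ C := by
  obtain ⟨Ca, hCa⟩ := P.pair.exists_bound_greenDer L a
  obtain ⟨Cb, hCb⟩ := P.pair.exists_bound_greenDer L b
  obtain ⟨Da, hDa⟩ := isCompact_Icc.exists_bound_of_continuousOn (s := Icc (-L) L)
    (P.pair.continuous_greenFn L a).continuousOn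
  obtain ⟨Db, hDb⟩ := isCompact_Icc.exists_bound_of_continuousOn (s := Icc (-L) L)
    (P.pair.continuous_greenFn L b).continuousOn
  obtain ⟨y, hy, hmin⟩ := isCompact_Icc.exists_isMinOn (nonempty_Icc.2 (min_le_max (a := a) (b := b)))
    (P.pair.continuous_greenFn L b).continuousOn
  have hm := P.green_right_pos (P.Icc_subset hy)
  set m := greenFn s L b y
  have hCa0 : 0 ≤ Ca := (abs_nonneg _).trans (hCa a (Ioo_subset_Icc_self P.left_mem_Ioo))
  have hCb0 : 0 ≤ Cb := (abs_nonneg _).trans (hCb a (Ioo_subset_Icc_self P.left_mem_Ioo))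
  have hDa0 : 0 ≤ Da := (norm_nonneg _).trans (hDa a (Ioo_subset_Icc_self P.left_mem_Ioo))
  have hDb0 : 0 ≤ Db := (norm_nonneg _).trans (hDb a (Ioo_subset_Icc_self P.left_mem_Ioo))
  refine ⟨(Ca * Db + Da * Cb) / m ^ 2, fun x hx => ?_⟩
  have hxI := Ioo_subset_Icc_self hx
  rcases le_total x (min a b) with h | h
  · have hxa : x ≤ a := h.trans (min_le_left _ _)
    have hxb : x ≤ b := h.trans (min_le_right _ _)
    have : weightDer s c L a b x = 0 := by
      simp only [weightDer, greenFn, greenDer, if_pos hxa, if_pos hxb, min_eq_left hxa,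
        min_eq_left hxb, max_eq_right hxa, max_eq_right hxb]
      ring
    rw [this, abs_zero]
    positivity
  rcases lt_or_ge (max a b) x with h' | h'
  · have hxa : a < x := (le_max_left _ _).trans_lt h'
    have hxb : b < x := (le_max_right _ _).trans_lt h'
    have : weightDer s c L a b x = 0 := by
      simp only [weightDer, greenFn, greenDer, if_neg hxa.not_ge, if_neg hxb.not_ge, min_eq_right hxa.le,
        min_eq_right hxb.le, max_eq_left hxa.le, max_eq_left hxb.le]
      ring
    rw [this, abs_zero]
    positivity
  · have hmx : m ≤ greenFn s L b x := hmin ⟨h, h'⟩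
    rw [weightDer, abs_div, abs_of_nonneg (sq_nonneg (greenFn s L b x))]
    have h1 := hCa x hxI
    have h2 := hCb x hxI
    have h3 := hDa x hxI
    have h4 := hDb x hxI
    rw [Real.norm_eq_abs] at h3 h4
    refine div_le_div₀ (by positivity) ?_ (by positivity) (by gcongr)
    refine (abs_sub _ _).trans ?_
    rw [abs_mul, abs_mul]
    gcongr

theorem isMultiplier_weight (P : Principal L β μ a b s c) :
    IsMultiplier L (weight s L a b) (weightDer s c L a b) where
  cont := P.continuous_weight.continuousOn
  deriv := by
    refine ⟨{a, b}, (countable_singleton b).insert a, fun x hx => ?_⟩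
    have := hx.2
    simp only [mem_insert_iff, mem_singleton_iff, not_or] at this
    exact P.hasDerivAt_weight hx.1 this.1 this.2
  bound := P.exists_bound_weightDer

end Principal

end

section
/-! ### The ground state representation of the weighted form -/

theorem integrableOn_of_bounded {L C : ℝ} {F : ℝ → ℝ} (hF : Measurable F)
    (hC : ∀ x ∈ Ioo (-L) L, |F x| ≤ C) : IntegrableOn F (Ioo (-L) L) := by
  refine Measure.integrableOn_of_bounded (M := C) (measure_Ioo_lt_top.ne) hF.aestronglyMeasurable ?_
  filter_upwards [ae_restrict_mem measurableSet_Ioo] with x hx using hC x hx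

/-- The quotient `h` of a test function by the ground state `G_b`. -/
structure IsQuotient (L b : ℝ) (s c : ℝ → ℝ) (w h h' : ℝ → ℂ) : Prop where
  cont : Continuous h
  meas : Measurable h'
  bound : ∃ C, ∀ x ∈ Ioo (-L) L, ‖h' x‖ ≤ C
  deriv : ∀ x ∈ Ioo (-L) L, x ≠ b → HasDerivAt h (h' x) x
  mul : ∀ x ∈ Ioo (-L) L, w x = h x * greenFn s L b x
  mul_deriv : ∀ x ∈ Ioo (-L) L, _root_.deriv w x = h' x * greenFn s L b x + h x * greenDer s c L b x

namespace IsQuotient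

variable {L b : ℝ} {s c : ℝ → ℝ} {w h h' : ℝ → ℂ}

theorem isMultiplier (q : IsQuotient L b s c w h h') :
    IsMultiplier L (fun x => Complex.normSq (h x))
      (fun x => 2 * ((h x).re * (h' x).re + (h x).im * (h' x).im)) where
  cont := (Complex.continuous_normSq.comp q.cont).continuousOn
  deriv := by
    refine ⟨{b}, countable_singleton b, fun x hx => ?_⟩
    have h1 := q.deriv x hx.1 hx.2
    have h2 : HasDerivAt (fun x => (h x).re) (h' x).re x :=
      (Complex.reCLM.hasFDerivAt.comp_hasDerivAt x h1)
    have h3 : HasDerivAt (fun x => (h x).im) (h' x).im x :=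
      (Complex.imCLM.hasFDerivAt.comp_hasDerivAt x h1)
    refine ((h2.mul h2).add (h3.mul h3)).congr_deriv ?_
    ring
  bound := by
    obtain ⟨C, hC⟩ := q.bound
    obtain ⟨D, hD⟩ := isCompact_Icc.exists_bound_of_continuousOn (s := Icc (-L) L) q.cont.continuousOn
    refine ⟨2 * (D * C + D * C), fun x hx => ?_⟩
    have h1 := hC x hx
    have h2 := hD x (Ioo_subset_Icc_self hx)
    have hD0 := (norm_nonneg _).trans h2
    rw [abs_mul, abs_two]
    refine mul_le_mul_of_nonneg_left ((abs_add_le _ _).trans ?_) zero_le_two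
    rw [abs_mul, abs_mul]
    gcongr
    · exact (Complex.abs_re_le_norm _).trans h2
    · exact (Complex.abs_re_le_norm _).trans h1
    · exact (Complex.abs_im_le_norm _).trans h2
    · exact (Complex.abs_im_le_norm _).trans h1

end IsQuotient

namespace Principal

variable {L β μ a b : ℝ} {s c : ℝ → ℝ}

/-- G_b vanishes only at ±L, away from the compact support of w; the one kink of the quotient is at
the pole b. -/
theorem exists_quotient (P : Principal L β μ a b s c) {w : ℝ → ℂ} (h1 : ContDiff ℝ ∞ w)
    (h2 : HasCompactSupport w) (h3 : tsupport w ⊆ Ioo (-L) L) :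
    ∃ h h' : ℝ → ℂ, IsQuotient L b s c w h h' := by
  have hp := P.pair.continuous_greenFn L b
  have hp' := P.pair.measurable_greenDer L b
  have hw := h1.continuous
  have hw' := h1.continuous_deriv (by simp)
  have hd : ∀ x, HasDerivAt w (deriv w x) x := fun x => (h1.differentiable (by simp) x).hasDerivAt
  have hpos : ∀ x ∈ Ioo (-L) L, (greenFn s L b x : ℂ) ≠ 0 := fun x hx => by
    exact_mod_cast (P.green_right_pos hx).ne'
  refine ⟨fun x => w x / greenFn s L b x, fun x => (deriv w x * greenFn s L b x -
    w x * greenDer s c L b x) / (greenFn s L b x : ℂ) ^ 2, ?_, ?_, ?_, ?_, ?_, ?_⟩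
  · rw [continuous_iff_continuousAt]
    intro x
    by_cases hx : x ∈ tsupport w
    · exact hw.continuousAt.div (Complex.continuous_ofReal.comp hp).continuousAt (hpos x (h3 hx))
    · have : (fun x => w x / greenFn s L b x) =ᶠ[𝓝 x] fun _ => (0 : ℂ) := by
        filter_upwards [(isClosed_tsupport w).isOpen_compl.mem_nhds hx] with y hy
        rw [image_eq_zero_of_notMem_tsupport hy, zero_div]
      exact continuousAt_const.congr this.symm
  · have m1 := hw.measurable
    have m2 := hw'.measurable
    have m3 := hp.measurable
    fun_prop
  · rcases (tsupport w).eq_empty_or_nonempty with he | hne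
    · refine ⟨0, fun x _ => ?_⟩
      have e1 : w x = 0 := image_eq_zero_of_notMem_tsupport (by rw [he]; exact notMem_empty x)
      have e2 : deriv w x = 0 := image_eq_zero_of_notMem_tsupport
        fun h => by have := tsupport_deriv_subset (f := w) h; rw [he] at this; exact this
      simp [e1, e2]
    obtain ⟨y, hy, hmin⟩ := h2.isCompact.exists_isMinOn hne hp.continuousOn
    have hm := P.green_right_pos (h3 hy)
    obtain ⟨A, hA⟩ := h2.exists_bound_of_continuous hw
    obtain ⟨B, hB⟩ := h2.deriv.exists_bound_of_continuous hw'
    obtain ⟨D, hD⟩ := P.pair.exists_bound_greenDer L b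
    obtain ⟨E, hE⟩ := isCompact_Icc.exists_bound_of_continuousOn (s := Icc (-L) L) hp.continuousOn
    refine ⟨(B * E + A * D) / greenFn s L b y ^ 2, fun x hx => ?_⟩
    have a1 := hA x
    have a2 := hB x
    have a3 := hD x (Ioo_subset_Icc_self hx)
    have a4 := hE x (Ioo_subset_Icc_self hx)
    rw [Real.norm_eq_abs] at a4
    have b1 := (norm_nonneg _).trans a1
    have b2 := (norm_nonneg _).trans a2
    have b3 := (abs_nonneg _).trans a3
    have b4 := (abs_nonneg _).trans a4
    by_cases hxs : x ∈ tsupport w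
    · rw [norm_div, norm_pow, Complex.norm_real, Real.norm_of_nonneg (P.green_right_pos hx).le]
      refine div_le_div₀ (by positivity) ?_ (by positivity) ?_
      · refine (norm_sub_le _ _).trans ?_
        rw [norm_mul, norm_mul, Complex.norm_real, Complex.norm_real, Real.norm_eq_abs,
          Real.norm_eq_abs]
        gcongr
      · have : greenFn s L b y ≤ greenFn s L b x := hmin hxs
        gcongr
    · have e1 : w x = 0 := image_eq_zero_of_notMem_tsupport hxs
      have e2 : deriv w x = 0 := image_eq_zero_of_notMem_tsupport
        fun h => hxs (tsupport_deriv_subset (f := w) h)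
      simp only [e1, e2, zero_mul, sub_zero, zero_div, norm_zero]
      positivity
  · intro x hx hxb
    exact (hd x).div (P.pair.hasDerivAt_greenFn hxb).ofReal_comp (hpos x hx)
  · intro x hx
    have := hpos x hx
    field_simp
  · intro x hx
    have := hpos x hx
    field_simp
    ring

/-- The weighted energy `∫ M |f|²`. -/
noncomputable def energy (P : Principal L β μ a b s c) (f : LTwo L) : ℝ :=
  (inner ℂ (P.isMultiplier_weight.op f) f).re

/-- The weighted form `Re ⟨A u, M ū⟩`. -/
noncomputable def form (P : Principal L β μ a b s c) (u : H10 L) : ℝ :=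
  (inner ℂ (P.isMultiplier_weight.dop u) (wderiv L u)).re +
    β * (weight s L a b b * (dirac L a u * (starRingEnd ℂ) (dirac L b u)).re)

theorem integrable_inner (f g : LTwo L) :
    IntegrableOn (fun x => (g x * (starRingEnd ℂ) (f x)).re) (Ioo (-L) L) := by
  have := (L2.integrable_inner (𝕜 := ℂ) f g).re
  refine this.congr (ae_of_all _ fun x => ?_)
  simp [RCLike.inner_apply]

theorem re_inner_eq (f g : LTwo L) :
    (inner ℂ f g).re = ∫ x in Ioo (-L) L, (g x * (starRingEnd ℂ) (f x)).re := by
  rw [L2.inner_def]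
  have := integral_re (L2.integrable_inner (𝕜 := ℂ) f g)
  simp only [RCLike.re_to_complex] at this
  rw [← this]
  simp only [RCLike.inner_apply]

theorem energy_eq (P : Principal L β μ a b s c) (f : LTwo L) :
    P.energy f = ∫ x in Ioo (-L) L, weight s L a b x * Complex.normSq (f x) := by
  rw [energy, re_inner_eq]
  refine integral_congr_ae ?_
  filter_upwards [P.isMultiplier_weight.op_ae f] with x hx
  rw [hx, map_mul, Complex.conj_ofReal, Complex.normSq_apply]
  simp only [Complex.mul_re, Complex.mul_im, Complex.ofReal_re, Complex.ofReal_im, Complex.conj_re,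
    Complex.conj_im]
  ring

/-- For u = hG_b the weighted conjugate of u is the conjugate of h times G_a. Twice the real part of
the product of derivatives is 2|h'|²G_aG_b + G_a'(|h|²G_b)' + G_b'(|h|²G_a)'. The last two terms are
Green functions tested against |h|² times the other one, so they give 2μ times the energy plus
Wronskian terms in |h(a)|² and |h(b)|². The eigenvalue equation merges these with the Dirac term
into |h(b) − h(a)|². -/
theorem ground_state (P : Principal L β μ a b s c) {u : H10 L} {w h h' : ℝ → ℂ}
    (h1 : ContDiff ℝ ∞ w) (h3 : tsupport w ⊆ Ioo (-L) L)
    (h4 : fn L u =ᵐ[volume.restrict (Ioo (-L) L)] w)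
    (h5 : wderiv L u =ᵐ[volume.restrict (Ioo (-L) L)] deriv w) (q : IsQuotient L b s c w h h') :
    IntegrableOn (fun x => ‖h' x‖ ^ 2 * (greenFn s L a x * greenFn s L b x)) (Ioo (-L) L) ∧
    P.energy (fn L u) =
      ∫ x in Ioo (-L) L, ‖h x‖ ^ 2 * (greenFn s L a x * greenFn s L b x) ∧
    2 * (P.form u - μ * P.energy (fn L u)) =
      2 * (∫ x in Ioo (-L) L, ‖h' x‖ ^ 2 * (greenFn s L a x * greenFn s L b x)) -
        β * greenFn s L b a ^ 2 * ‖h b - h a‖ ^ 2 := by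
  have hL := P.L_pos
  have ha := P.left_mem_Ioo
  have hb := P.right_mem_Ioo
  set G := greenFn s L b with hG
  set K := greenFn s L a with hK
  set G' := greenDer s c L b with hG'
  set K' := greenDer s c L a with hK'
  have Hm := q.isMultiplier
  set H : ℝ → ℝ := fun x => Complex.normSq (h x) with hH
  set H' : ℝ → ℝ := fun x => 2 * ((h x).re * (h' x).re + (h x).im * (h' x).im) with hH'
  obtain ⟨g, g1, g2, g3, g4⟩ := P.pair.exists_green hL hb
  obtain ⟨k, k1, k2, k3, k4⟩ := P.pair.exists_green hL ha
  obtain ⟨y, y1, y2⟩ := Hm.exists_mul hL g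
  obtain ⟨z, z1, z2⟩ := Hm.exists_mul hL k
  -- integrability
  have cG : Continuous G := P.pair.continuous_greenFn L b
  have cK : Continuous K := P.pair.continuous_greenFn L a
  have cH : Continuous H := Complex.continuous_normSq.comp q.cont
  have mG' : Measurable G' := P.pair.measurable_greenDer L b
  have mK' : Measurable K' := P.pair.measurable_greenDer L a
  have mh := q.cont.measurable
  have mh' := q.meas
  have mH' : Measurable H' := by fun_prop
  have bd : ∀ F : ℝ → ℝ, Continuous F → ∃ C, ∀ x ∈ Ioo (-L) L, |F x| ≤ C := fun F hF => by
    obtain ⟨C, hC⟩ := isCompact_Icc.exists_bound_of_continuousOn (s := Icc (-L) L) hF.continuousOn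
    exact ⟨C, fun x hx => hC x (Ioo_subset_Icc_self hx)⟩
  obtain ⟨BG, hBG⟩ := bd G cG
  obtain ⟨BK, hBK⟩ := bd K cK
  obtain ⟨BH, hBH⟩ := bd H cH
  obtain ⟨BG', hBG'⟩ := P.pair.exists_bound_greenDer L b
  obtain ⟨BK', hBK'⟩ := P.pair.exists_bound_greenDer L a
  obtain ⟨BH', hBH'⟩ := Hm.bound
  obtain ⟨Bh', hBh'⟩ := q.bound
  have mulb : ∀ {x y X Y : ℝ}, |x| ≤ X → |y| ≤ Y → |x * y| ≤ X * Y := fun h1 h2 => by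
    rw [abs_mul]
    exact mul_le_mul h1 h2 (abs_nonneg _) ((abs_nonneg _).trans h1)
  have addb : ∀ {x y X Y : ℝ}, |x| ≤ X → |y| ≤ Y → |x + y| ≤ X + Y := fun h1 h2 =>
    (abs_add_le _ _).trans (add_le_add h1 h2)
  have i2 : IntegrableOn (fun x => K' x * (H x * G' x + H' x * G x)) (Ioo (-L) L) :=
    integrableOn_of_bounded (C := BK' * (BH * BG' + BH' * BG)) (by fun_prop) fun x hx =>
      mulb (hBK' x (Ioo_subset_Icc_self hx)) (addb (mulb (hBH x hx) (hBG' x (Ioo_subset_Icc_self hx)))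
        (mulb (hBH' x hx) (hBG x hx)))
  have i3 : IntegrableOn (fun x => G' x * (H x * K' x + H' x * K x)) (Ioo (-L) L) :=
    integrableOn_of_bounded (C := BG' * (BH * BK' + BH' * BK)) (by fun_prop) fun x hx =>
      mulb (hBG' x (Ioo_subset_Icc_self hx)) (addb (mulb (hBH x hx) (hBK' x (Ioo_subset_Icc_self hx)))
        (mulb (hBH' x hx) (hBK x hx)))
  have i5 : IntegrableOn (fun x => ‖h' x‖ ^ 2 * (K x * G x)) (Ioo (-L) L) :=
    integrableOn_of_bounded (C := Bh' ^ 2 * (BK * BG)) (by fun_prop) fun x hx =>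
      mulb (by rw [abs_of_nonneg (by positivity)]; gcongr; exact hBh' x hx)
        (mulb (hBK x hx) (hBG x hx))
  have ee : P.energy (fn L u) = ∫ x in Ioo (-L) L, ‖h x‖ ^ 2 * (K x * G x) := by
    rw [energy_eq]
    refine integral_congr_ae ?_
    filter_upwards [h4, ae_restrict_mem measurableSet_Ioo] with x e1 e2
    have := (P.green_right_pos e2).ne'
    rw [e1, P.weight_eq e2, q.mul x e2, map_mul, Complex.normSq_ofReal, Complex.normSq_eq_norm_sq]
    simp only [hK, hG]
    field_simp
  refine ⟨i5, ee, ?_⟩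
  -- the three integral identities
  have toReal : ∀ F : ℝ → ℝ, ∫ x in Ioo (-L) L, (F x : ℂ) = ((∫ x in Ioo (-L) L, F x : ℝ) : ℂ) :=
    fun F => integral_ofReal
  have E1 : (∫ x in Ioo (-L) L, K' x * (H x * G' x + H' x * G x)) -
      μ * (∫ x in Ioo (-L) L, ‖h x‖ ^ 2 * (K x * G x)) = 2 * s L * c L * (H a * G a) := by
    have t1 : opA L k y = ((∫ x in Ioo (-L) L, K' x * (H x * G' x + H' x * G x) : ℝ) : ℂ) := by
      rw [← toReal, opA_apply, y1]
      refine integral_congr_ae ?_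
      filter_upwards [k3, Hm.dop_ae g, g2, g3] with x e1 e2 e3 e4
      rw [e1, e2, e3, e4]; push_cast; ring
    have t2 : emb L k y = ((∫ x in Ioo (-L) L, ‖h x‖ ^ 2 * (K x * G x) : ℝ) : ℂ) := by
      rw [← toReal, emb_apply]
      refine integral_congr_ae ?_
      filter_upwards [k2, fn_ae_eq_dirac L y, ae_restrict_mem measurableSet_Ioo] with x e1 e2 e3
      rw [e1, e2, y2 x e3, g1 x e3, ← Complex.normSq_eq_norm_sq]; push_cast; ring
    have t3 := k4 y
    rw [t1, t2, y2 a ha, g1 a ha] at t3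
    exact_mod_cast t3
  have E2 : (∫ x in Ioo (-L) L, G' x * (H x * K' x + H' x * K x)) -
      μ * (∫ x in Ioo (-L) L, ‖h x‖ ^ 2 * (K x * G x)) = 2 * s L * c L * (H b * K b) := by
    have t1 : opA L g z = ((∫ x in Ioo (-L) L, G' x * (H x * K' x + H' x * K x) : ℝ) : ℂ) := by
      rw [← toReal, opA_apply, z1]
      refine integral_congr_ae ?_
      filter_upwards [g3, Hm.dop_ae k, k2, k3] with x e1 e2 e3 e4
      rw [e1, e2, e3, e4]; push_cast; ring
    have t2 : emb L g z = ((∫ x in Ioo (-L) L, ‖h x‖ ^ 2 * (K x * G x) : ℝ) : ℂ) := by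
      rw [← toReal, emb_apply]
      refine integral_congr_ae ?_
      filter_upwards [g2, fn_ae_eq_dirac L z, ae_restrict_mem measurableSet_Ioo] with x e1 e2 e3
      rw [e1, e2, z2 x e3, k1 x e3, ← Complex.normSq_eq_norm_sq]; push_cast; ring
    have t3 := g4 z
    rw [t1, t2, z2 b hb, k1 b hb] at t3
    exact_mod_cast t3
  have E3 : 2 * (inner ℂ (P.isMultiplier_weight.dop u) (wderiv L u)).re =
      2 * (∫ x in Ioo (-L) L, ‖h' x‖ ^ 2 * (K x * G x)) +
        (∫ x in Ioo (-L) L, K' x * (H x * G' x + H' x * G x)) +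
        ∫ x in Ioo (-L) L, G' x * (H x * K' x + H' x * K x) := by
    have i6 : IntegrableOn (fun x => 2 * (‖h' x‖ ^ 2 * (K x * G x)) +
        K' x * (H x * G' x + H' x * G x)) (Ioo (-L) L) := (i5.const_mul 2).add i2
    rw [re_inner_eq, ← integral_const_mul, ← integral_const_mul,
      ← integral_add (i5.const_mul 2) i2, ← integral_add i6 i3]
    refine integral_congr_ae ?_
    filter_upwards [P.isMultiplier_weight.dop_ae u, h4, h5, ae_restrict_mem measurableSet_Ioo]
      with x e1 e2 e3 e4
    have e5 := (P.green_right_pos e4).ne'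
    rw [e1, e2, e3, P.weight_eq e4, q.mul_deriv x e4, q.mul x e4]
    simp only [weightDer, hH, hH']
    rw [← Complex.normSq_eq_norm_sq, Complex.normSq_apply, Complex.normSq_apply]
    change G x ≠ 0 at e5
    rw [← hG, ← hK, ← hG', ← hK']
    generalize G x = G at *
    generalize K x = K at *
    generalize G' x = G' at *
    generalize K' x = K' at *
    generalize h x = h at *
    generalize h' x = h' at *
    simp only [map_mul, map_add, Complex.conj_ofReal, Complex.mul_re, Complex.mul_im, Complex.add_re,
      Complex.add_im, Complex.ofReal_re, Complex.ofReal_im, Complex.conj_re, Complex.conj_im]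
    field_simp
    ring
  have hw : dirac L a u = h a * G a ∧ dirac L b u = h b * G b := by
    rw [dirac_test ha h1 h3 h5, dirac_test hb h1 h3 h5, q.mul a ha, q.mul b hb]
    exact ⟨rfl, rfl⟩
  have hGa : K b = G a := greenFn_comm s L a b
  have hGb : weight s L a b b * G b = G a := by
    rw [P.weight_eq hb, div_mul_cancel₀ _ (P.green_right_pos hb).ne']
    exact hGa
  have E4 : weight s L a b b * (dirac L a u * (starRingEnd ℂ) (dirac L b u)).re =
      G a ^ 2 * ((h a).re * (h b).re + (h a).im * (h b).im) := by
    rw [hw.1, hw.2, map_mul, Complex.conj_ofReal]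
    rw [sq, ← hGb]
    simp only [Complex.mul_re, Complex.mul_im, Complex.ofReal_re, Complex.ofReal_im, Complex.conj_re,
      Complex.conj_im]
    rw [hGb]
    linear_combination (G a * ((h a).re * (h b).re + (h a).im * (h b).im)) * hGb
  -- The eigenvalue equation replaces the Wronskian by −βG_b(a), which completes the square.
  have E5 : 2 * s L * c L = -(β * G a) := by linarith [P.eig]
  rw [E5] at E1 E2
  rw [hGa] at E2
  rw [form, E4, ee, ← Complex.normSq_eq_norm_sq, Complex.normSq_apply, Complex.sub_re, Complex.sub_im]
  simp only [hH, Complex.normSq_apply] at E1 E2 E3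
  linear_combination E3 + E1 + E2

end Principal

end

section
/-! ### The spectral gap -/

theorem sq_integral_mul_le {α : Type*} [MeasurableSpace α] {ν : Measure α} {F G : α → ℝ}
    (hF : Integrable (fun x => F x ^ 2) ν) (hG : Integrable (fun x => G x ^ 2) ν)
    (hFG : Integrable (fun x => F x * G x) ν) :
    (∫ x, F x * G x ∂ν) ^ 2 ≤ (∫ x, F x ^ 2 ∂ν) * ∫ x, G x ^ 2 ∂ν := by
  have h : ∀ r : ℝ, 0 ≤ (∫ x, F x ^ 2 ∂ν) * (r * r) + (2 * ∫ x, F x * G x ∂ν) * r +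
      ∫ x, G x ^ 2 ∂ν := by
    intro r
    have h1 : 0 ≤ ∫ x, (r * F x + G x) ^ 2 ∂ν := integral_nonneg fun x => sq_nonneg _
    have h2 : ∫ x, (r * F x + G x) ^ 2 ∂ν =
        ∫ x, (r * r) * F x ^ 2 + (2 * r) * (F x * G x) + G x ^ 2 ∂ν :=
      integral_congr_ae (ae_of_all _ fun x => by ring)
    have h3 : Integrable (fun x => (r * r) * F x ^ 2 + (2 * r) * (F x * G x)) ν :=
      (hF.const_mul _).add (hFG.const_mul _)
    rw [h2, integral_add h3 hG, integral_add (hF.const_mul _) (hFG.const_mul _), integral_const_mul,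
      integral_const_mul] at h1
    linarith
  have := discrim_le_zero h
  rw [discrim] at this
  linarith

namespace Principal

variable {L β μ a b : ℝ} {s c : ℝ → ℝ}

/-- The density `G_a G_b`. -/
noncomputable def density (s : ℝ → ℝ) (L a b x : ℝ) : ℝ := greenFn s L a x * greenFn s L b x

theorem continuous_density (P : Principal L β μ a b s c) : Continuous (density s L a b) :=
  (P.pair.continuous_greenFn L a).mul (P.pair.continuous_greenFn L b)

theorem density_pos (P : Principal L β μ a b s c) {x : ℝ} (hx : x ∈ Ioo (-L) L) :
    0 < density s L a b x := mul_pos (P.green_left_pos hx) (P.green_right_pos hx)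

theorem intervalIntegrable_inv_density (P : Principal L β μ a b s c) {x y : ℝ} (hx : x ∈ Ioo (-L) L)
    (hy : y ∈ Ioo (-L) L) : IntervalIntegrable (fun z => (density s L a b z)⁻¹) volume x y := by
  refine ContinuousOn.intervalIntegrable fun z hz => ?_
  have hz' : z ∈ Ioo (-L) L := (ordConnected_Ioo.uIcc_subset hx hy) hz
  exact (P.continuous_density.continuousAt.inv₀ (P.density_pos hz').ne').continuousWithinAt

/-- Cauchy–Schwarz for ∫ h' with h' split as (h'√ρ)·(1/√ρ), ρ = G_aG_b. -/
theorem norm_sub_sq_le (P : Principal L β μ a b s c) {w h h' : ℝ → ℂ} (q : IsQuotient L b s c w h h')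
    (hi : IntegrableOn (fun x => ‖h' x‖ ^ 2 * density s L a b x) (Ioo (-L) L)) {x y : ℝ}
    (hx : x ∈ Ioo (-L) L) (hy : y ∈ Ioo (-L) L) (hxy : x ≤ y) :
    ‖h y - h x‖ ^ 2 ≤ (∫ z in x..y, (density s L a b z)⁻¹) *
      ∫ z in Ioo (-L) L, ‖h' z‖ ^ 2 * density s L a b z := by
  have hsub : Ioc x y ⊆ Ioo (-L) L := fun z hz => ⟨hx.1.trans hz.1, hz.2.trans_lt hy.2⟩
  obtain ⟨C, hC⟩ := q.bound
  have i1 : IntegrableOn h' (Ioc x y) := by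
    refine Measure.integrableOn_of_bounded (M := C) (measure_Ioc_lt_top.ne)
      q.meas.aestronglyMeasurable ?_
    filter_upwards [ae_restrict_mem measurableSet_Ioc] with z hz using hC z (hsub hz)
  have e1 : ∫ z in x..y, h' z = h y - h x :=
    integral_eq_of_hasDerivAt_off_countable_of_le h h' hxy (countable_singleton b)
      q.cont.continuousOn (fun z hz => q.deriv z (hsub (Ioo_subset_Ioc_self hz.1)) hz.2)
      ((intervalIntegrable_iff_integrableOn_Ioc_of_le hxy).2 i1)
  have e2 : ∀ z ∈ Ioc x y, ‖h' z‖ * √(density s L a b z) * (√(density s L a b z))⁻¹ = ‖h' z‖ :=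
    fun z hz => by
      have := (Real.sqrt_pos.2 (P.density_pos (hsub hz))).ne'
      field_simp
  have e3 : ∀ z ∈ Ioc x y, (‖h' z‖ * √(density s L a b z)) ^ 2 = ‖h' z‖ ^ 2 * density s L a b z :=
    fun z hz => by rw [mul_pow, Real.sq_sqrt (P.density_pos (hsub hz)).le]
  have e4 : ∀ z ∈ Ioc x y, ((√(density s L a b z))⁻¹) ^ 2 = (density s L a b z)⁻¹ :=
    fun z hz => by rw [inv_pow, Real.sq_sqrt (P.density_pos (hsub hz)).le]
  have i2 : IntegrableOn (fun z => ‖h' z‖ ^ 2 * density s L a b z) (Ioc x y) := hi.mono_set hsub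
  have i3 : IntegrableOn (fun z => (density s L a b z)⁻¹) (Ioc x y) :=
    (intervalIntegrable_iff_integrableOn_Ioc_of_le hxy).1 (P.intervalIntegrable_inv_density hx hy)
  have cs := sq_integral_mul_le (ν := volume.restrict (Ioc x y))
    (F := fun z => ‖h' z‖ * √(density s L a b z)) (G := fun z => (√(density s L a b z))⁻¹)
    (IntegrableOn.congr_fun i2 (fun z hz => (e3 z hz).symm) measurableSet_Ioc)
    (IntegrableOn.congr_fun i3 (fun z hz => (e4 z hz).symm) measurableSet_Ioc)
    (IntegrableOn.congr_fun i1.norm (fun z hz => (e2 z hz).symm) measurableSet_Ioc)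
  rw [setIntegral_congr_fun measurableSet_Ioc e2, setIntegral_congr_fun measurableSet_Ioc e3,
    setIntegral_congr_fun measurableSet_Ioc e4] at cs
  have e5 : ‖h y - h x‖ ≤ ∫ z in Ioc x y, ‖h' z‖ := by
    rw [← e1, intervalIntegral.integral_of_le hxy]
    exact norm_integral_le_integral_norm _
  refine (pow_le_pow_left₀ (norm_nonneg _) e5 2).trans (cs.trans ?_)
  rw [intervalIntegral.integral_of_le hxy, mul_comm]
  refine mul_le_mul_of_nonneg_left ?_ ?_
  · refine setIntegral_mono_set hi ?_ (Eventually.of_forall hsub)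
    filter_upwards [ae_restrict_mem measurableSet_Ioo] with z hz
    exact mul_nonneg (sq_nonneg _) (P.density_pos hz).le
  · exact setIntegral_nonneg measurableSet_Ioc fun z hz => inv_nonneg.2 (P.density_pos (hsub hz)).le

/-- The density ρ is comparable to the squared distance to the boundary, so ∫ 1/ρ grows like the
inverse distance and the product with ρ stays bounded. This is what makes a Poincaré inequality with
degenerate weight possible. -/
theorem exists_density_mul_integral_le (P : Principal L β μ a b s c) : ∃ D : ℝ, 0 < D ∧
    (∀ x ∈ Ioo (-L) L, 0 ≤ x →
      density s L a b x * (∫ z in (0 : ℝ)..x, (density s L a b z)⁻¹) ≤ D) ∧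
    (∀ x ∈ Ioo (-L) L, x ≤ 0 →
      density s L a b x * (∫ z in x..0, (density s L a b z)⁻¹) ≤ D) := by
  have hL := P.L_pos
  have h0 : (0 : ℝ) ∈ Ioo (-L) L := ⟨by linarith, hL⟩
  obtain ⟨k, K, hk, hK, hb⟩ := P.exists_green_bounds
  obtain ⟨k', K', hk', hK', hb'⟩ := P.symm.exists_green_bounds
  have hd : ∀ x ∈ Ioo (-L) L, 0 < L - |x| := fun x hx => sub_pos.2 (abs_lt.2 hx)
  have lower : ∀ x ∈ Ioo (-L) L, (density s L a b x)⁻¹ ≤ (k * k')⁻¹ * ((L - |x|) ^ 2)⁻¹ := by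
    intro x hx
    have := hd x hx
    rw [← mul_inv]
    refine inv_anti₀ (by positivity) ?_
    have := mul_le_mul (hb' x hx).1 (hb x hx).1 (by positivity)
      (le_trans (by positivity) (hb' x hx).1)
    rw [density]
    linarith
  have upper : ∀ x ∈ Ioo (-L) L, density s L a b x ≤ K * K' * (L - |x|) ^ 2 := by
    intro x hx
    have := hd x hx
    have := mul_le_mul (hb' x hx).2 (hb x hx).2 (P.green_right_pos hx).le (by positivity)
    rw [density]
    linarith
  have fin : ∀ x ∈ Ioo (-L) L, ∀ J : ℝ, J ≤ (k * k')⁻¹ * (L - |x|)⁻¹ →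
      density s L a b x * J ≤ K * K' * L * (k * k')⁻¹ := by
    intro x hx J hJ
    have h1 := hd x hx
    calc density s L a b x * J ≤ density s L a b x * ((k * k')⁻¹ * (L - |x|)⁻¹) :=
          mul_le_mul_of_nonneg_left hJ (P.density_pos hx).le
      _ ≤ K * K' * (L - |x|) ^ 2 * ((k * k')⁻¹ * (L - |x|)⁻¹) :=
          mul_le_mul_of_nonneg_right (upper x hx) (by positivity)
      _ = K * K' * (L - |x|) * (k * k')⁻¹ := by field_simp
      _ ≤ _ := by gcongr; linarith [abs_nonneg x]
  refine ⟨K * K' * L * (k * k')⁻¹, by positivity, fun x hx hx0 => fin x hx _ ?_,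
    fun x hx hx0 => fin x hx _ ?_⟩
  · have hsub : ∀ z ∈ Icc 0 x, z ∈ Ioo (-L) L := fun z hz =>
      ⟨by linarith [hz.1], hz.2.trans_lt hx.2⟩
    have hc : ContinuousOn (fun z => ((L - z) ^ 2)⁻¹) (uIcc 0 x) := by
      rw [uIcc_of_le hx0]
      refine ContinuousOn.inv₀ (by fun_prop) fun z hz => ?_
      have := sub_pos.2 (hsub z hz).2
      positivity
    have e : ∫ z in (0 : ℝ)..x, ((L - z) ^ 2)⁻¹ = (L - x)⁻¹ - (L - 0)⁻¹ := by
      refine intervalIntegral.integral_eq_sub_of_hasDerivAt (f := fun z => (L - z)⁻¹) (fun z hz => ?_)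
        hc.intervalIntegrable
      rw [uIcc_of_le hx0] at hz
      have := sub_pos.2 (hsub z hz).2
      have h1 : HasDerivAt (fun z => L - z) (-1) z := by simpa using (hasDerivAt_id z).const_sub L
      refine (h1.inv this.ne').congr_deriv ?_
      rw [neg_neg, one_div]
    have h2 : ∫ z in (0 : ℝ)..x, (density s L a b z)⁻¹ ≤
        ∫ z in (0 : ℝ)..x, (k * k')⁻¹ * ((L - z) ^ 2)⁻¹ := by
      refine intervalIntegral.integral_mono_on hx0 (P.intervalIntegrable_inv_density h0 hx)
        (hc.intervalIntegrable.const_mul _) fun z hz => ?_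
      have := lower z (hsub z hz)
      rwa [abs_of_nonneg hz.1] at this
    rw [intervalIntegral.integral_const_mul, e] at h2
    rw [abs_of_nonneg hx0]
    refine h2.trans (mul_le_mul_of_nonneg_left ?_ (by positivity))
    have : 0 < (L - 0)⁻¹ := by rw [sub_zero]; positivity
    linarith
  · have hsub : ∀ z ∈ Icc x 0, z ∈ Ioo (-L) L := fun z hz =>
      ⟨hx.1.trans_le hz.1, by linarith [hz.2]⟩
    have hc : ContinuousOn (fun z => ((L + z) ^ 2)⁻¹) (uIcc x 0) := by
      rw [uIcc_of_le hx0]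
      refine ContinuousOn.inv₀ (by fun_prop) fun z hz => ?_
      have : 0 < L + z := by linarith [(hsub z hz).1]
      positivity
    have e : ∫ z in x..0, ((L + z) ^ 2)⁻¹ = -(L + 0)⁻¹ - -(L + x)⁻¹ := by
      refine intervalIntegral.integral_eq_sub_of_hasDerivAt (f := fun z => -(L + z)⁻¹) (fun z hz => ?_)
        hc.intervalIntegrable
      rw [uIcc_of_le hx0] at hz
      have : 0 < L + z := by linarith [(hsub z hz).1]
      have h1 : HasDerivAt (fun z => L + z) 1 z := by simpa using (hasDerivAt_id z).const_add L
      refine (h1.inv this.ne').neg.congr_deriv ?_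
      rw [neg_div, neg_neg, one_div]
    have h2 : ∫ z in x..0, (density s L a b z)⁻¹ ≤
        ∫ z in x..0, (k * k')⁻¹ * ((L + z) ^ 2)⁻¹ := by
      refine intervalIntegral.integral_mono_on hx0 (P.intervalIntegrable_inv_density hx h0)
        (hc.intervalIntegrable.const_mul _) fun z hz => ?_
      have := lower z (hsub z hz)
      rwa [abs_of_nonpos hz.2, sub_neg_eq_add] at this
    rw [intervalIntegral.integral_const_mul, e] at h2
    rw [abs_of_nonpos hx0, sub_neg_eq_add]
    refine h2.trans (mul_le_mul_of_nonneg_left ?_ (by positivity))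
    have : 0 < (L + 0)⁻¹ := by rw [add_zero]; positivity
    linarith

/-- The field `small` bounds ρ below between the poles by βG_b(a)²|b − a|, so that βG_b(a)² ∫ 1/ρ ≤
1 there; this is the only use of the smallness of β. For β ≤ 0 the left side is nonpositive. -/
theorem small_jump (P : Principal L β μ a b s c) {w h h' : ℝ → ℂ} (q : IsQuotient L b s c w h h')
    (hi : IntegrableOn (fun x => ‖h' x‖ ^ 2 * density s L a b x) (Ioo (-L) L)) :
    β * greenFn s L b a ^ 2 * ‖h b - h a‖ ^ 2 ≤
      ∫ z in Ioo (-L) L, ‖h' z‖ ^ 2 * density s L a b z := by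
  have hE : 0 ≤ ∫ z in Ioo (-L) L, ‖h' z‖ ^ 2 * density s L a b z :=
    setIntegral_nonneg measurableSet_Ioo fun z hz => mul_nonneg (sq_nonneg _) (P.density_pos hz).le
  rcases le_or_gt β 0 with hβ | hβ
  · refine le_trans ?_ hE
    have : 0 ≤ greenFn s L b a ^ 2 * ‖h b - h a‖ ^ 2 := by positivity
    nlinarith
  have hmin : min a b ∈ Ioo (-L) L := P.Icc_subset ⟨le_rfl, min_le_max⟩
  have hmax : max a b ∈ Ioo (-L) L := P.Icc_subset ⟨min_le_max, le_rfl⟩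
  have h1 := P.norm_sub_sq_le q hi hmin hmax min_le_max
  have h2 : ‖h (max a b) - h (min a b)‖ = ‖h b - h a‖ := by
    rcases le_total a b with hab | hab
    · rw [max_eq_right hab, min_eq_left hab]
    · rw [max_eq_left hab, min_eq_right hab, norm_sub_rev]
  rw [h2] at h1
  have hg := P.green_right_pos P.left_mem_Ioo
  have h3 : β * greenFn s L b a ^ 2 * (∫ z in (min a b)..(max a b), (density s L a b z)⁻¹) ≤ 1 := by
    rcases eq_or_ne a b with hab | hab
    · simp [hab]
    have hab' : 0 < |b - a| := abs_pos.2 (sub_ne_zero.2 hab.symm)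
    have h4 : ∫ z in (min a b)..(max a b), (density s L a b z)⁻¹ ≤
        ∫ z in (min a b)..(max a b), (β * greenFn s L b a ^ 2 * |b - a|)⁻¹ := by
      refine intervalIntegral.integral_mono_on min_le_max (P.intervalIntegrable_inv_density hmin hmax)
        (by simp) fun z hz => ?_
      exact inv_anti₀ (by positivity) (P.small z hz)
    rw [intervalIntegral.integral_const, smul_eq_mul, max_sub_min_eq_abs, ] at h4
    calc β * greenFn s L b a ^ 2 * (∫ z in (min a b)..(max a b), (density s L a b z)⁻¹)
        ≤ β * greenFn s L b a ^ 2 * (|b - a| * (β * greenFn s L b a ^ 2 * |b - a|)⁻¹) := by gcongr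
      _ = 1 := by field_simp
  calc β * greenFn s L b a ^ 2 * ‖h b - h a‖ ^ 2
      ≤ β * greenFn s L b a ^ 2 * ((∫ z in (min a b)..(max a b), (density s L a b z)⁻¹) *
        ∫ z in Ioo (-L) L, ‖h' z‖ ^ 2 * density s L a b z) := by gcongr
    _ = (β * greenFn s L b a ^ 2 * (∫ z in (min a b)..(max a b), (density s L a b z)⁻¹)) *
        ∫ z in Ioo (-L) L, ‖h' z‖ ^ 2 * density s L a b z := by ring
    _ ≤ 1 * ∫ z in Ioo (-L) L, ‖h' z‖ ^ 2 * density s L a b z := by gcongr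
    _ = _ := one_mul _

/-- The weighted Poincaré inequality for the density `G_a G_b`. -/
theorem exists_poincare (P : Principal L β μ a b s c) : ∃ D R : ℝ, 0 < D ∧ 0 < R ∧
    ∀ w h h' : ℝ → ℂ, IsQuotient L b s c w h h' →
      IntegrableOn (fun x => ‖h' x‖ ^ 2 * density s L a b x) (Ioo (-L) L) →
      ∫ x in Ioo (-L) L, ‖h x‖ ^ 2 * density s L a b x ≤
        D * (∫ x in Ioo (-L) L, ‖h' x‖ ^ 2 * density s L a b x) +
          ‖∫ x in Ioo (-L) L, h x * density s L a b x‖ ^ 2 / R := by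
  have hL := P.L_pos
  have h0 : (0 : ℝ) ∈ Ioo (-L) L := ⟨by linarith, hL⟩
  obtain ⟨D, hD, hD1, hD2⟩ := P.exists_density_mul_integral_le
  have iρ : IntegrableOn (density s L a b) (Ioo (-L) L) :=
    (P.continuous_density.continuousOn.integrableOn_Icc).mono_set Ioo_subset_Icc_self
  set R := ∫ x in Ioo (-L) L, density s L a b x with hR
  have hRpos : 0 < R := by
    refine (setIntegral_pos_iff_support_of_nonneg_ae ?_ iρ).2 ?_
    · filter_upwards [ae_restrict_mem measurableSet_Ioo] with x hx using (P.density_pos hx).le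
    · have : Function.support (density s L a b) ∩ Ioo (-L) L = Ioo (-L) L :=
        inter_eq_right.2 fun x hx => (P.density_pos hx).ne'
      rw [this, Real.volume_Ioo]
      simp [hL]
  refine ⟨D * (2 * L), R, by positivity, hRpos, fun w h h' q hi => ?_⟩
  set E := ∫ x in Ioo (-L) L, ‖h' x‖ ^ 2 * density s L a b x with hE
  have hE0 : 0 ≤ E :=
    setIntegral_nonneg measurableSet_Ioo fun z hz => mul_nonneg (sq_nonneg _) (P.density_pos hz).le
  set I := ∫ x in Ioo (-L) L, h x * density s L a b x with hI
  have hc := q.cont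
  have hρ := P.continuous_density
  have pt : ∀ x ∈ Ioo (-L) L, density s L a b x * ‖h x - h 0‖ ^ 2 ≤ D * E := by
    intro x hx
    have hρx := (P.density_pos hx).le
    rcases le_total 0 x with hx0 | hx0
    · have h1 := P.norm_sub_sq_le q hi h0 hx hx0
      calc density s L a b x * ‖h x - h 0‖ ^ 2 ≤ density s L a b x *
            ((∫ z in (0 : ℝ)..x, (density s L a b z)⁻¹) * E) := by gcongr
        _ = (density s L a b x * ∫ z in (0 : ℝ)..x, (density s L a b z)⁻¹) * E := by ring
        _ ≤ D * E := mul_le_mul_of_nonneg_right (hD1 x hx hx0) hE0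
    · have h1 := P.norm_sub_sq_le q hi hx h0 hx0
      rw [norm_sub_rev] at h1
      calc density s L a b x * ‖h x - h 0‖ ^ 2 ≤ density s L a b x *
            ((∫ z in x..0, (density s L a b z)⁻¹) * E) := by gcongr
        _ = (density s L a b x * ∫ z in x..0, (density s L a b z)⁻¹) * E := by ring
        _ ≤ D * E := mul_le_mul_of_nonneg_right (hD2 x hx hx0) hE0
  have ci : ∀ {F : ℝ → ℝ}, Continuous F → IntegrableOn F (Ioo (-L) L) := fun hF =>
    (hF.continuousOn.integrableOn_Icc).mono_set Ioo_subset_Icc_self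
  have iI : IntegrableOn (fun x => h x * density s L a b x) (Ioo (-L) L) := by
    have : Continuous fun x => h x * (density s L a b x : ℂ) := by fun_prop
    exact (this.continuousOn.integrableOn_Icc).mono_set Ioo_subset_Icc_self
  have s1 : ∫ x in Ioo (-L) L, density s L a b x * ‖h x - h 0‖ ^ 2 ≤ D * (2 * L) * E := by
    have := setIntegral_mono_on (ci (by fun_prop)) (integrableOn_const (by simp)) measurableSet_Ioo pt
    refine this.trans (le_of_eq ?_)
    rw [setIntegral_const, smul_eq_mul, Measure.real, Real.volume_Ioo,
      ENNReal.toReal_ofReal (by linarith)]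
    ring
  have s2 : ∫ x in Ioo (-L) L, ((starRingEnd ℂ) (h 0) * (h x * density s L a b x)).re =
      ((starRingEnd ℂ) (h 0) * I).re := by
    have := integral_re (iI.const_mul ((starRingEnd ℂ) (h 0)))
    simp only [RCLike.re_to_complex] at this
    rw [this, integral_const_mul]
  -- Expansion around h(0) instead of the weighted mean; completing the square then eliminates h(0)
  -- in favour of the integral I.
  have s3 : ∫ x in Ioo (-L) L, ‖h x‖ ^ 2 * density s L a b x =
      (∫ x in Ioo (-L) L, density s L a b x * ‖h x - h 0‖ ^ 2) +
        2 * ((starRingEnd ℂ) (h 0) * I).re - ‖h 0‖ ^ 2 * R := by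
    have i3 : IntegrableOn (fun x => density s L a b x * ‖h x - h 0‖ ^ 2 +
        2 * ((starRingEnd ℂ) (h 0) * (h x * density s L a b x)).re) (Ioo (-L) L) :=
      ci (by
        have := Complex.continuous_re
        fun_prop)
    have i4 : IntegrableOn (fun x => 2 * ((starRingEnd ℂ) (h 0) * (h x * density s L a b x)).re)
        (Ioo (-L) L) := ci (by
          have := Complex.continuous_re
          fun_prop)
    rw [← s2, hR, ← integral_const_mul, ← integral_const_mul,
      ← integral_add (ci (by fun_prop)) i4, ← integral_sub i3 (iρ.const_mul _)]
    refine integral_congr_ae (ae_of_all _ fun x => ?_)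
    simp only [← Complex.normSq_eq_norm_sq, Complex.normSq_apply, Complex.sub_re, Complex.sub_im,
      Complex.mul_re, Complex.mul_im, Complex.ofReal_re, Complex.ofReal_im, Complex.conj_re,
      Complex.conj_im]
    ring
  have s4 : 2 * ((starRingEnd ℂ) (h 0) * I).re ≤ ‖h 0‖ ^ 2 * R + ‖I‖ ^ 2 / R := by
    have t1 : ((starRingEnd ℂ) (h 0) * I).re ≤ ‖h 0‖ * ‖I‖ := by
      refine (Complex.re_le_norm _).trans ?_
      rw [norm_mul, RCLike.norm_conj]
    have t2 : ‖h 0‖ ^ 2 * R + ‖I‖ ^ 2 / R - 2 * (‖h 0‖ * ‖I‖) = (‖h 0‖ * R - ‖I‖) ^ 2 / R := by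
      field_simp
      ring
    have t3 : 0 ≤ (‖h 0‖ * R - ‖I‖) ^ 2 / R := by positivity
    linarith
  rw [s3]
  linarith

theorem continuous_energy (P : Principal L β μ a b s c) : Continuous P.energy := by
  unfold energy
  refine Complex.continuous_re.comp ?_
  fun_prop

theorem continuous_form (P : Principal L β μ a b s c) : Continuous P.form := by
  unfold form
  refine Continuous.add (Complex.continuous_re.comp (by fun_prop)) ?_
  refine continuous_const.mul (continuous_const.mul (Complex.continuous_re.comp ?_))
  have := Complex.continuous_conj
  fun_prop

/-- The spectral gap: the weighted form controls the weighted energy strictly better than `μ` off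
the annihilator of the adjoint ground state `ψ`. -/
theorem exists_gap (P : Principal L β μ a b s c) {ψ : H10 L}
    (hψ : ∀ x ∈ Ioo (-L) L, dirac L x ψ = greenFn s L a x) : ∃ γ C : ℝ, 0 < γ ∧ ∀ u : H10 L,
      (μ + γ) * P.energy (fn L u) ≤ P.form u + C * ‖emb L u ψ‖ ^ 2 := by
  obtain ⟨D, R, hD, hR, hp⟩ := P.exists_poincare
  refine ⟨(2 * D)⁻¹, (2 * D)⁻¹ / R, by positivity, fun u => ?_⟩
  have hc := P.continuous_energy
  have hf := P.continuous_form
  refine closure_induction (P := fun u => (μ + (2 * D)⁻¹) * P.energy (fn L u) ≤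
    P.form u + (2 * D)⁻¹ / R * ‖emb L u ψ‖ ^ 2) (isClosed_le (by fun_prop) (by fun_prop)) ?_ u
  intro u w h1 h2 h3 h4 h5
  obtain ⟨h, h', q⟩ := P.exists_quotient h1 h2 h3
  obtain ⟨g1, g2, g3⟩ := P.ground_state h1 h3 h4 h5 q
  -- The jump costs at most half of the Dirichlet integral E; the other half goes into the Poincaré
  -- inequality, whence γ = 1/(2D).
  have g4 := P.small_jump q g1
  have g5 := hp w h h' q g1
  have e1 : emb L u ψ = ∫ x in Ioo (-L) L, h x * density s L a b x := by
    rw [emb_apply]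
    refine integral_congr_ae ?_
    filter_upwards [h4, fn_ae_eq_dirac L ψ, ae_restrict_mem measurableSet_Ioo] with x k1 k2 k3
    rw [k1, k2, hψ x k3, q.mul x k3, density]
    push_cast
    ring
  rw [e1]
  change _ ≤ _
  have e2 : P.energy (fn L u) = ∫ x in Ioo (-L) L, ‖h x‖ ^ 2 * density s L a b x := g2
  rw [← e2] at g5
  set E := ∫ x in Ioo (-L) L, ‖h' x‖ ^ 2 * density s L a b x with hE
  change 2 * (P.form u - μ * P.energy (fn L u)) = 2 * E - _ at g3
  have g6 := mul_le_mul_of_nonneg_left g5 (show 0 ≤ (2 * D)⁻¹ by positivity)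
  have g7 : (2 * D)⁻¹ * (D * E + ‖∫ x in Ioo (-L) L, h x * density s L a b x‖ ^ 2 / R) =
      E / 2 + (2 * D)⁻¹ / R * ‖∫ x in Ioo (-L) L, h x * density s L a b x‖ ^ 2 := by
    field_simp
  rw [g7] at g6
  linarith

end Principal

end

section
/-! ### First eigenpairs -/

variable {L : ℝ}

theorem nonnegHm1_emb {u : H10 L} (hu : NonnegH10 u) : NonnegHm1 (emb L u) := fun _ hv =>
  mem_realCone_true.1 (pairing_mem_realCone (p := True) (fun x hx => mem_realCone_true.2 (hu x hx)) hv)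

theorem exists_re_im (hL : 0 < L) (u : H10 L) : ∃ v w : H10 L, u = v + Complex.I • w ∧
    ∀ x, dirac L x v = ((dirac L x u).re : ℂ) ∧ dirac L x w = ((dirac L x u).im : ℂ) := by
  obtain ⟨z, hz⟩ := exists_isConj hL u
  refine ⟨(1 / 2 : ℂ) • (u + z), (-Complex.I / 2) • (u - z), ?_, fun x => ⟨?_, ?_⟩⟩
  · rw [smul_smul]
    have : Complex.I * (-Complex.I / 2) = 1 / 2 := by
      linear_combination (-1 / 2 : ℂ) * Complex.I_mul_I
    rw [this]
    module
  · rw [map_smul, map_add, hz.dirac, Complex.re_eq_add_conj, smul_eq_mul]; ring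
  · rw [map_smul, map_sub, hz.dirac, Complex.im_eq_sub_conj, smul_eq_mul]
    have := Complex.I_ne_zero
    field_simp
    linear_combination -((dirac L x) u - (starRingEnd ℂ) ((dirac L x) u)) * Complex.I_mul_I

/-- A nonzero positive functional is strictly positive on strictly positive functions. -/
theorem pos_of_nonneg_of_ne_zero (hL : 0 < L) {f : Hm1 L} (hf : NonnegHm1 f) (hf0 : f ≠ 0) {ψ : H10 L}
    (hψ : PosH10 ψ) : 0 < f ψ := by
  have h1 : 0 ≤ f ψ := hf ψ fun x hx => (hψ x hx).le
  refine lt_of_le_of_ne h1 fun h0 => hf0 ?_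
  ext v
  refine closure_induction (P := fun v => f v = (0 : Hm1 L) v)
    (isClosed_eq (by fun_prop) (by fun_prop)) ?_ v
  intro v φ k1 k2 k3 k4 k5
  change f v = 0
  have hφ : ∀ x ∈ Ioo (-L) L, dirac L x v = φ x := fun x hx => dirac_test hx k1 k3 k5
  -- On its compact support a test function is dominated by a multiple of ψ; a positive functional
  -- vanishing at ψ therefore vanishes at all test functions.
  obtain ⟨C, hC⟩ : ∃ C : ℝ, ∀ x ∈ Ioo (-L) L, ‖φ x‖ ≤ C * (dirac L x ψ).re := by
    rcases (tsupport φ).eq_empty_or_nonempty with he | hne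
    · refine ⟨0, fun x _ => ?_⟩
      have : φ x = 0 := image_eq_zero_of_notMem_tsupport (by rw [he]; exact notMem_empty x)
      rw [this]
      simp
    obtain ⟨y, hy, hmin⟩ := k2.isCompact.exists_isMinOn hne
      (Complex.continuous_re.comp_continuousOn ((continuousOn_dirac L ψ).mono k3))
    obtain ⟨A, hA⟩ := k2.exists_bound_of_continuous k1.continuous
    have hm : 0 < (dirac L y ψ).re := (Complex.pos_iff.1 (hψ y (k3 hy))).1
    have hA0 := (norm_nonneg _).trans (hA 0)
    refine ⟨A / (dirac L y ψ).re, fun x hx => ?_⟩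
    by_cases hxs : x ∈ tsupport φ
    · have h2 : (dirac L y ψ).re ≤ (dirac L x ψ).re := hmin hxs
      rw [div_mul_eq_mul_div, le_div_iff₀ hm]
      exact mul_le_mul (hA x) h2 hm.le hA0
    · rw [image_eq_zero_of_notMem_tsupport hxs, norm_zero]
      have := (Complex.pos_iff.1 (hψ x hx)).1.le
      positivity
  have key : ∀ w : H10 L, (∀ x ∈ Ioo (-L) L, ∃ r : ℝ, dirac L x w = r ∧ |r| ≤ ‖φ x‖) → f w = 0 := by
    intro w hw
    have p1 : ∀ x ∈ Ioo (-L) L, ((dirac L x ψ).re : ℂ) = dirac L x ψ := fun x hx =>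
      Complex.ext rfl (by simpa using (Complex.pos_iff.1 (hψ x hx)).2)
    have a1 : 0 ≤ f ((C : ℂ) • ψ + w) := hf _ fun x hx => by
      obtain ⟨r, hr, hr'⟩ := hw x hx
      rw [map_add, map_smul, hr, ← p1 x hx, smul_eq_mul]
      have := (abs_le.1 (hr'.trans (hC x hx))).1
      exact_mod_cast (by linarith : 0 ≤ C * (dirac L x ψ).re + r)
    have a2 : 0 ≤ f ((C : ℂ) • ψ - w) := hf _ fun x hx => by
      obtain ⟨r, hr, hr'⟩ := hw x hx
      rw [map_sub, map_smul, hr, ← p1 x hx, smul_eq_mul]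
      have := (abs_le.1 (hr'.trans (hC x hx))).2
      exact_mod_cast (by linarith : 0 ≤ C * (dirac L x ψ).re - r)
    rw [map_add, map_smul, ← h0, smul_zero, zero_add] at a1
    rw [map_sub, map_smul, ← h0, smul_zero, zero_sub] at a2
    exact le_antisymm (neg_nonneg.1 a2) a1
  obtain ⟨p, q, hpq, hd⟩ := exists_re_im hL v
  have e1 : f p = 0 := key p fun x hx => ⟨(φ x).re, by rw [(hd x).1, hφ x hx], Complex.abs_re_le_norm _⟩
  have e2 : f q = 0 := key q fun x hx => ⟨(φ x).im, by rw [(hd x).2, hφ x hx], Complex.abs_im_le_norm _⟩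
  rw [hpq, map_add, map_smul, e1, e2, smul_zero, add_zero]

namespace Principal

variable {β μ a b : ℝ} {s c : ℝ → ℝ}

theorem inner_op_self (P : Principal L β μ a b s c) (f : LTwo L) :
    inner ℂ (P.isMultiplier_weight.op f) f = (P.energy f : ℂ) := by
  have toReal : ∀ F : ℝ → ℝ, ∫ x in Ioo (-L) L, (F x : ℂ) = ((∫ x in Ioo (-L) L, F x : ℝ) : ℂ) :=
    fun F => integral_ofReal
  rw [energy_eq, ← toReal, L2.inner_def]
  refine integral_congr_ae ?_
  filter_upwards [P.isMultiplier_weight.op_ae f] with x hx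
  rw [RCLike.inner_apply, hx, map_mul, Complex.conj_ofReal, mul_left_comm, Complex.mul_conj]
  push_cast
  rfl

theorem exists_energy_bounds (P : Principal L β μ a b s c) :
    ∃ m : ℝ, 0 < m ∧ ∀ f : LTwo L, m * ‖f‖ ^ 2 ≤ P.energy f := by
  have hL := P.L_pos
  obtain ⟨y, hy, hmin⟩ := isCompact_Icc.exists_isMinOn (nonempty_Icc.2 (by linarith : -L ≤ L))
    P.continuous_weight.continuousOn
  refine ⟨weight s L a b y, P.weight_pos y, fun f => ?_⟩
  have h1 : ‖f‖ ^ 2 = ∫ x in Ioo (-L) L, Complex.normSq (f x) := by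
    have := re_inner_eq f f
    rw [inner_self_eq_norm_sq_to_K] at this
    have e : (((‖f‖ : ℝ) : ℂ) ^ 2).re = ‖f‖ ^ 2 := by rw [← Complex.ofReal_pow, Complex.ofReal_re]
    rw [← e]
    refine Eq.trans this (integral_congr_ae (ae_of_all _ fun x => ?_))
    simp only [Complex.mul_conj, Complex.ofReal_re]
  have i1 : IntegrableOn (fun x => Complex.normSq (f x)) (Ioo (-L) L) := by
    refine (integrable_inner f f).congr (ae_of_all _ fun x => ?_)
    simp only [Complex.mul_conj, Complex.ofReal_re]
  have i2 : IntegrableOn (fun x => weight s L a b x * Complex.normSq (f x)) (Ioo (-L) L) := by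
    refine (integrable_inner (P.isMultiplier_weight.op f) f).congr ?_
    filter_upwards [P.isMultiplier_weight.op_ae f] with x hx
    rw [hx, map_mul, Complex.conj_ofReal, mul_left_comm, Complex.mul_conj, ← Complex.ofReal_mul,
      Complex.ofReal_re]
  rw [h1, energy_eq, ← integral_const_mul]
  refine setIntegral_mono_on (i1.const_mul _) i2 measurableSet_Ioo fun x hx => ?_
  exact mul_le_mul_of_nonneg_right (hmin (Ioo_subset_Icc_self hx)) (Complex.normSq_nonneg _)

/-- The element v is the weight times the conjugate of u; pairing with it expresses form and energy
through the operator and the embedding. -/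
theorem exists_dual (P : Principal L β μ a b s c) (u : H10 L) : ∃ v : H10 L,
    (∀ z, emb L z v = inner ℂ (P.isMultiplier_weight.op (fn L u)) (fn L z)) ∧
    (opA L u v + β * (dirac L a u * dirac L b v)).re = P.form u := by
  obtain ⟨z, hz⟩ := exists_isConj P.L_pos u
  obtain ⟨v, v1, v2⟩ := P.isMultiplier_weight.exists_mul P.L_pos z
  have e1 : wderiv L v = star (P.isMultiplier_weight.dop u) := by
    rw [v1]
    refine Lp.ext ?_
    filter_upwards [P.isMultiplier_weight.dop_ae z, P.isMultiplier_weight.dop_ae u,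
      Lp.coeFn_star (P.isMultiplier_weight.dop u), Lp.coeFn_star (wderiv L u), Lp.coeFn_star (fn L u)]
      with x k1 k2 k3 k4 k5
    rw [k1, k3, Pi.star_apply, k2, hz.wderiv, hz.fn, k4, k5]
    simp
  have e2 : fn L v = star (P.isMultiplier_weight.op (fn L u)) := by
    refine Lp.ext ?_
    filter_upwards [P.isMultiplier_weight.op_ae (fn L u), fn_ae_eq_dirac L v, fn_ae_eq_dirac L u,
      Lp.coeFn_star (P.isMultiplier_weight.op (fn L u)), ae_restrict_mem measurableSet_Ioo]
      with x k1 k2 k3 k4 k5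
    rw [k2, v2 x k5, hz.dirac, k4, Pi.star_apply, k1, k3]
    simp
  refine ⟨v, fun y => ?_, ?_⟩
  · rw [← pairing_star, ← e2]; rfl
  · have e3 : opA L u v = inner ℂ (P.isMultiplier_weight.dop u) (wderiv L u) := by
      rw [← pairing_star, ← e1]; rfl
    rw [e3, v2 b P.right_mem_Ioo, hz.dirac, form, Complex.add_re, mul_left_comm (dirac L a u),
      Complex.re_ofReal_mul, Complex.re_ofReal_mul]

/-- The Green function with pole b leaves the Wronskian times δ_b, which the eigenvalue equation
cancels against βG_b(a)δ_b. -/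
theorem exists_ground (P : Principal L β μ a b s c) : ∃ φ : H10 L,
    (∀ x ∈ Ioo (-L) L, dirac L x φ = greenFn s L b x) ∧ PosH10 φ ∧
    ∀ v, opA L φ v + β * (dirac L a φ * dirac L b v) = μ * emb L φ v := by
  obtain ⟨φ, h1, -, -, h2⟩ := P.pair.exists_green P.L_pos P.right_mem_Ioo
  refine ⟨φ, h1, fun x hx => ?_, fun v => ?_⟩
  · rw [h1 x hx]; exact_mod_cast P.green_right_pos hx
  · have h3 := h2 v
    have h4 : ((2 * s L * c L : ℝ) : ℂ) = -(β * greenFn s L b a) := by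
      exact_mod_cast (by linarith [P.eig] : 2 * s L * c L = -(β * greenFn s L b a))
    rw [h4] at h3
    rw [h1 a P.left_mem_Ioo]
    linear_combination h3

theorem ne_zero_of_pos (hL : 0 < L) {φ : H10 L} (h : PosH10 φ) : φ ≠ 0 := by
  rintro rfl
  have := h 0 ⟨by linarith, hL⟩
  simp at this

/-- An eigenfunction w for ν ≠ μ annihilates the adjoint ground state ψ; testing its equation with
the weighted conjugate of w turns the gap into Re ν ≥ μ + γ. For ν = μ the same estimate applied to
w minus its φ-component shows that this difference is zero. -/
theorem isFirstEigenpair (P : Principal L β μ a b s c) {B : H10 L →L[ℂ] Hm1 L}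
    (hB : ∀ u v, B u v = opA L u v + β * (dirac L a u * dirac L b v)) {φ : H10 L}
    (hφ : PosH10 φ) (hφ' : ∀ v, opA L φ v + β * (dirac L a φ * dirac L b v) = μ * emb L φ v) :
    IsFirstEigenpair B μ φ := by
  obtain ⟨ψ, ψ1, ψ2, ψ3⟩ := P.symm.exists_ground
  obtain ⟨γ, C, hγ, hgap⟩ := P.exists_gap ψ1
  obtain ⟨m, hm, hmb⟩ := P.exists_energy_bounds
  have hL := P.L_pos
  have hφ0 := ne_zero_of_pos hL hφ
  have hBφ : B φ = (μ : ℂ) • emb L φ := by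
    ext v
    rw [hB, hφ' v, smul_apply, smul_eq_mul]
  have hpair : emb L φ ψ ≠ 0 :=
    (pos_of_nonneg_of_ne_zero hL (nonnegHm1_emb fun x hx => (hφ x hx).le)
      (fun h => hφ0 (emb_injective L (h.trans (map_zero _).symm))) ψ2).ne'
  have horth : ∀ (ν : ℂ) w, B w = ν • emb L w → ν ≠ μ → emb L w ψ = 0 := by
    intro ν w hw hν
    have h1 := congrArg (fun g : Hm1 L => g ψ) hw
    simp only [hB, smul_apply, smul_eq_mul] at h1
    have h2 := ψ3 w
    rw [opA_comm, emb_comm] at h2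
    have h3 : (ν - μ) * emb L w ψ = 0 := by linear_combination h2 - h1
    exact (mul_eq_zero.1 h3).resolve_left (sub_ne_zero.2 hν)
  have hlow : ∀ (ν : ℂ) w, B w = ν • emb L w → emb L w ψ = 0 → w ≠ 0 → μ + γ ≤ ν.re := by
    intro ν w hw ho hw0
    obtain ⟨v, v1, v2⟩ := P.exists_dual w
    have h1 := hgap w
    rw [ho, norm_zero] at h1
    rw [← v2, ← hB, hw, smul_apply, v1, P.inner_op_self, smul_eq_mul, Complex.re_mul_ofReal] at h1
    have h2 : 0 < P.energy (fn L w) := by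
      have : 0 < ‖fn L w‖ := norm_pos_iff.2 fun h => hw0 (fn_injective L (h.trans (map_zero _).symm))
      exact lt_of_lt_of_le (by positivity) (hmb _)
    refine le_of_mul_le_mul_right ?_ h2
    linarith
  refine ⟨⟨hφ0, hBφ⟩, fun w hw => ?_, fun ν w hw hν => ?_⟩
  · refine ⟨emb L w ψ / emb L φ ψ, ?_⟩
    by_contra hne
    have h1 := hlow μ (w - (emb L w ψ / emb L φ ψ) • φ) (by
      rw [map_sub, map_sub, map_smul, map_smul, hw.2, hBφ]; module) (by
      rw [map_sub, map_smul, sub_apply, smul_apply, smul_eq_mul, div_mul_cancel₀ _ hpair,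
        sub_self]) (sub_ne_zero.2 hne)
    rw [Complex.ofReal_re] at h1
    linarith
  · have h1 := hlow ν w hw.2 (horth ν w hw.2 hν) hw.1
    rw [Complex.ofReal_re]
    linarith

end Principal

end

section
/-! ### Eventual positivity -/

variable {L : ℝ}

/-- One of the two factors is controlled by the distance of y to the nearer endpoint, the other is
bounded; the estimate is uniform in x. -/
theorem greenFn_le {ν : ℝ} {s c : ℝ → ℝ} (h : SinePair ν s c) (hL : 0 < L)
    (hpos : ∀ y, 0 < y → y ≤ 2 * L → 0 < s y) : ∃ C : ℝ, 0 < C ∧ ∀ x ∈ Ioo (-L) L, ∀ y ∈ Ioo (-L) L,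
      0 ≤ greenFn s L y x ∧ greenFn s L y x ≤ C * (L - |y|) := by
  obtain ⟨k, K, hk, hK, hb⟩ := h.exists_linear_bounds (R := 2 * L) (by positivity) hpos
  refine ⟨K * K * (2 * L), by positivity, fun x hx y hy => ?_⟩
  have p1 : 0 < L + min x y := by linarith [lt_min hx.1 hy.1]
  have p2 : 0 < L - max x y := by linarith [max_lt hx.2 hy.2]
  have q1 : L + min x y ≤ 2 * L := by linarith [(min_le_right x y).trans hy.2.le]
  have q2 : L - max x y ≤ 2 * L := by linarith [hy.1.le.trans (le_max_right x y)]
  obtain ⟨b1, b2⟩ := hb _ p1.le q1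
  obtain ⟨b3, b4⟩ := hb _ p2.le q2
  have s1 := hpos _ p1 q1
  have s2 := hpos _ p2 q2
  refine ⟨(mul_pos s1 s2).le, ?_⟩
  have e : (L + min x y) * (L - max x y) ≤ 2 * L * (L - |y|) := by
    rcases le_total y 0 with h0 | h0
    · rw [abs_of_nonpos h0, mul_comm]
      exact mul_le_mul q2 (by linarith [min_le_right x y]) p1.le (by linarith)
    · rw [abs_of_nonneg h0]
      exact mul_le_mul q1 (by linarith [le_max_right x y]) p2.le (by linarith)
  calc greenFn s L y x ≤ (K * (L + min x y)) * (K * (L - max x y)) :=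
        mul_le_mul b2 b4 s2.le (by positivity)
    _ = K * K * ((L + min x y) * (L - max x y)) := by ring
    _ ≤ K * K * (2 * L * (L - |y|)) := by gcongr
    _ = _ := by ring

/-- The equation reads (A_{L,β} + 1)u = z + u, so u is given by the sinh Green functions, which
vanish linearly at the boundary. For β ≥ 0 the factor W + βG_a(b) is at least W, which bounds u(a).
-/
theorem exists_pointwise_bound (hL : 0 < L) {β : ℝ} (hβ : 0 ≤ β) {a b : ℝ} (ha : a ∈ Ioo (-L) L)
    (hb : b ∈ Ioo (-L) L) : ∃ C : ℝ, ∀ u z : H10 L,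
      (∀ v, opA L u v + β * (dirac L a u * dirac L b v) = emb L z v) →
      ∀ y ∈ Ioo (-L) L, ‖dirac L y u‖ ≤ C * (L - |y|) * (‖fn L u‖ + ‖fn L z‖) := by
  have hs := sinePair_sinh (one_ne_zero (α := ℝ))
  simp only [one_mul, div_one, one_pow] at hs
  have hspos : ∀ y, 0 < y → y ≤ 2 * L → 0 < Real.sinh y := fun y hy _ => Real.sinh_pos_iff.2 hy
  obtain ⟨K, hK, hG⟩ := greenFn_le hs hL hspos
  set W := 2 * Real.sinh L * Real.cosh L with hW
  have hWpos : 0 < W := by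
    have := Real.sinh_pos_iff.2 hL
    have := Real.cosh_pos L
    positivity
  set D := K * ‖one L‖ with hD
  have hD0 : 0 ≤ D := by positivity
  have hemb : ∀ (g G : H10 L) (y : ℝ), y ∈ Ioo (-L) L →
      (∀ x ∈ Ioo (-L) L, dirac L x G = greenFn Real.sinh L y x) →
      ‖emb L g G‖ ≤ D * (L - |y|) * ‖fn L g‖ := by
    intro g G y hy hGy
    have hd : 0 ≤ L - |y| := (sub_pos.2 (abs_lt.2 hy)).le
    rw [emb_apply]
    refine (norm_integral_le_integral_norm _).trans ?_
    have i1 := integrable_norm_mul_norm (fn L g) (one L)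
    have h1 : ∫ x in Ioo (-L) L, ‖fn L g x * fn L G x‖ ≤
        ∫ x in Ioo (-L) L, K * (L - |y|) * (‖fn L g x‖ * ‖one L x‖) := by
      refine integral_mono_ae ?_ (i1.const_mul _) ?_
      · refine (integrable_norm_mul_norm (fn L g) (fn L G)).congr (ae_of_all _ fun x => ?_)
        simp only [norm_mul]
      · filter_upwards [one_ae L, fn_ae_eq_dirac L G, ae_restrict_mem measurableSet_Ioo] with x k1 k2 k3
        obtain ⟨g1, g2⟩ := hG x k3 y hy
        simp only [norm_mul]
        rw [k1, k2, hGy x k3, norm_one, mul_one, Complex.norm_real, Real.norm_of_nonneg g1, mul_comm]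
        gcongr
    refine h1.trans ?_
    rw [integral_const_mul]
    have := mul_le_mul_of_nonneg_left (integral_norm_mul_norm_le (fn L g) (one L))
      (mul_nonneg hK.le hd)
    rw [hD]
    linarith
  refine ⟨W⁻¹ * (D + β * (W⁻¹ * (D * L)) * K), fun u z h y hy => ?_⟩
  have hu : ∀ v, opA L u v + β * (dirac L a u * dirac L b v) - (-1 : ℝ) * emb L u v =
      emb L (z + u) v := fun v => by
    rw [h v, map_add, add_apply]; push_cast; ring
  have hg : ‖fn L (z + u)‖ ≤ ‖fn L u‖ + ‖fn L z‖ := by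
    rw [map_add, add_comm ‖fn L u‖]; exact norm_add_le _ _
  set N := ‖fn L u‖ + ‖fn L z‖ with hN
  have hd : ∀ y ∈ Ioo (-L) L, 0 ≤ L - |y| := fun y hy => (sub_pos.2 (abs_lt.2 hy)).le
  have hN0 : 0 ≤ N := by positivity
  have ha' : ‖dirac L a u‖ ≤ W⁻¹ * (D * L) * N := by
    obtain ⟨G, g1, g2⟩ := green_representation hs hL hb hu ha
    have e1 := hemb (z + u) G a ha g1
    have e2 : ((W + β * greenFn Real.sinh L a b : ℝ) : ℂ) * dirac L a u = emb L (z + u) G := by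
      push_cast
      linear_combination g2
    rw [← e2, norm_mul, Complex.norm_real] at e1
    have e3 : W ≤ ‖W + β * greenFn Real.sinh L a b‖ := by
      have := mul_nonneg hβ (hG b hb a ha).1
      rw [Real.norm_of_nonneg (by linarith)]
      linarith
    have e4 : D * (L - |a|) * ‖fn L (z + u)‖ ≤ D * L * N := by
      have := hd a ha
      gcongr
      linarith [abs_nonneg a]
    have e5 := (mul_le_mul_of_nonneg_right e3 (norm_nonneg (dirac L a u))).trans (e1.trans e4)
    rw [mul_assoc, ← div_eq_inv_mul, le_div_iff₀ hWpos]
    linarith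
  obtain ⟨G, g1, g2⟩ := green_representation hs hL hb hu hy
  have e1 := hemb (z + u) G y hy g1
  have e2 : W * ‖dirac L y u‖ ≤ D * (L - |y|) * N + β * (W⁻¹ * (D * L) * N) * (K * (L - |y|)) := by
    have := congrArg norm g2
    rw [norm_mul, Complex.norm_real, Real.norm_of_nonneg hWpos.le] at this
    rw [this]
    refine (norm_sub_le _ _).trans (add_le_add (e1.trans ?_) ?_)
    · have := hd y hy
      gcongr
    · rw [norm_mul, norm_mul, Complex.norm_real, Complex.norm_real, Real.norm_of_nonneg hβ,
        Real.norm_of_nonneg (hG b hb y hy).1]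
      have := (hG b hb y hy).1
      have := (hG b hb y hy).2
      have := hd y hy
      gcongr
  have e3 : ‖dirac L y u‖ ≤ W⁻¹ *
      (D * (L - |y|) * N + β * (W⁻¹ * (D * L) * N) * (K * (L - |y|))) := by
    rw [← div_eq_inv_mul, le_div_iff₀ hWpos, mul_comm]
    exact e2
  refine e3.trans (le_of_eq ?_)
  ring

namespace Principal

variable {β μ a b : ℝ} {s c : ℝ → ℝ}

theorem inner_op_comm (P : Principal L β μ a b s c) (f g : LTwo L) :
    inner ℂ (P.isMultiplier_weight.op f) g = inner ℂ f (P.isMultiplier_weight.op g) := by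
  rw [L2.inner_def, L2.inner_def]
  refine integral_congr_ae ?_
  filter_upwards [P.isMultiplier_weight.op_ae f, P.isMultiplier_weight.op_ae g] with x h1 h2
  rw [RCLike.inner_apply, RCLike.inner_apply, h1, h2, map_mul, Complex.conj_ofReal]
  ring

theorem hasDerivAt_energy (P : Principal L β μ a b s c) {f : ℝ → LTwo L} {f' : LTwo L} {t : ℝ}
    (hf : HasDerivAt f f' t) : HasDerivAt (fun t => P.energy (f t))
      (2 * (inner ℂ (P.isMultiplier_weight.op (f t)) f').re) t := by
  have h1 : HasDerivAt (fun t => P.isMultiplier_weight.op (f t)) (P.isMultiplier_weight.op f') t :=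
    ((P.isMultiplier_weight.op.restrictScalars ℝ).hasFDerivAt.comp_hasDerivAt t hf)
  have h2 := h1.inner ℂ hf
  have h3 := Complex.reCLM.hasFDerivAt.comp_hasDerivAt t h2
  refine h3.congr_deriv ?_
  rw [P.inner_op_comm f', ← inner_conj_symm f']
  simp only [Complex.reCLM_apply, Complex.add_re, Complex.conj_re]
  ring

/-- Orbits of the parabolic equation annihilating `ψ` decay faster than `e^{-μ t}`. -/
theorem exists_decay (P : Principal L β μ a b s c) {ψ : H10 L}
    (hψ : ∀ x ∈ Ioo (-L) L, dirac L x ψ = greenFn s L a x) : ∃ γ : ℝ, 0 < γ ∧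
      ∀ r r' : ℝ → H10 L, (∀ t, 0 < t → HasDerivAt r (r' t) t) →
        (∀ t, 0 < t → ∀ v, opA L (r t) v + β * (dirac L a (r t) * dirac L b v) = -emb L (r' t) v) →
        (∀ t, 0 < t → emb L (r t) ψ = 0) →
        ∃ C : ℝ, ∀ t, 1 ≤ t → ‖fn L (r t)‖ ≤ C * Real.exp (-(μ + γ) * t) := by
  obtain ⟨γ, C₀, hγ, hgap⟩ := P.exists_gap hψ
  obtain ⟨m, hm, hmb⟩ := P.exists_energy_bounds
  refine ⟨γ, hγ, fun r r' hr hA ho => ?_⟩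
  set E : ℝ → ℝ := fun t => P.energy (fn L (r t)) with hE
  have hEd : ∀ t, 0 < t → HasDerivAt E (-2 * P.form (r t)) t := by
    intro t ht
    have h1 : HasDerivAt (fun t => fn L (r t)) (fn L (r' t)) t :=
      ((fn L).restrictScalars ℝ).hasFDerivAt.comp_hasDerivAt t (hr t ht)
    refine (P.hasDerivAt_energy h1).congr_deriv ?_
    obtain ⟨v, v1, v2⟩ := P.exists_dual (r t)
    rw [← v1, ← v2, hA t ht, Complex.neg_re]
    ring
  have hd : ∀ t, 0 < t → HasDerivAt (fun t => E t * Real.exp (2 * (μ + γ) * t))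
      ((-2 * P.form (r t)) * Real.exp (2 * (μ + γ) * t) +
        E t * (Real.exp (2 * (μ + γ) * t) * (2 * (μ + γ)))) t := by
    intro t ht
    have h1 : HasDerivAt (fun t => 2 * (μ + γ) * t) (2 * (μ + γ)) t := by
      simpa using (hasDerivAt_id t).const_mul (2 * (μ + γ))
    exact (hEd t ht).mul h1.exp
  -- E' = −2·form, and the gap on the annihilator of ψ gives form ≥ (μ + γ)E. Time 1 is an arbitrary
  -- positive start, since nothing is assumed at t = 0.
  have hanti : AntitoneOn (fun t => E t * Real.exp (2 * (μ + γ) * t)) (Ici 1) := by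
    have hpos : ∀ t ∈ Ici (1 : ℝ), 0 < t := fun t ht => one_pos.trans_le ht
    refine antitoneOn_of_deriv_nonpos (convex_Ici 1)
      (fun t ht => (hd t (hpos t ht)).continuousAt.continuousWithinAt) (fun t ht => ?_) fun t ht => ?_
    · exact (hd t (hpos t (interior_subset ht))).differentiableAt.differentiableWithinAt
    · have ht0 := hpos t (interior_subset ht)
      rw [(hd t ht0).deriv]
      have h1 := hgap (r t)
      rw [ho t ht0, norm_zero] at h1
      have h2 := Real.exp_pos (2 * (μ + γ) * t)
      have h3 : (μ + γ) * E t - P.form (r t) ≤ 0 := by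
        have : (0 : ℝ) ^ 2 = 0 := by norm_num
        rw [this, mul_zero, add_zero] at h1
        linarith
      nlinarith
  set E1 := E 1 * Real.exp (2 * (μ + γ) * 1) with hE1
  refine ⟨√(E1 / m), fun t ht => ?_⟩
  have h1 : E t * Real.exp (2 * (μ + γ) * t) ≤ E1 := hanti self_mem_Ici ht ht
  have h2 : m * ‖fn L (r t)‖ ^ 2 ≤ E t := hmb _
  have h3 : 0 ≤ E1 := le_trans (mul_nonneg (le_trans (by positivity) h2) (Real.exp_pos _).le) h1
  refine abs_le_of_sq_le_sq' ?_ (by positivity) |>.2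
  rw [mul_pow, Real.sq_sqrt (by positivity), ← Real.exp_nat_mul]
  have h4 : Real.exp (((2 : ℕ) : ℝ) * (-(μ + γ) * t)) * Real.exp (2 * (μ + γ) * t) = 1 := by
    rw [← Real.exp_add, ← Real.exp_zero]
    congr 1
    push_cast
    ring
  have h5 : 0 < Real.exp (((2 : ℕ) : ℝ) * (-(μ + γ) * t)) := Real.exp_pos _
  rw [div_mul_eq_mul_div, le_div_iff₀ hm]
  calc ‖fn L (r t)‖ ^ 2 * m = m * ‖fn L (r t)‖ ^ 2 := mul_comm _ _
    _ ≤ E t := h2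
    _ = (E t * Real.exp (2 * (μ + γ) * t)) * Real.exp (((2 : ℕ) : ℝ) * (-(μ + γ) * t)) := by
        rw [mul_assoc, mul_comm (Real.exp (2 * (μ + γ) * t)), h4, mul_one]
    _ ≤ E1 * Real.exp (((2 : ℕ) : ℝ) * (-(μ + γ) * t)) := by gcongr

end Principal

end

/-! ### Asymptotics of the semigroup and individual eventual positivity -/

section
variable {L x₀ : ℝ}

/-- As ψ is an adjoint eigenfunction, e^{μt} times the pairing of the orbit with ψ has derivative
zero, and its limit at t = 0 is f(ψ). -/
theorem heat_apply_adjoint (hL : 0 < L) (hx : x₀ ∈ Ioo (-L) L) {β μ : ℝ} {ψ : H10 L}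
    (hψ : ∀ u, opAβ L x₀ β u ψ = μ * emb L u ψ) (f : Hm1 L) {t : ℝ} (ht : 0 < t) :
    emb L (orbit (V := H10 L) (X := Hm1 L) (res L x₀ β) (|β| + 1) 0 (t : ℂ) f) ψ =
      Real.exp (-μ * t) * f ψ := by
  have P := parabolicResolvent hL hx β
  set u : ℕ → ℝ → H10 L := fun n t =>
    orbit (V := H10 L) (X := Hm1 L) (res L x₀ β) (|β| + 1) n (t : ℂ) f with hu
  change emb L (u 0 t) ψ = _
  have hd : ∀ t, 0 < t → HasDerivAt (fun t => (Real.exp (μ * t) : ℂ) * emb L (u 0 t) ψ) 0 t := by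
    intro t ht
    have h1 : HasDerivAt (fun t => emb L (u 0 t) ψ) (emb L (u 1 t) ψ) t :=
      (((emb L).flip ψ).restrictScalars ℝ).hasFDerivAt.comp_hasDerivAt t (P.hasDerivAt_orbit_real 0 ht f)
    have h2 : HasDerivAt (fun t => μ * t) μ t := by simpa using (hasDerivAt_id t).const_mul μ
    have h3 := (h2.exp.ofReal_comp).mul h1
    refine h3.congr_deriv ?_
    have h4 : opAβ L x₀ β (u 0 t) = -emb L (u 1 t) := P.A_orbit 0 ht f
    have h5 := hψ (u 0 t)
    rw [h4, neg_apply] at h5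
    push_cast
    linear_combination -Complex.exp (μ * t) * h5
  have hconst : ∀ ε, 0 < ε → ε ≤ t → (Real.exp (μ * t) : ℂ) * emb L (u 0 t) ψ =
      (Real.exp (μ * ε) : ℂ) * emb L (u 0 ε) ψ := fun ε h0 h1 =>
    constant_of_has_deriv_right_zero
      (fun z hz => (hd z (h0.trans_le hz.1)).continuousAt.continuousWithinAt)
      (fun z hz => (hd z (h0.trans_le hz.1)).hasDerivWithinAt) t ⟨h1, le_rfl⟩
  have hlim : Tendsto (fun ε : ℝ => (Real.exp (μ * ε) : ℂ) * emb L (u 0 ε) ψ) (𝓝[>] 0) (𝓝 (f ψ)) := by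
    have h1 : Continuous fun ε : ℝ => (Real.exp (μ * ε) : ℂ) * heat L x₀ β ε.toNNReal f ψ := by
      have h2 : Continuous fun ε : ℝ => heat L x₀ β ε.toNNReal f :=
        ((isAnalyticSemigroup_heat hL hx β).continuous f).comp continuous_real_toNNReal
      fun_prop
    have h3 := (h1.tendsto 0).mono_left (nhdsWithin_le_nhds (s := Ioi 0))
    rw [Real.toNNReal_zero, (isAnalyticSemigroup_heat hL hx β).map_zero, mul_zero, Real.exp_zero,
      Complex.ofReal_one, one_mul] at h3
    refine h3.congr' ?_
    filter_upwards [self_mem_nhdsWithin] with ε hε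
    have hε' : (0 : ℝ) < ε := hε
    have h4 := P.j_orbit_zero (t := ε.toNNReal) (by simpa using hε') f
    rw [Real.coe_toNNReal _ hε'.le] at h4
    rw [heat, ← h4]
  have h : (Real.exp (μ * t) : ℂ) * emb L (u 0 t) ψ = f ψ := by
    refine tendsto_nhds_unique (tendsto_const_nhds.congr' ?_) hlim
    filter_upwards [Ioc_mem_nhdsGT ht] with ε hε using hconst ε hε.1 hε.2
  rw [← h, ← mul_assoc, ← Complex.ofReal_mul, ← Real.exp_add]
  simp

/-- The component d e^{-μt}φ is bounded below by a multiple of e^{-μt} times the distance to the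
boundary, the remainder above by a faster decaying multiple of the same. The waiting time depends on
f through d and through the size of the remainder at time 1. -/
theorem isIndividuallyEventuallyPositive_heat (hx₀ : 0 < x₀) (hL : x₀ < L) {β μ : ℝ} (hβ : 0 ≤ β)
    {s c : ℝ → ℝ} (Q : Principal L β μ x₀ 0 s c) :
    IsIndividuallyEventuallyPositive (heat L x₀ β) := by
  intro f hf
  rcases eq_or_ne f 0 with rfl | hf0
  · exact ⟨0, fun t _ v _ => by simp⟩
  have hL0 : 0 < L := hx₀.trans hL
  have hx : x₀ ∈ Ioo (-L) L := Q.left_mem_Ioo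
  have h0 : (0 : ℝ) ∈ Ioo (-L) L := Q.right_mem_Ioo
  have P := parabolicResolvent hL0 hx β
  obtain ⟨φ, φ1, φ2, φ3⟩ := Q.exists_ground
  obtain ⟨ψ, ψ1, ψ2, ψ3⟩ := Q.symm.exists_ground
  obtain ⟨k, K, hk, -, hφb⟩ := Q.exists_green_bounds
  obtain ⟨γ, hγ, hdecay⟩ := Q.exists_decay ψ1
  obtain ⟨C, hC⟩ := exists_pointwise_bound hL0 hβ hx h0
  have hφA : opAβ L x₀ β φ = (μ : ℂ) • emb L φ := by
    ext v; rw [opAβ_apply, φ3 v, smul_apply, smul_eq_mul]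
  have hψA : ∀ u, opAβ L x₀ β u ψ = μ * emb L u ψ := fun u => by
    rw [opAβ_apply, opA_comm, emb_comm, ← ψ3 u]
    ring
  have hpair : 0 < emb L φ ψ := pos_of_nonneg_of_ne_zero hL0 (nonnegHm1_emb fun x hx => (φ2 x hx).le)
    (fun h => Principal.ne_zero_of_pos hL0 φ2 (emb_injective L (h.trans (map_zero _).symm))) ψ2
  have hfψ : 0 < f ψ := pos_of_nonneg_of_ne_zero hL0 hf hf0 ψ2
  -- The coefficient of the spectral projection of f; d > 0 because ψ is strictly positive and f is
  -- positive and nonzero.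
  obtain ⟨d, hd0, hd⟩ : ∃ d : ℝ, 0 < d ∧ f ψ = d * emb L φ ψ := by
    rw [Complex.pos_iff] at hpair hfψ
    refine ⟨(f ψ).re / (emb L φ ψ).re, div_pos hfψ.1 hpair.1, Complex.ext ?_ ?_⟩
    · rw [Complex.re_ofReal_mul, div_mul_cancel₀ _ hpair.1.ne']
    · rw [Complex.im_ofReal_mul, ← hpair.2, mul_zero, ← hfψ.2]
  set u : ℕ → ℝ → H10 L := fun n t =>
    orbit (V := H10 L) (X := Hm1 L) (res L x₀ β) (|β| + 1) n (t : ℂ) f with hu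
  -- Here r n is the n-th time derivative of the orbit minus that of d e^{-μt}φ.
  set r : ℕ → ℝ → H10 L := fun n t => u n t - (((-μ) ^ n * d * Real.exp (-μ * t) : ℝ) : ℂ) • φ with hr
  have hrd : ∀ n t, 0 < t → HasDerivAt (r n) (r (n + 1) t) t := by
    intro n t ht
    have h1 : HasDerivAt (fun t => -μ * t) (-μ) t := by simpa using (hasDerivAt_id t).const_mul (-μ)
    have h2 := ((h1.exp.const_mul ((-μ) ^ n * d)).ofReal_comp).smul_const φ
    refine ((P.hasDerivAt_orbit_real n ht f).sub h2).congr_deriv ?_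
    simp only [hr, hu]
    congr 3
    ring
  have hrA : ∀ n t, 0 < t → ∀ v,
      opA L (r n t) v + β * (dirac L x₀ (r n t) * dirac L 0 v) = -emb L (r (n + 1) t) v := by
    intro n t ht v
    rw [← opAβ_apply, ← neg_apply]
    congr 1
    have h1 : opAβ L x₀ β (u n t) = -emb L (u (n + 1) t) := P.A_orbit n ht f
    simp only [hr, map_sub, map_smul, h1, hφA]
    have h2 : (((-μ) ^ (n + 1) * d * Real.exp (-μ * t) : ℝ) : ℂ) =
        -((((-μ) ^ n * d * Real.exp (-μ * t) : ℝ) : ℂ) * μ) := by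
      push_cast
      ring
    rw [h2, smul_smul]
    module
  have hro0 : ∀ t, 0 < t → emb L (r 0 t) ψ = 0 := by
    intro t ht
    have h1 : emb L (u 0 t) ψ = _ := heat_apply_adjoint hL0 hx hψA f ht
    simp only [hr, map_sub, map_smul, sub_apply, smul_apply, h1, hd, smul_eq_mul]
    push_cast
    ring
  -- The derivative must decay as well: the pointwise bound for r 0 involves its image under A,
  -- which is −r 1.
  have hro1 : ∀ t, 0 < t → emb L (r 1 t) ψ = 0 := by
    intro t ht
    have h1 := hrA 0 t ht ψ
    rw [← opAβ_apply, hψA, hro0 t ht, mul_zero] at h1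
    exact neg_eq_zero.1 h1.symm
  obtain ⟨C0, hC0⟩ := hdecay (r 0) (r 1) (hrd 0) (hrA 0) hro0
  obtain ⟨C1, hC1⟩ := hdecay (r 1) (r 2) (hrd 1) (hrA 1) hro1
  -- the remainder is eventually dominated by the leading term
  have hev : ∀ᶠ t : ℝ in atTop, |C| * (C0 + C1) * Real.exp (-γ * t) ≤ d * k := by
    have h1 : Tendsto (fun t : ℝ => -γ * t) atTop atBot := by
      have := tendsto_id.const_mul_atTop_of_neg (neg_lt_zero.2 hγ) (l := atTop (α := ℝ))
      simpa using this
    have h2 := (Real.tendsto_exp_atBot.comp h1).const_mul (|C| * (C0 + C1))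
    rw [mul_zero] at h2
    exact (h2.eventually (gt_mem_nhds (mul_pos hd0 hk))).mono fun t ht => le_of_lt ht
  obtain ⟨t₁, ht₁⟩ := eventually_atTop.1 hev
  refine ⟨(max t₁ 1).toNNReal, fun t ht v hv => ?_⟩
  have ht' : max t₁ 1 ≤ (t : ℝ) := (Real.toNNReal_le_iff_le_coe).1 ht
  have ht1 : (1 : ℝ) ≤ t := (le_max_right _ _).trans ht'
  have ht0 : (0 : ℝ) < t := by linarith
  -- Reality holds for all times and every β; only the sign of the real part needs large times.
  have hreal := heat_mem_realCone hx₀ hL (p := False) (β := β) (fun h => h.elim) (f := f)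
    (fun v hv => mem_realCone_of_nonneg (hf v hv)) t v hv
  have hT : heat L x₀ β t f = emb L (u 0 t) := (P.j_orbit_zero (by exact_mod_cast ht0) f).symm
  have hpos : ∀ x ∈ Ioo (-L) L, 0 ≤ (dirac L x (u 0 t)).re := by
    intro x hx'
    have hdx : 0 ≤ L - |x| := (sub_pos.2 (abs_lt.2 hx')).le
    have e1 : u 0 t = r 0 t + ((d * Real.exp (-μ * t) : ℝ) : ℂ) • φ := by
      simp only [hr, pow_zero, one_mul, sub_add_cancel]
    have e2 : ‖dirac L x (r 0 t)‖ ≤ C * (L - |x|) * (‖fn L (r 0 t)‖ + ‖fn L (-r 1 t)‖) :=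
      hC (r 0 t) (-r 1 t) (fun v => by rw [hrA 0 t ht0, map_neg, neg_apply]) x hx'
    rw [map_neg, norm_neg] at e2
    have e3 := hC0 t ht1
    have e4 := hC1 t ht1
    have e5 : ‖dirac L x (r 0 t)‖ ≤ |C| * (L - |x|) *
        (C0 * Real.exp (-(μ + γ) * t) + C1 * Real.exp (-(μ + γ) * t)) := by
      refine e2.trans ?_
      gcongr
      exact le_abs_self C
    have e6 : Real.exp (-(μ + γ) * t) = Real.exp (-γ * t) * Real.exp (-μ * t) := by
      rw [← Real.exp_add]; congr 1; ring
    have e7 := ht₁ t ((le_max_left _ _).trans ht')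
    have e8 := (abs_le.1 ((Complex.abs_re_le_norm _).trans e5)).1
    have e9 := (hφb x hx').1
    rw [e1, map_add, map_smul, φ1 x hx', smul_eq_mul, Complex.add_re, Complex.re_ofReal_mul,
      Complex.ofReal_re]
    rw [e6] at e8
    have e10 : |C| * (C0 + C1) * Real.exp (-γ * t) * ((L - |x|) * Real.exp (-μ * t)) ≤
        d * k * ((L - |x|) * Real.exp (-μ * t)) :=
      mul_le_mul_of_nonneg_right e7 (by positivity)
    have e11 : d * Real.exp (-μ * t) * (k * (L - |x|)) ≤ d * Real.exp (-μ * t) * greenFn s L 0 x :=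
      mul_le_mul_of_nonneg_left e9 (by positivity)
    linarith
  rw [Complex.nonneg_iff]
  refine ⟨?_, hreal.1.symm⟩
  rw [hT, emb_apply]
  have i1 : IntegrableOn (fun x => fn L (u 0 t) x * fn L v x) (Ioo (-L) L) := by
    have h1 : MemLp (fun x => fn L (u 0 t) x * fn L v x) 1 (volume.restrict (Ioo (-L) L)) :=
      (Lp.memLp (fn L v)).mul (Lp.memLp (fn L (u 0 t)))
    exact h1.integrable le_rfl
  have h2 := integral_re i1
  simp only [RCLike.re_to_complex] at h2
  rw [← h2]
  refine integral_nonneg_of_ae ?_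
  filter_upwards [fn_ae_eq_dirac L (u 0 t), fn_ae_eq_dirac L v, ae_restrict_mem measurableSet_Ioo]
    with x k1 k2 k3
  have h4 := Complex.nonneg_iff.1 (hv x k3)
  rw [k1, k2, Pi.zero_apply, Complex.mul_re, ← h4.2, mul_zero, sub_zero]
  exact mul_nonneg (hpos x k3) h4.1

end

section
/-! ### Existence of the principal eigenvalue -/

variable {L x₀ β : ℝ}

/-- Since G_0(x₀) = s(L)s(L − x₀), the factor s(L) splits off the eigenvalue equation, and s(L)s(L −
x₀) splits off both sides of the smallness condition. -/
theorem Principal.of_root (hx₀ : 0 < x₀) (hL : x₀ < L) {μ : ℝ} {s c : ℝ → ℝ} (h : SinePair μ s c)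
    (hpos : ∀ y, 0 < y → y ≤ L + x₀ → 0 < s y) (hroot : 2 * c L + β * s (L - x₀) = 0)
    (hsmall : β ≤ 0 ∨ ∀ x ∈ Icc 0 x₀, β * x₀ * (s L * s (L - x₀)) ≤ s (L + x) * s (L - x)) :
    Principal L β μ x₀ 0 s c where
  pair := h
  left_mem := ⟨hx₀.le, hL⟩
  right_mem := ⟨le_rfl, hx₀.trans hL⟩
  pos := by rwa [max_eq_left hx₀.le]
  eig := by
    rw [greenFn, min_eq_right hx₀.le, max_eq_left hx₀.le, add_zero]
    linear_combination s L * hroot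
  small := by
    rw [min_eq_right hx₀.le, max_eq_left hx₀.le]
    intro x hx
    have p1 := hpos L (by linarith) (by linarith)
    have p2 := hpos (L - x₀) (by linarith) (by linarith)
    have p3 := hpos (L + x) (by linarith [hx.1]) (by linarith [hx.2])
    have p4 := hpos (L - x) (by linarith [hx.2]) (by linarith [hx.1])
    simp only [greenFn, min_eq_right hx₀.le, max_eq_left hx₀.le, add_zero, min_eq_left hx.2,
      max_eq_right hx.2, min_eq_right hx.1, max_eq_left hx.1]
    rw [zero_sub, abs_neg, abs_of_pos hx₀]
    rcases hsmall with hβ | hs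
    · refine le_trans (b := 0) ?_ (by positivity)
      have : 0 ≤ (s L * s (L - x₀)) ^ 2 * x₀ := by positivity
      nlinarith
    · have := mul_le_mul_of_nonneg_left (hs x hx) (mul_pos p1 p2).le
      linarith

/-- `sin (θ y) / θ`, with value `y` for `θ = 0`. -/
noncomputable def sn (θ y : ℝ) : ℝ := y * Real.sinc (θ * y)

theorem sn_of_ne_zero {θ : ℝ} (hθ : θ ≠ 0) (y : ℝ) : sn θ y = Real.sin (θ * y) / θ := by
  rcases eq_or_ne y 0 with rfl | hy
  · simp [sn]
  · rw [sn, Real.sinc_of_ne_zero (mul_ne_zero hθ hy)]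
    field_simp

theorem sinePair_sn (θ : ℝ) : SinePair (θ ^ 2) (sn θ) (fun y => Real.cos (θ * y)) := by
  rcases eq_or_ne θ 0 with rfl | hθ
  · refine ⟨fun y => ?_, fun y => ?_, by simp [sn], by simp⟩
    · have e : sn 0 = fun y => y := by ext y; simp [sn]
      rw [e]
      simpa using hasDerivAt_id' y
    · simpa using hasDerivAt_const y (1 : ℝ)
  · have hd : ∀ y, HasDerivAt (fun y => θ * y) θ y := fun y => by
      simpa using (hasDerivAt_id y).const_mul θ
    have e : sn θ = fun y => Real.sin (θ * y) / θ := funext (sn_of_ne_zero hθ)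
    refine ⟨fun y => ?_, fun y => ?_, by simp [sn], by simp⟩
    · rw [e]
      refine ((hd y).sin.div_const θ).congr_deriv ?_
      field_simp
    · refine (hd y).cos.congr_deriv ?_
      rw [e]
      field_simp

theorem continuous_sn (y : ℝ) : Continuous fun θ => sn θ y := by
  unfold sn
  have := Real.continuous_sinc
  fun_prop

theorem sn_pos {θ y : ℝ} (hθ : 0 ≤ θ) (hy : 0 < y) (h : θ * y < Real.pi) : 0 < sn θ y := by
  rcases hθ.eq_or_lt with rfl | hθ
  · simpa [sn] using hy
  · rw [sn_of_ne_zero hθ.ne']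
    exact div_pos (Real.sin_pos_of_pos_of_lt_pi (by positivity) h) hθ

/-- Here μ = θ² ≥ 0 with θ in [0, π/(2L)]: the root function equals 2 + β(L − x₀) ≥ 0 at θ = 0, and
at the right end the cosine vanishes. Positivity of s holds since θ(L + x₀) < π. -/
theorem exists_principal_of_nonpos (hx₀ : 0 < x₀) (hL : x₀ < L) (hβ : β ≤ 0)
    (hβ' : -2 ≤ β * (L - x₀)) : ∃ (μ : ℝ) (s c : ℝ → ℝ), Principal L β μ x₀ 0 s c := by
  have hL0 : 0 < L := hx₀.trans hL
  have hpi := Real.pi_pos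
  set F : ℝ → ℝ := fun θ => 2 * Real.cos (θ * L) + β * sn θ (L - x₀) with hF
  have hc : Continuous F := by
    have := continuous_sn (L - x₀)
    fun_prop
  have hb : ∀ θ ∈ Icc 0 (Real.pi / (2 * L)), ∀ y, y ≤ L + x₀ → θ * y < Real.pi := by
    intro θ hθ y hy
    calc θ * y ≤ θ * (L + x₀) := mul_le_mul_of_nonneg_left hy hθ.1
      _ ≤ Real.pi / (2 * L) * (L + x₀) := mul_le_mul_of_nonneg_right hθ.2 (by linarith)
      _ < Real.pi / (2 * L) * (2 * L) := mul_lt_mul_of_pos_left (by linarith) (by positivity)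
      _ = Real.pi := by field_simp
  have h0 : 0 ≤ Real.pi / (2 * L) := by positivity
  have h1 : 0 ≤ F 0 := by
    simp only [hF, sn, zero_mul, Real.cos_zero, Real.sinc_zero]
    linarith
  have h2 : F (Real.pi / (2 * L)) ≤ 0 := by
    have e : Real.pi / (2 * L) * L = Real.pi / 2 := by field_simp
    have := sn_pos h0 (sub_pos.2 hL) (hb _ ⟨h0, le_rfl⟩ (L - x₀) (by linarith))
    simp only [hF, e, Real.cos_pi_div_two]
    nlinarith
  obtain ⟨θ, hθ, hroot⟩ := intermediate_value_Icc' h0 hc.continuousOn ⟨h2, h1⟩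
  exact ⟨_, _, _, Principal.of_root hx₀ hL (sinePair_sn θ)
    (fun y hy hy' => sn_pos hθ.1 hy (hb θ hθ y hy')) hroot (Or.inl hβ)⟩

/-- Strong attraction gives a negative eigenvalue μ = −κ²: the hyperbolic root function is negative
for small κ and nonnegative at κ = −β. Positivity of s is automatic for sinh. -/
theorem exists_principal_of_lt (hx₀ : 0 < x₀) (hL : x₀ < L) (hβ : β * (L - x₀) < -2) :
    ∃ (μ : ℝ) (s c : ℝ → ℝ), Principal L β μ x₀ 0 s c := by
  have hL0 : 0 < L := hx₀.trans hL
  have hd : 0 < L - x₀ := sub_pos.2 hL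
  have hβ0 : β < 0 := by nlinarith
  set F : ℝ → ℝ := fun κ => 2 * Real.cosh (κ * L) + β * (Real.sinh (κ * (L - x₀)) / κ) with hF
  obtain ⟨κ₀, hκ₀, h0⟩ : ∃ κ₀, 0 < κ₀ ∧ F κ₀ < 0 := by
    have hc : Continuous fun κ : ℝ => 2 * Real.cosh (κ * L) + β * (L - x₀) := by
      have := Real.continuous_cosh
      fun_prop
    have h1 : ∀ᶠ κ in 𝓝[>] (0 : ℝ), 2 * Real.cosh (κ * L) + β * (L - x₀) < 0 :=
      ((hc.tendsto 0).eventually (gt_mem_nhds (by simp; linarith))).filter_mono nhdsWithin_le_nhds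
    obtain ⟨κ, h2, h3⟩ := (h1.and self_mem_nhdsWithin).exists
    have h3' : (0 : ℝ) < κ := h3
    refine ⟨κ, h3', ?_⟩
    have h4 : L - x₀ ≤ Real.sinh (κ * (L - x₀)) / κ := by
      rw [le_div_iff₀ h3', mul_comm]
      exact Real.self_le_sinh_iff.2 (by positivity)
    simp only [hF]
    nlinarith
  have h1 : 0 ≤ F (-β) := by
    have hκ : 0 < -β := by linarith
    have h2 : Real.sinh (-β * (L - x₀)) ≤ Real.cosh (-β * L) :=
      (Real.sinh_le_sinh.2 (mul_le_mul_of_nonneg_left (by linarith) hκ.le)).trans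
        (Real.sinh_lt_cosh _).le
    have h3 : β * (Real.sinh (-β * (L - x₀)) / -β) = -Real.sinh (-β * (L - x₀)) := by
      have := hβ0.ne
      field_simp
    have h4 := Real.cosh_pos (-β * L)
    simp only [hF]
    rw [h3]
    linarith
  have hpos : ∀ κ ∈ uIcc κ₀ (-β), 0 < κ := fun κ hκ =>
    (lt_min hκ₀ (by linarith)).trans_le hκ.1
  have hc : ContinuousOn F (uIcc κ₀ (-β)) := by
    have := Real.continuous_cosh
    have := Real.continuous_sinh
    have hne : ∀ κ ∈ uIcc κ₀ (-β), κ ≠ 0 := fun κ hκ => (hpos κ hκ).ne'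
    refine ContinuousOn.add (by fun_prop) (continuousOn_const.mul ?_)
    exact ContinuousOn.div (by fun_prop) continuousOn_id hne
  obtain ⟨κ, hκ, hroot⟩ := intermediate_value_uIcc hc
    (show (0 : ℝ) ∈ uIcc (F κ₀) (F (-β)) from by rw [uIcc_of_le (h0.le.trans h1)]; exact ⟨h0.le, h1⟩)
  have hκ0 := hpos κ hκ
  exact ⟨_, _, _, Principal.of_root hx₀ hL (sinePair_sinh hκ0.ne')
    (fun y hy _ => div_pos (Real.sinh_pos_iff.2 (by positivity)) hκ0) hroot (Or.inl hβ0.le)⟩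

/-- For β > 0 the root moves beyond π/(2L), the value for β = 0, but must stay below π/(L + x₀) to
keep s positive. A fixed θ₁ strictly between the two caps it. -/
theorem exists_principal_of_pos (hx₀ : 0 < x₀) (hL : x₀ < L) : ∃ βp : ℝ, 0 < βp ∧
    ∀ β, 0 < β → β < βp → ∃ (μ : ℝ) (s c : ℝ → ℝ), Principal L β μ x₀ 0 s c := by
  have hL0 : 0 < L := hx₀.trans hL
  have hd : 0 < L - x₀ := sub_pos.2 hL
  have hpi := Real.pi_pos
  set θ₀ := Real.pi / (2 * L) with hθ₀
  obtain ⟨θ₁, h01, h1⟩ : ∃ θ₁, θ₀ < θ₁ ∧ θ₁ < Real.pi / (L + x₀) :=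
    exists_between (div_lt_div_of_pos_left hpi (by linarith) (by linarith))
  have hθ₀pos : 0 < θ₀ := by positivity
  have hθ₁pos : 0 < θ₁ := hθ₀pos.trans h01
  have h1' : θ₁ * (L + x₀) < Real.pi := by rwa [lt_div_iff₀ (by linarith)] at h1
  have e0 : θ₀ * L = Real.pi / 2 := by rw [hθ₀]; field_simp
  have hcos : Real.cos (θ₁ * L) < 0 := by
    refine Real.cos_neg_of_pi_div_two_lt_of_lt ?_ ?_
    · rw [← e0]; exact mul_lt_mul_of_pos_right h01 hL0
    · have : θ₁ * L < θ₁ * (L + x₀) := mul_lt_mul_of_pos_left (by linarith) hθ₁pos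
      linarith
  have hsin : 0 < Real.sin (θ₁ * (L + x₀)) :=
    Real.sin_pos_of_pos_of_lt_pi (by positivity) h1'
  -- The first bound makes the root function nonpositive at θ₁; the second yields the smallness
  -- condition.
  refine ⟨min (-2 * Real.cos (θ₁ * L) / (L - x₀)) (Real.sin (θ₁ * (L + x₀)) / x₀),
    lt_min (div_pos (by linarith) hd) (by positivity), fun β hβ hβp => ?_⟩
  have hb1 : β * (L - x₀) < -2 * Real.cos (θ₁ * L) := by
    rw [← lt_div_iff₀ hd]; exact hβp.trans_le (min_le_left _ _)
  have hb2 : β * x₀ < Real.sin (θ₁ * (L + x₀)) := by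
    rw [← lt_div_iff₀ hx₀]; exact hβp.trans_le (min_le_right _ _)
  set F : ℝ → ℝ := fun θ => 2 * Real.cos (θ * L) + β * sn θ (L - x₀) with hF
  have hc : Continuous F := by
    have := continuous_sn (L - x₀)
    fun_prop
  have hb : ∀ θ ∈ Icc θ₀ θ₁, ∀ y, y ≤ L + x₀ → θ * y < Real.pi := by
    intro θ hθ y hy
    have hθ0 : 0 ≤ θ := hθ₀pos.le.trans hθ.1
    calc θ * y ≤ θ * (L + x₀) := mul_le_mul_of_nonneg_left hy hθ0
      _ ≤ θ₁ * (L + x₀) := mul_le_mul_of_nonneg_right hθ.2 (by linarith)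
      _ < Real.pi := h1'
  have f0 : 0 ≤ F θ₀ := by
    have := sn_pos hθ₀pos.le hd (hb _ ⟨le_rfl, h01.le⟩ (L - x₀) (by linarith))
    simp only [hF, e0, Real.cos_pi_div_two]
    nlinarith
  have f1 : F θ₁ ≤ 0 := by
    have h2 : sn θ₁ (L - x₀) ≤ L - x₀ := by
      have := mul_le_mul_of_nonneg_left (Real.sinc_le_one (θ₁ * (L - x₀))) hd.le
      simpa [sn] using this
    have := mul_le_mul_of_nonneg_left h2 hβ.le
    simp only [hF]
    linarith
  obtain ⟨θ, hθ, hroot⟩ := intermediate_value_Icc' h01.le hc.continuousOn ⟨f1, f0⟩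
  have hθpos : 0 < θ := hθ₀pos.trans_le hθ.1
  refine ⟨_, _, _, Principal.of_root hx₀ hL (sinePair_sn θ)
    (fun y hy hy' => sn_pos hθpos.le hy (hb θ hθ y hy')) hroot (Or.inr fun x hx => ?_)⟩
  simp only [sn_of_ne_zero hθpos.ne']
  have s1 : 0 < Real.sin (θ * (L - x₀)) :=
    Real.sin_pos_of_pos_of_lt_pi (by positivity) (hb θ hθ _ (by linarith))
  have s2 : Real.sin (θ₁ * (L + x₀)) ≤ Real.sin (θ * (L + x₀)) := by
    have h2 : Real.pi / 2 ≤ θ * (L + x₀) := by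
      rw [← e0]
      exact mul_le_mul hθ.1 (by linarith) hL0.le hθpos.le
    rw [← Real.sin_pi_sub, ← Real.sin_pi_sub (θ * (L + x₀))]
    refine Real.sin_le_sin_of_le_of_le_pi_div_two (by linarith) (by linarith) ?_
    have := mul_le_mul_of_nonneg_right hθ.2 (show 0 ≤ L + x₀ by linarith)
    linarith
  -- The product equals cos²(θx) − cos²(θL), which decreases on [0, x₀].
  have s3 : Real.sin (θ * (L + x₀)) * Real.sin (θ * (L - x₀)) ≤
      Real.sin (θ * (L + x)) * Real.sin (θ * (L - x)) := by
    have prod : ∀ z, Real.sin (θ * (L + z)) * Real.sin (θ * (L - z)) =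
        Real.cos (θ * z) ^ 2 - Real.cos (θ * L) ^ 2 := fun z => by
      rw [mul_add, mul_sub, Real.sin_add, Real.sin_sub]
      linear_combination Real.cos (θ * z) ^ 2 * Real.sin_sq_add_cos_sq (θ * L) -
        Real.cos (θ * L) ^ 2 * Real.sin_sq_add_cos_sq (θ * z)
    rw [prod, prod]
    have h3 : θ * x₀ ≤ Real.pi / 2 := by
      have h4 := hb θ hθ (L + x₀) le_rfl
      have h5 : θ * x₀ ≤ θ * L := mul_le_mul_of_nonneg_left hL.le hθpos.le
      linarith
    have h6 : Real.cos (θ * x₀) ≤ Real.cos (θ * x) :=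
      Real.cos_le_cos_of_nonneg_of_le_pi (mul_nonneg hθpos.le hx.1) (by linarith)
        (mul_le_mul_of_nonneg_left hx.2 hθpos.le)
    have h7 : 0 ≤ Real.cos (θ * x₀) :=
      Real.cos_nonneg_of_neg_pi_div_two_le_of_le (by have := mul_pos hθpos hx₀; linarith) h3
    have := pow_le_pow_left₀ h7 h6 2
    linarith
  have s4 : β * x₀ * (Real.sin (θ * L) * Real.sin (θ * (L - x₀))) ≤
      Real.sin (θ * (L + x)) * Real.sin (θ * (L - x)) := by
    refine le_trans ?_ s3
    have h2 : β * x₀ * Real.sin (θ * L) ≤ Real.sin (θ * (L + x₀)) :=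
      (mul_le_of_le_one_right (by positivity) (Real.sin_le_one _)).trans (hb2.le.trans s2)
    have := mul_le_mul_of_nonneg_right h2 s1.le
    linarith
  rw [div_mul_div_comm, div_mul_div_comm, mul_div_assoc']
  gcongr

end

end PointHeat


/-! ### The main theorem -/

theorem proposition3p1 (L x₀ : ℝ) (hx₀ : 0 < x₀) (hL : x₀ < L) :
    ∃ T : ℝ → ℝ≥0 → Hm1 L →L[ℂ] Hm1 L,
      (∀ β, IsAnalyticSemigroup (X := Hm1 L) (T β) ∧ IsGenerator (X := Hm1 L) (-unbddA L x₀ β) (T β)) ∧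
      (∀ β, IsPositive (T β) ↔ β ≤ 0) ∧
      ∃ βp : ℝ, 0 < βp ∧
        (∀ β < βp, ∃ μ : ℝ, ∃ φ ψ : H10 L,
          IsFirstEigenpair (opAβ L x₀ β) μ φ ∧ PosH10 φ ∧
          IsFirstEigenpair (opAβ' L x₀ β) μ ψ ∧ PosH10 ψ) ∧
        (∀ β, 0 < β → β < βp → IsIndividuallyEventuallyPositive (T β)) := by
  have hL0 : 0 < L := hx₀.trans hL
  have hx : x₀ ∈ Ioo (-L) L := ⟨by linarith, hL⟩
  obtain ⟨βp, hβp, hpos⟩ := exists_principal_of_pos hx₀ hL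
  refine ⟨heat L x₀, fun β => ⟨isAnalyticSemigroup_heat hL0 hx β, isGenerator_heat hL0 hx β⟩,
    fun β => ⟨fun h => ?_, isPositive_heat hx₀ hL⟩, βp, hβp, fun β hβ => ?_, fun β h0 h1 => ?_⟩
  · by_contra hβ
    exact not_isPositive_heat hx₀ hL (not_le.1 hβ) h
  · obtain ⟨μ, s, c, P⟩ : ∃ (μ : ℝ) (s c : ℝ → ℝ), Principal L β μ x₀ 0 s c := by
      -- The three cases are μ > 0 slightly above the Dirichlet value, μ < 0, and μ between 0 and
      -- the Dirichlet value.
      rcases lt_or_ge 0 β with h0 | h0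
      · exact hpos β h0 hβ
      rcases lt_or_ge (β * (L - x₀)) (-2) with h1 | h1
      · exact exists_principal_of_lt hx₀ hL h1
      · exact exists_principal_of_nonpos hx₀ hL h0 h1
    obtain ⟨φ, -, φ2, φ3⟩ := P.exists_ground
    obtain ⟨ψ, -, ψ2, ψ3⟩ := P.symm.exists_ground
    refine ⟨μ, φ, ψ, P.isFirstEigenpair (opAβ_apply L x₀ β) φ2 φ3, φ2,
      P.symm.isFirstEigenpair (fun u v => ?_) ψ2 ψ3, ψ2⟩
    rw [opAβ', ContinuousLinearMap.flip_apply, opAβ_apply, opA_comm]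
    ring
  · obtain ⟨μ, s, c, P⟩ := hpos β h0 h1
    exact isIndividuallyEventuallyPositive_heat hx₀ hL h0.le P
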